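/- **Setting.** Let $S\subset\mathbb R^n$ be unbounded and locally compact with $0\in S$, let $E=S\cup\{\infty\}$ be its one-point compactification with its Borel $\sigma$-field, put $\mathring E=\mathring S\setminus\{0\}$ ($\mathring S$ the interior of $S$ in $\mathbb R^n$) and $\partial E=E\setminus\mathring E$. A *standard process* on $E$ is a strong Markov process $(X_t,\mathbb P_x)_{x\in E}$, $\mathbb P_x(X_0=x)=1$, with respect to a right-continuous filtration, with Borel transition functions and right-continuous paths with left limits in $E$, absorbed at the first point of $\partial E$ that it visits, and quasi-left-continuous on $[0,\zeta)$, $\zeta=\inf\{t>0:X_t\notin\mathring E\}$. For a set $D$ let $\tau_D=\inf\{t>0:X_t\notin D\}$. For an open $D\subset \mathring E$: * a Borel $f:E\to\mathbb R$ is *regular harmonic on $D$* if $\mathbb E_x(f(X_{\tau_D}),\tau_D<\infty)=f(x)$ for all $x\in D$ (the expectation existing and being finite), and *harmonic on $D$* if this holds with $B$ in place of $D$, for every open $B$ with $\overline B\subset D$ (closure in $E$; such $B$ are automatically bounded) and every $x\in B$; * a Borel $f:E\to[-\infty,\infty]$ is *superharmonic on $D$* if, for every open $B$ with $\overline B\subset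 D$ and every $x\in B$, the negative part of $f(X_{\tau_B})1_{\tau_B<\infty}$ is $\mathbb P_x$-integrable and $\mathbb E_x(f(X_{\tau_B}),\tau_B<\infty)\le f(x)$; * $f:D\to[0,\infty]$ Borel is *excessive on $D$* if $\mathbb E_x(f(X_t),t<\tau_D)\le f(x)$ for all $t\ge 0$, $x\in D$, with $\lim_{t\to0+}\mathbb E_x(f(X_t),t<\tau_D)=f(x)$. A standard process $X$ has the *dual inversion property* with characteristics $(I,\hat h,v,m)$ and dual process $\hat X$ if: $\hat X$ is a standard process on $E$; $m$ is a $\sigma$-finite measure on $E$ that is a reference measure for $X$ on $\mathring E$ (a Borel set $A\subset\mathring E$ is $m$-null if and only if $\int_0^\infty\mathbb P_x(X_t\in A)\,dt=0$ for all $x\in\mathring E$); $X$ and $\hat X$ are in weak duality, $\int g\,P_tf\,dm=\int f\,\hat P_tg\,dm$ for all $t\ge0$ and all Borel $f,g\ge0$ vanishing on $\partial E$; $I\ne\mathrm{Id}$ is a Borel involution of $E$; $\hat h:E\to[0,\infty)$ is $\hat X$-harmonic on $\mathring E$, positive on $\mathring E$ and $0$ on $\partial E$; $v$ is positive and continuous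 on $\mathring E$; and for every $x\in E$ the process $(I(X_{\gamma_t}))_{t<A_\zeta}$ under $\mathbb P_x$ has the same finite-dimensional distributions as $\hat X^{\hat h}$ started at $I(x)$. Here $A_t=\int_0^{t\wedge\zeta}v(X_s)^{-1}ds$, $\gamma_t=\inf\{s:A_s>t\}$, and $\hat X^{\hat h}$ is the Doob transform, i.e. the Markov process with lifetime whose transition kernels are $\frac{\hat h(y)}{\hat h(x)}\hat Q_t(x,dy)$ for $\hat h(x)>0$ and $0$ otherwise, $\hat Q_t$ being the semigroup of $\hat X$ killed when it exits $\{\hat h>0\}$. **Theorem.** Suppose that $X$ has the dual inversion property with characteristics $(I,\hat h,v,m)$ and dual process $\hat X$. Put $\hat{\mathcal K}f(x)=\hat h(x)f(I(x))$ and let $D\subset\mathring E$ be open. 1. If $I(D)$ is open, $f$ vanishes on $\partial E$ and $f$ is regular harmonic on $D$ for $X$, then $\hat{\mathcal K}f$ is regular harmonic on $I(D)$ for $\hat X$. 2. If $I$ is continuous on $\mathring E$, $f$ vanishes on $\partial E$ and $f$ is superharmonic on $D$ for $X$, then $\hat{\mathcal K}f$ is superharmonic on $I(D)$ for $\hat X$.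 3. If $I$ and $\hat h$ are continuous on $\mathring E$ and $f:D\to[0,\infty]$ is continuous and excessive on $D$ for $X$, then $\hat{\mathcal K}f$ is excessive on $I(D)$ for $\hat X$. -/

import Mathlib

open MeasureTheory Filter Topology Set
open scoped NNReal ENNReal

noncomputable section

namespace KelvinDuality

/-! ## The state space -/

/-- The interior of the state space `E = S ∪ {∞}` (the one-point compactification of
`S ⊆ ℝⁿ`): the points of `interior S` other than `0`.  Its complement in `E`, written `∂E`, consists
of `∞`, `0` and the points of `S` that are not interior. -/
def stateInterior {n : ℕ} (S : Set (EuclideanSpace ℝ (Fin n))) : Set (OnePoint S) :=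
  {z | ∃ p : S, (p : EuclideanSpace ℝ (Fin n)) ∈ interior S ∧
    (p : EuclideanSpace ℝ (Fin n)) ≠ 0 ∧ z = (p : OnePoint S)}

/-- The one-point compactification carries its Borel σ-algebra. -/
instance instMeasurableSpaceState {n : ℕ} (S : Set (EuclideanSpace ℝ (Fin n))) :
    MeasurableSpace (OnePoint S) := borel _

instance instBorelSpaceState {n : ℕ} (S : Set (EuclideanSpace ℝ (Fin n))) :
    BorelSpace (OnePoint S) := ⟨rfl⟩

/-! ## Exit times and standard processes -/

/-- First exit time `τ_D = inf {t > 0 : X_t ∉ D}`, equal to `∞` if there is no such `t`. -/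
def exitTime {E Ω : Type*} (X : ℝ≥0 → Ω → E) (D : Set E) (ω : Ω) : ℝ≥0∞ :=
  ⨅ (t : ℝ≥0) (_ : 0 < t ∧ X t ω ∉ D), (t : ℝ≥0∞)

/-- The random variable `f(X_{τ_D}) 1_{τ_D < ∞}`. -/
def atExit {E Ω β : Type*} [Zero β] (X : ℝ≥0 → Ω → E) (D : Set E) (f : E → β) : Ω → β :=
  {ω | exitTime X D ω < ⊤}.indicator fun ω => f (X (exitTime X D ω).toNNReal ω)

/-- A standard Markov process with state space `E`, absorbed outside the open set `E₀` (the
interior of the state space).  Its lifetime is `exitTime X E₀`. -/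
structure StandardProcess (E : Type*) [TopologicalSpace E] [MeasurableSpace E] (E₀ : Set E)
    (Ω : Type*) [mΩ : MeasurableSpace Ω] where
  /-- the filtration -/
  ℱ : Filtration ℝ≥0 mΩ
  /-- the paths -/
  X : ℝ≥0 → Ω → E
  /-- the law of the process started at a point -/
  P : E → Measure Ω
  prob : ∀ x, IsProbabilityMeasure (P x)
  right_continuous_filtration : ∀ t, (⨅ s > t, ℱ s) ≤ ℱ t
  adapted : ∀ t, Measurable[ℱ t] (X t)
  measurable_transition : ∀ t (B : Set E), MeasurableSet B → Measurable fun x => P x (X t ⁻¹' B)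
  start : ∀ x, ∀ᵐ ω ∂(P x), X 0 ω = x
  right_continuous : ∀ ω t, Tendsto (fun s => X s ω) (𝓝[>] t) (𝓝 (X t ω))
  left_limits : ∀ ω t, 0 < t → ∃ l, Tendsto (fun s => X s ω) (𝓝[<] t) (𝓝 l)
  /-- paths are constant after leaving `E₀` -/
  absorbed : ∀ ω s t, s ≤ t → X s ω ∉ E₀ → X t ω = X s ω
  strong_markov : ∀ (τ : Ω → ℝ≥0∞) (hτ : IsStoppingTime ℱ τ) (x : E) (t : ℝ≥0) (B : Set E)
    (L : Set Ω), MeasurableSet B → MeasurableSet[IsStoppingTime.measurableSpace hτ] L →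
    P x (L ∩ {ω | τ ω < ⊤ ∧ X ((τ ω).toNNReal + t) ω ∈ B}) =
      ∫⁻ ω in L ∩ {ω | τ ω < ⊤}, P (X (τ ω).toNNReal ω) (X t ⁻¹' B) ∂(P x)
  /-- quasi-left continuity on `[0, ζ)` -/
  quasi_left_continuous : ∀ (τ : ℕ → Ω → ℝ≥0∞), (∀ k, IsStoppingTime ℱ (τ k)) →
    (∀ ω, Monotone fun k => τ k ω) → ∀ x, ∀ᵐ ω ∂(P x), (⨆ k, τ k ω) < exitTime X E₀ ω →
      Tendsto (fun k => X (τ k ω).toNNReal ω) atTop (𝓝 (X (⨆ k, τ k ω).toNNReal ω))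

/-! ## Harmonic, superharmonic and excessive functions -/

section Functions

variable {E : Type*} [TopologicalSpace E] [MeasurableSpace E] {E₀ : Set E}
  {Ω : Type*} [MeasurableSpace Ω]

/-- `f` is regular harmonic on `D`: `E_x (f(X_{τ_D}), τ_D < ∞) = f(x)` for `x ∈ D`, where the
expectation exists and is finite. -/
def RegularHarmonicOn (Z : StandardProcess E E₀ Ω) (D : Set E) (f : E → ℝ) : Prop :=
  Measurable f ∧ ∀ x ∈ D, Integrable (atExit Z.X D f) (Z.P x) ∧
    ∫ ω, atExit Z.X D f ω ∂(Z.P x) = f x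

/-- `f` is harmonic on `D`: `E_x (f(X_{τ_B}), τ_B < ∞) = f(x)` for all open `B` with closure in
`D` and all `x ∈ B`.  (The closure is taken in the compact space `E`, so that for `D` inside the
interior of the state space such a `B` is automatically bounded.) -/
def HarmonicOn (Z : StandardProcess E E₀ Ω) (D : Set E) (f : E → ℝ) : Prop :=
  Measurable f ∧ ∀ B, IsOpen B → closure B ⊆ D → ∀ x ∈ B,
    Integrable (atExit Z.X B f) (Z.P x) ∧ ∫ ω, atExit Z.X B f ω ∂(Z.P x) = f x

/-- `f`, with extended real values, is superharmonic on `D`: for all open `B` with closure in `D`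
and all `x ∈ B` the negative part of `f(X_{τ_B}) 1_{τ_B < ∞}` has finite expectation and
`E_x (f(X_{τ_B}), τ_B < ∞) ≤ f(x)`, the expectation being that of the positive part minus that
of the negative part. -/
def SuperharmonicOn (Z : StandardProcess E E₀ Ω) (D : Set E) (f : E → EReal) : Prop :=
  Measurable f ∧ ∀ B, IsOpen B → closure B ⊆ D → ∀ x ∈ B,
    (∫⁻ ω, (-atExit Z.X B f ω).toENNReal ∂(Z.P x)) < ⊤ ∧
    ((∫⁻ ω, (atExit Z.X B f ω).toENNReal ∂(Z.P x) : ℝ≥0∞) : EReal) -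
      ((∫⁻ ω, (-atExit Z.X B f ω).toENNReal ∂(Z.P x) : ℝ≥0∞) : EReal) ≤ f x

/-- `E_x (f(X_t), t < τ_D)`: the semigroup of the process killed when it exits `D`. -/
def killedExpect (Z : StandardProcess E E₀ Ω) (D : Set E) (f : E → ℝ≥0∞) (t : ℝ≥0) (x : E) :
    ℝ≥0∞ :=
  ∫⁻ ω, {ω | (t : ℝ≥0∞) < exitTime Z.X D ω}.indicator (fun ω => f (Z.X t ω)) ω ∂(Z.P x)

/-- `f ≥ 0` is excessive on `D`, i.e. excessive for the process killed when it exits `D`. -/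
def ExcessiveOn (Z : StandardProcess E E₀ Ω) (D : Set E) (f : E → ℝ≥0∞) : Prop :=
  Measurable (D.indicator f) ∧ ∀ x ∈ D,
    (∀ t, killedExpect Z D f t x ≤ f x) ∧
    Tendsto (fun t => killedExpect Z D f t x) (𝓝[>] 0) (𝓝 (f x))

/-! ## Doob transform -/

/-- Transition kernels of the Doob `h`-transform for a finite `h ≥ 0`:
`P^h_t(x, dy) = (h(y) / h(x)) Q_t(x, dy)` if `x ∈ E_h = {h > 0}`, and `0` otherwise; here `Q` is
the semigroup of the process killed when it exits `E_h`. -/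
def doobKernel (Z : StandardProcess E E₀ Ω) (h : E → ℝ) (t : ℝ≥0) (x : E) : Measure E :=
  open Classical in
  if 0 < h x then
    ((((Z.P x).restrict {ω | (t : ℝ≥0∞) < exitTime Z.X {y | 0 < h y} ω}).map (Z.X t)).withDensity
      fun y => ENNReal.ofReal (h y / h x))
  else 0

/-- Finite-dimensional distributions of the Markov process with transition kernels `K` started
at `x`.  For a list `[(s₁, B₁), …, (s_k, B_k)]` this is the mass of the event that the process is
alive and in `B_i` at time `s₁ + ⋯ + s_i`, for `i = 1, …, k`. -/
def markovFdd (K : ℝ≥0 → E → Measure E) : E → List (ℝ≥0 × Set E) → ℝ≥0∞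
  | _, [] => 1
  | x, (s, B) :: l => ∫⁻ y in B, markovFdd K y l ∂(K s x)

/-- The event that a process `Y` with lifetime (`none` is the cemetery) is alive and in `B_i` at
time `r + s₁ + ⋯ + s_i`, for `i = 1, …, k`. -/
def fddEvent (Y : ℝ≥0 → Ω → Option E) : ℝ≥0 → List (ℝ≥0 × Set E) → Set Ω
  | _, [] => univ
  | r, (s, B) :: l => {ω | ∃ y ∈ B, Y (r + s) ω = some y} ∩ fddEvent Y (r + s) l

/-! ## Time change -/

/-- The additive functional `A_t = ∫₀ᵗ v(X_s)⁻¹ ds`, stopped at the lifetime of the process. -/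
def clock (Z : StandardProcess E E₀ Ω) (v : E → ℝ) (t : ℝ≥0) (ω : Ω) : ℝ≥0∞ :=
  ∫⁻ s in Icc (0 : ℝ) t,
    E₀.indicator (fun y => ENNReal.ofReal (v y)⁻¹) (Z.X s.toNNReal ω)

/-- The inverse `γ_t = inf {s : A_s > t}` of the additive functional; it is finite exactly
for `t < A_ζ`. -/
def invClock (Z : StandardProcess E E₀ Ω) (v : E → ℝ) (t : ℝ≥0) (ω : Ω) : ℝ≥0∞ :=
  ⨅ (s : ℝ≥0) (_ : (t : ℝ≥0∞) < clock Z v s ω), (s : ℝ≥0∞)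

/-- The process `I(X_{γ_t})`, alive for `t < A_ζ`. -/
def invertedProcess (Z : StandardProcess E E₀ Ω) (I : E → E) (v : E → ℝ) (t : ℝ≥0) (ω : Ω) :
    Option E :=
  open Classical in
  if invClock Z v t ω < ⊤ then some (I (Z.X (invClock Z v t ω).toNNReal ω)) else none

/-! ## Weak duality and the dual inversion property -/

/-- `m` is a reference measure (on the interior `E₀` of the state space): the Borel sets of
potential zero are exactly the `m`-null ones. -/
def IsReferenceMeasure (Z : StandardProcess E E₀ Ω) (m : Measure E) : Prop :=
  ∀ A, MeasurableSet A → A ⊆ E₀ →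
    ((∀ x ∈ E₀, ∫⁻ t in Ici (0 : ℝ), Z.P x (Z.X t.toNNReal ⁻¹' A) = 0) ↔ m A = 0)

/-- Weak duality of two processes with respect to `m`:
`∫ g P_t f dm = ∫ f P̂_t g dm` for all nonnegative Borel functions `f, g` that vanish outside
the interior of the state space. -/
def WeakDuality {Ω' : Type*} [MeasurableSpace Ω'] (Z : StandardProcess E E₀ Ω)
    (Z' : StandardProcess E E₀ Ω') (m : Measure E) : Prop :=
  ∀ f g : E → ℝ≥0∞, Measurable f → Measurable g → (∀ x ∉ E₀, f x = 0) → (∀ x ∉ E₀, g x = 0) →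
    ∀ t, ∫⁻ x, g x * (∫⁻ ω, f (Z.X t ω) ∂(Z.P x)) ∂m =
      ∫⁻ x, f x * (∫⁻ ω, g (Z'.X t ω) ∂(Z'.P x)) ∂m

/-- `X = Z` has the dual inversion property with dual process `X̂ = Z'` and characteristics
`(I, h, v, m)`. -/
structure DualInversionProperty {Ω' : Type*} [MeasurableSpace Ω'] (Z : StandardProcess E E₀ Ω)
    (Z' : StandardProcess E E₀ Ω') (I : E → E) (h v : E → ℝ) (m : Measure E) : Prop where
  involutive : Function.Involutive I
  ne_id : I ≠ id
  measurable_I : Measurable I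
  harmonic : HarmonicOn Z' E₀ h
  pos : ∀ x ∈ E₀, 0 < h x
  zero_boundary : ∀ x ∉ E₀, h x = 0
  v_pos : ∀ x ∈ E₀, 0 < v x
  v_continuous : ContinuousOn v E₀
  sigmaFinite : SigmaFinite m
  reference : IsReferenceMeasure Z m
  duality : WeakDuality Z Z' m
  /-- `(I(X_{γ_t}), ℙ_x)` and the Doob transform of `X̂` started at `I(x)` have the same law. -/
  law : ∀ x (l : List (ℝ≥0 × Set E)), (∀ p ∈ l, MeasurableSet p.2) →
    Z.P x (fddEvent (invertedProcess Z I v) 0 l) = markovFdd (doobKernel Z' h) (I x) l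

end Functions

end KelvinDuality

end

namespace KelvinDuality

/-! ## Topology of the state space -/

section StateSpace

variable {n : ℕ} (S : Set (EuclideanSpace ℝ (Fin n)))

/-! The Doob transform by `h` changes the law of the dual process up to a fixed time `u` by the
density `h(X̂_u)/h(X̂_0)`. The inversion property therefore says that, for a functional `F` of the
path up to time `u`, the `h(X̂_u)`-weighted expectation of `F(X̂)` from `I x` is `h(I x)` times the
expectation of `F(I(X_γ))` from `x` on the event that the time-changed process is alive at `u`
(`change_of_measure`). Everything follows once this identity is available at exit times.

To pass from `u` to a random time `T` determined by the path, integrate over shifts: after the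
substitution `u = T + s`, Fubini reduces the identity at `T + s`, for almost every `s`, to the
identity at fixed times. Then `s` decreases to `0`. For continuous bounded test functions the
time-changed side converges by right-continuity. On the dual side the strong Markov property at `T`
leaves the expectation of `h(X̂_s) φ(I X̂_s)` from the point `X̂_T`, and its limit is again read off
from the time-changed process. A measure-determining argument gives Borel test functions
(`lintegral_exit_eq`).

Exit times become path functionals through `pathExit`, which uses rational times and an exhaustion
by closed sets and agrees with the exit time almost surely by quasi-left-continuity. The strictly
increasing clock carries exit of `X` from `B` to exit of `X_γ` from `B`. On the dual side, exit
through the merely Borel sets `I ⁻¹' K n` must be identified with exit from `I '' B`; it suffices to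
do this where `h` is positive. The outcome is `lintegral_atExit`: the exit expectation of the Kelvin
transform is `h(I x)` times that of the original function. The first two claims follow by applying
it to positive and negative parts.

For excessive functions the same tools express the killed semigroup of the dual as `h(I x)` times
the expectation, at the stopping time `γ_t`, of `M_s = f(X_s) 1_{s < τ_D}` (`killedExpect_dual`).
Since `M` is a supermartingale, lower semicontinuous from the right, optional stopping gives the
inequality and Fatou's lemma the limit at `0`. -/

lemma isOpen_stateInterior : IsOpen (stateInterior S) := by
  have : stateInterior S = ((↑) : S → OnePoint S) ''
      {p : S | (p : EuclideanSpace ℝ (Fin n)) ∈ interior S ∧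
        (p : EuclideanSpace ℝ (Fin n)) ≠ 0} := by
    ext z
    simp only [stateInterior, mem_ofPred_eq, mem_image]
    constructor
    · rintro ⟨p, h1, h2, rfl⟩; exact ⟨p, ⟨h1, h2⟩, rfl⟩
    · rintro ⟨p, ⟨h1, h2⟩, rfl⟩; exact ⟨p, h1, h2, rfl⟩
  rw [this, OnePoint.isOpen_image_coe]
  exact (isOpen_interior.preimage continuous_subtype_val).inter
    (isOpen_ne.preimage continuous_subtype_val)

end StateSpace

/-- The one-point compactification of a second countable locally compact Hausdorff space is second
countable. -/
lemma secondCountableTopology_onePoint {X : Type*} [TopologicalSpace X] [T2Space X]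
    [LocallyCompactSpace X] [SecondCountableTopology X] :
    SecondCountableTopology (OnePoint X) := by
  let K := CompactExhaustion.choice X
  let b := TopologicalSpace.countableBasis X
  -- The complements of the compacts of an exhaustion are a countable neighbourhood base at
  -- infinity.
  let s : Set (Set (OnePoint X)) :=
    (fun u : Set X => ((↑) : X → OnePoint X) '' u) '' b ∪
      range fun n => (((↑) : X → OnePoint X) '' (K n))ᶜ
  have hs : TopologicalSpace.IsTopologicalBasis s := by
    apply TopologicalSpace.isTopologicalBasis_of_isOpen_of_nhds
    · rintro u (⟨v, hv, rfl⟩ | ⟨n, rfl⟩)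
      · exact OnePoint.isOpen_image_coe.2 (TopologicalSpace.isOpen_of_mem_countableBasis hv)
      · exact OnePoint.isOpen_compl_image_coe.2 ⟨(K.isCompact n).isClosed, K.isCompact n⟩
    · intro a u ha hu
      induction a using OnePoint.rec with
      | infty =>
        have h1 := (OnePoint.isOpen_iff_of_mem ha).1 hu
        obtain ⟨n, hn⟩ := K.exists_superset_of_isCompact h1.2
        refine ⟨_, Or.inr ⟨n, rfl⟩, by simp, ?_⟩
        intro z hz
        induction z using OnePoint.rec with
        | infty => exact ha
        | coe z =>
          by_contra hzu
          exact hz ⟨z, hn hzu, rfl⟩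
      | coe a =>
        have h1 : IsOpen (((↑) : X → OnePoint X) ⁻¹' u) := hu.preimage OnePoint.continuous_coe
        obtain ⟨v, hv, hav, hvu⟩ :=
          (TopologicalSpace.isBasis_countableBasis X).exists_subset_of_mem_open ha h1
        exact ⟨_, Or.inl ⟨v, hv, rfl⟩, ⟨a, hav, rfl⟩, by rintro _ ⟨z, hz, rfl⟩; exact hvu hz⟩
  exact hs.secondCountableTopology
    (((TopologicalSpace.countable_countableBasis X).image _).union (countable_range _))

/-- `K` is an increasing sequence of closed subsets of `D` whose interiors cover `D`. -/
structure IsExhaustion {E : Type*} [TopologicalSpace E] (K : ℕ → Set E) (D : Set E) : Prop where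
  closed : ∀ n, IsClosed (K n)
  mono : Monotone K
  subset : ∀ n, K n ⊆ D
  exists_mem : ∀ x ∈ D, ∃ n, x ∈ interior (K n)

/-- The `n`-th set consists of the points at distance at least `1/(n+1)` from the complement of `D`.
-/
lemma exists_isExhaustion {E : Type*} [TopologicalSpace E] [TopologicalSpace.MetrizableSpace E]
    {D : Set E} (hD : IsOpen D) : ∃ K : ℕ → Set E, IsExhaustion K D := by
  let _ := TopologicalSpace.metrizableSpaceMetric E
  refine ⟨fun n => {x | ((n : ℝ≥0∞) + 1)⁻¹ ≤ Metric.infEDist x Dᶜ}, ?_, ?_, ?_, ?_⟩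
  · intro n
    exact isClosed_le continuous_const Metric.continuous_infEDist
  · intro i j hij x hx
    refine le_trans (ENNReal.inv_le_inv.2 ?_) (show ((i : ℝ≥0∞) + 1)⁻¹ ≤ _ from hx)
    gcongr
  · intro n x hx
    by_contra hxD
    have : Metric.infEDist x Dᶜ = 0 := Metric.infEDist_zero_of_mem hxD
    simp only [mem_ofPred_eq, this, nonpos_iff_eq_zero, ENNReal.inv_eq_zero] at hx
    exact ENNReal.add_ne_top.2 ⟨ENNReal.natCast_ne_top n, ENNReal.one_ne_top⟩ hx
  · intro x hx
    have h0 : 0 < Metric.infEDist x Dᶜ := by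
      rw [pos_iff_ne_zero]
      intro h
      have := (Metric.mem_closure_iff_infEDist_zero).2 h
      rw [hD.isClosed_compl.closure_eq] at this
      exact this hx
    obtain ⟨n, hn⟩ := ENNReal.exists_inv_nat_lt h0.ne'
    refine ⟨n, mem_interior.2 ⟨{z | ((n : ℝ≥0∞) + 1)⁻¹ < Metric.infEDist z Dᶜ},
      fun z hz => by rw [mem_ofPred_eq] at hz ⊢; exact hz.le,
      isOpen_lt continuous_const Metric.continuous_infEDist, ?_⟩⟩
    refine lt_of_le_of_lt (ENNReal.inv_le_inv.2 ?_) hn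
    exact le_self_add

/-! ## Dyadic approximation of times from the right -/

/-- The first dyadic number of rank `k` strictly after `t`. -/
noncomputable def dyadicAfter (k : ℕ) (t : ℝ≥0) : ℝ≥0 := (⌊2 ^ k * t⌋₊ + 1) / 2 ^ k

lemma lt_dyadicAfter (k : ℕ) (t : ℝ≥0) : t < dyadicAfter k t := by
  rw [dyadicAfter, lt_div_iff₀ (by positivity), mul_comm]
  exact Nat.lt_floor_add_one _

lemma dyadicAfter_le (k : ℕ) (t : ℝ≥0) : dyadicAfter k t ≤ t + (1 / 2) ^ k := by
  rw [dyadicAfter, div_le_iff₀ (by positivity), add_mul, ← mul_pow]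
  have : (⌊2 ^ k * t⌋₊ : ℝ≥0) ≤ 2 ^ k * t := Nat.floor_le (by positivity)
  simpa [mul_comm] using this

lemma tendsto_dyadicAfter (t : ℝ≥0) : Tendsto (fun k => dyadicAfter k t) atTop (𝓝[>] t) := by
  refine tendsto_nhdsWithin_iff.2 ⟨?_, Eventually.of_forall fun k => lt_dyadicAfter k t⟩
  refine tendsto_of_tendsto_of_tendsto_of_le_of_le tendsto_const_nhds ?_
    (fun k => (lt_dyadicAfter k t).le) (fun k => dyadicAfter_le k t)
  have : Tendsto (fun k : ℕ => ((1 / 2 : ℝ≥0)) ^ k) atTop (𝓝 0) :=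
    tendsto_pow_atTop_nhds_zero_of_lt_one (by positivity)
      (by rw [div_lt_one (by norm_num)]; norm_num)
  simpa using tendsto_const_nhds.add this

/-- A right-continuous process is jointly measurable. -/
lemma measurable_uncurry_of_rightContinuous {Ω β : Type*} [MeasurableSpace Ω]
    [TopologicalSpace β] [TopologicalSpace.PseudoMetrizableSpace β] [MeasurableSpace β]
    [BorelSpace β] {X : ℝ≥0 → Ω → β} (hX : ∀ t, Measurable (X t))
    (hr : ∀ ω t, Tendsto (fun s => X s ω) (𝓝[>] t) (𝓝 (X t ω))) :
    Measurable fun p : ℝ≥0 × Ω => X p.1 p.2 := by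
  refine measurable_of_tendsto_metrizable (f := fun k p => X (dyadicAfter k p.1) p.2) ?_ ?_
  · intro k
    have h0 : ∀ g : ℕ → ℝ≥0, Measurable fun q : ℕ × Ω => X (g q.1) q.2 := fun g =>
      measurable_from_prod_countable_right (fun j => hX (g j))
    have h2 : Measurable fun p : ℝ≥0 × Ω => (⌊2 ^ k * p.1⌋₊, p.2) :=
      (Nat.measurable_floor.comp (measurable_const.mul measurable_fst)).prodMk measurable_snd
    obtain ⟨g, hg⟩ : ∃ g : ℕ → ℝ≥0, ∀ t, dyadicAfter k t = g ⌊2 ^ k * t⌋₊ :=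
      ⟨fun j => (j + 1) / 2 ^ k, fun t => rfl⟩
    simp_rw [hg]
    exact (h0 g).comp h2
  · rw [tendsto_pi_nhds]
    intro p
    exact (hr p.2 p.1).comp (tendsto_dyadicAfter p.1)

/-! ## Exit times along a path -/

section Paths

variable {E Ω : Type*} {X : ℝ≥0 → Ω → E} {D : Set E} {ω : Ω}

lemma exitTime_le {t : ℝ≥0} (ht : 0 < t) (h : X t ω ∉ D) : exitTime X D ω ≤ t :=
  iInf₂_le t ⟨ht, h⟩

lemma mem_of_lt_exitTime {t : ℝ≥0} (ht : 0 < t) (h : (t : ℝ≥0∞) < exitTime X D ω) : X t ω ∈ D := by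
  by_contra hX
  exact (exitTime_le ht hX).not_gt h

lemma exists_of_exitTime_lt {c : ℝ≥0∞} (h : exitTime X D ω < c) :
    ∃ t : ℝ≥0, 0 < t ∧ X t ω ∉ D ∧ (t : ℝ≥0∞) < c := by
  simp only [exitTime, iInf_lt_iff] at h
  obtain ⟨t, ⟨h0, h1⟩, h2⟩ := h
  exact ⟨t, h0, h1, h2⟩

lemma exitTime_mono {D' : Set E} (h : D ⊆ D') : exitTime X D ω ≤ exitTime X D' ω :=
  le_iInf₂ fun _ ht => exitTime_le ht.1 fun hD => ht.2 (h hD)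

variable [TopologicalSpace E]

/-- If `X_t` were in the open set, right-continuity would keep the path inside for a while after
`t`, and the infimum of the exit times could not be `t`. The case `t = 0` is covered, although time
`0` is not admitted in that infimum. -/
lemma notMem_of_exitTime_eq (hr : ∀ t, Tendsto (fun s => X s ω) (𝓝[>] t) (𝓝 (X t ω)))
    (hD : IsOpen D) {t : ℝ≥0} (h : exitTime X D ω = t) : X t ω ∉ D := by
  intro hX
  have h1 : ∀ᶠ s in 𝓝[>] t, X s ω ∈ D := hr t (hD.mem_nhds hX)
  obtain ⟨u, htu, hu⟩ := (mem_nhdsGT_iff_exists_Ioo_subset).1 h1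
  have h2 : exitTime X D ω < (u : ℝ≥0∞) := by rw [h]; exact_mod_cast htu
  obtain ⟨s, hs0, hs, hsu⟩ := exists_of_exitTime_lt h2
  have hts : t ≤ s := by
    have := exitTime_le hs0 hs
    rw [h] at this
    exact_mod_cast this
  rcases hts.eq_or_lt with rfl | hts
  · exact hs hX
  · exact hs (hu ⟨hts, by exact_mod_cast hsu⟩)

end Paths

/-! ## Exit times as functionals of the path -/

/-- Exit time from `⋃ n, K n`, computed as the supremum over `n` of the first rational exit times
from `K n`. -/
noncomputable def pathExit {E : Type*} (K : ℕ → Set E) (w : ℝ≥0 → E) : ℝ≥0∞ :=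
  ⨆ n, ⨅ (q : ℚ≥0) (_ : w (q : ℝ≥0) ∉ K n), ((q : ℝ≥0) : ℝ≥0∞)

/-- A measurable random time of the path space, such that `T < u` only depends on the path up to
time `u`. -/
structure IsPathTime {E : Type*} [MeasurableSpace E] (T : (ℝ≥0 → E) → ℝ≥0∞) : Prop where
  measurable : Measurable T
  causal : ∀ (w w' : ℝ≥0 → E) (u : ℝ≥0), (∀ s ≤ u, w s = w' s) → T w < u → T w' = T w

lemma IsPathTime.lt_stopped_iff {E : Type*} [MeasurableSpace E] {T : (ℝ≥0 → E) → ℝ≥0∞}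
    (hT : IsPathTime T) (w : ℝ≥0 → E) (u : ℝ≥0) : T (fun t => w (min t u)) < u ↔ T w < u := by
  constructor
  · intro h
    rwa [hT.causal _ w u (fun s hs => by simp [hs]) h]
  · intro h
    rwa [hT.causal w _ u (fun s hs => by simp [hs]) h]

section PathExit

variable {E : Type*}

lemma pathExit_const_lt_iff {K : Set E} {w : ℝ≥0 → E} {c : ℝ≥0∞} :
    pathExit (fun _ => K) w < c ↔ ∃ q : ℚ≥0, w (q : ℝ≥0) ∉ K ∧ ((q : ℝ≥0) : ℝ≥0∞) < c := by
  simp [pathExit, iInf_lt_iff]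

lemma pathExit_eq_iSup (K : ℕ → Set E) (w : ℝ≥0 → E) :
    pathExit K w = ⨆ n, pathExit (fun _ => K n) w := by
  simp [pathExit]

/-- Only countably many coordinates of the path enter, whence measurability in the product
σ-algebra; a rational witness of an exit before `u` only involves the path up to `u`, whence
causality. -/
lemma isPathTime_pathExit [MeasurableSpace E] {K : ℕ → Set E} (hK : ∀ n, MeasurableSet (K n)) :
    IsPathTime (pathExit K) := by
  constructor
  · refine Measurable.iSup fun n => ?_
    refine measurable_of_Iio fun c => ?_
    have : (fun w : ℝ≥0 → E => ⨅ (q : ℚ≥0) (_ : w (q : ℝ≥0) ∉ K n), ((q : ℝ≥0) : ℝ≥0∞)) ⁻¹' Iio c =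
        ⋃ (q : ℚ≥0) (_ : ((q : ℝ≥0) : ℝ≥0∞) < c), (fun w : ℝ≥0 → E => w (q : ℝ≥0)) ⁻¹' (K n)ᶜ := by
      ext w
      simp only [mem_preimage, mem_Iio, iInf_lt_iff, mem_iUnion, mem_compl_iff, exists_prop]
      exact exists_congr fun q => and_comm
    rw [this]
    exact MeasurableSet.iUnion fun q => MeasurableSet.iUnion fun _ =>
      (measurable_pi_apply _) (hK n).compl
  · have key : ∀ (n : ℕ) (w w' : ℝ≥0 → E) (u : ℝ≥0), (∀ s ≤ u, w s = w' s) →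
        pathExit (fun _ => K n) w < u → pathExit (fun _ => K n) w' ≤ pathExit (fun _ => K n) w := by
      intro n w w' u h hT
      refine le_of_forall_gt fun c hc => ?_
      obtain ⟨q, hq, hqc⟩ := pathExit_const_lt_iff.1 (lt_min hc hT)
      refine pathExit_const_lt_iff.2 ⟨q, ?_, hqc.trans_le (min_le_left _ _)⟩
      rwa [← h q]
      exact_mod_cast (hqc.trans_le (min_le_right _ _)).le
    intro w w' u h hT
    rw [pathExit_eq_iSup] at hT
    rw [pathExit_eq_iSup, pathExit_eq_iSup]
    refine iSup_congr fun n => ?_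
    have h1 : pathExit (fun _ => K n) w < u := (le_iSup (fun n => pathExit (fun _ => K n) w) n).trans_lt hT
    have h2 := key n w w' u h h1
    exact h2.antisymm (key n w' w u (fun s hs => (h s hs).symm) (h2.trans_lt h1))

lemma pathExit_mono {K : ℕ → Set E} (hK : Monotone K) (w : ℝ≥0 → E) :
    Monotone fun n => pathExit (fun _ => K n) w := by
  intro i j hij
  refine le_of_forall_gt fun c hc => ?_
  obtain ⟨q, hq, hqc⟩ := pathExit_const_lt_iff.1 hc
  exact pathExit_const_lt_iff.2 ⟨q, fun h => hq (hK hij h), hqc⟩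

lemma exists_nnrat_btwn {a b : ℝ≥0} (h : a < b) : ∃ q : ℚ≥0, a < (q : ℝ≥0) ∧ (q : ℝ≥0) < b := by
  obtain ⟨q, h1, h2⟩ := exists_rat_btwn (show (a : ℝ) < b from h)
  have hq : 0 ≤ q := by
    have : (0 : ℝ) < q := a.2.trans_lt h1
    exact_mod_cast this.le
  refine ⟨⟨q, hq⟩, ?_, ?_⟩
  · rw [← NNReal.coe_lt_coe]; exact h1
  · rw [← NNReal.coe_lt_coe]; exact h2

lemma exists_nnrat_btwn_ennreal {a b : ℝ≥0∞} (h : a < b) :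
    ∃ q : ℚ≥0, a < ((q : ℝ≥0) : ℝ≥0∞) ∧ ((q : ℝ≥0) : ℝ≥0∞) < b := by
  obtain ⟨c, hac, hcb⟩ := exists_between h
  lift a to ℝ≥0 using hac.ne_top
  lift c to ℝ≥0 using hcb.ne_top
  obtain ⟨q, h1, h2⟩ := exists_nnrat_btwn (ENNReal.coe_lt_coe.1 hac)
  exact ⟨q, by exact_mod_cast h1, lt_trans (by exact_mod_cast h2) hcb⟩

variable [TopologicalSpace E]

/-- A right-continuous path outside the closed set `K` at time `t` leaves `K` at a rational time
shortly after `t`. -/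
lemma exists_nnrat_notMem {w : ℝ≥0 → E} {t u : ℝ≥0} (hr : Tendsto w (𝓝[>] t) (𝓝 (w t)))
    {K : Set E} (hK : IsClosed K) (h : w t ∉ K) (htu : t < u) :
    ∃ q : ℚ≥0, t < (q : ℝ≥0) ∧ (q : ℝ≥0) < u ∧ w (q : ℝ≥0) ∉ K := by
  have h1 : ∀ᶠ s in 𝓝[>] t, w s ∈ Kᶜ := hr (hK.isOpen_compl.mem_nhds h)
  obtain ⟨u', htu', hu'⟩ := (mem_nhdsGT_iff_exists_Ioo_subset).1 h1
  obtain ⟨q, hq1, hq2⟩ := exists_nnrat_btwn (lt_min htu htu')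
  exact ⟨q, hq1, hq2.trans_le (min_le_left _ _), hu' ⟨hq1, hq2.trans_le (min_le_right _ _)⟩⟩

lemma pathExit_const_le {w : ℝ≥0 → E} {t : ℝ≥0} (hr : Tendsto w (𝓝[>] t) (𝓝 (w t)))
    {K : Set E} (hK : IsClosed K) (h : w t ∉ K) : pathExit (fun _ => K) w ≤ t := by
  refine le_of_forall_gt fun c hc => ?_
  obtain ⟨c', h1, h2⟩ := exists_between hc
  lift c' to ℝ≥0 using h2.ne_top
  obtain ⟨q, -, hq2, hq⟩ := exists_nnrat_notMem hr hK h (ENNReal.coe_lt_coe.1 h1)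
  exact pathExit_const_lt_iff.2 ⟨q, hq, lt_trans (by exact_mod_cast hq2) h2⟩

lemma mem_of_lt_pathExit_const {w : ℝ≥0 → E} {t : ℝ≥0} (hr : Tendsto w (𝓝[>] t) (𝓝 (w t)))
    {K : Set E} (hK : IsClosed K) (h : (t : ℝ≥0∞) < pathExit (fun _ => K) w) : w t ∈ K := by
  by_contra hw
  exact (pathExit_const_le hr hK hw).not_gt h

/-- At its rational exit time from `K`, a right-continuous path is in the closure of `Kᶜ`. -/
lemma mem_closure_of_pathExit_const_eq {w : ℝ≥0 → E} {t : ℝ≥0} (hr : Tendsto w (𝓝[>] t) (𝓝 (w t)))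
    {K : Set E} (h : pathExit (fun _ => K) w = t) : w t ∈ closure Kᶜ := by
  by_contra hw
  have hw' : w t ∈ (closure Kᶜ)ᶜ := hw
  have h1 : ∀ᶠ s in 𝓝[>] t, w s ∈ (closure Kᶜ)ᶜ := hr (isClosed_closure.isOpen_compl.mem_nhds hw')
  obtain ⟨u, htu, hu⟩ := (mem_nhdsGT_iff_exists_Ioo_subset).1 h1
  have h2 : pathExit (fun _ => K) w < (u : ℝ≥0∞) := by rw [h]; exact_mod_cast htu
  obtain ⟨q, hq, hqu⟩ := pathExit_const_lt_iff.1 h2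
  have hq' : w q ∈ closure Kᶜ := subset_closure hq
  have htq : t ≤ q := by
    by_contra! hlt
    have : pathExit (fun _ => K) w < t := pathExit_const_lt_iff.2 ⟨q, hq, by exact_mod_cast hlt⟩
    exact this.ne h
  rcases htq.eq_or_lt with heq | hlt
  · rw [← heq] at hq'; exact hw hq'
  · exact hu ⟨hlt, by exact_mod_cast hqu⟩ hq'

end PathExit

/-! ## Basic properties of standard processes -/

namespace StandardProcess

variable {E : Type*} [TopologicalSpace E] [MeasurableSpace E] {E₀ : Set E}
  {Ω : Type*} [MeasurableSpace Ω] (Z : StandardProcess E E₀ Ω)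

instance (x : E) : IsProbabilityMeasure (Z.P x) := Z.prob x

lemma measurable_X (t : ℝ≥0) : Measurable (Z.X t) := (Z.adapted t).mono (Z.ℱ.le t) le_rfl

lemma measurable_path : Measurable fun ω t => Z.X t ω := measurable_pi_lambda _ Z.measurable_X

lemma measurable_stoppedPath (u : ℝ≥0) : Measurable[Z.ℱ u] fun ω t => Z.X (min t u) ω :=
  @measurable_pi_lambda _ _ _ (Z.ℱ u) _ _ fun _ => (Z.adapted _).mono (Z.ℱ.mono (min_le_right _ _)) le_rfl

variable {Z}

/-- Absorption turns survival up to time `t` into an event about `X_t` alone, so killing at the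
lifetime is restriction to `E₀`. -/
lemma lt_lifetime_iff (hE₀ : IsOpen E₀) {t : ℝ≥0} {ω : Ω} :
    (t : ℝ≥0∞) < exitTime Z.X E₀ ω ↔ Z.X t ω ∈ E₀ := by
  constructor
  · intro h
    by_contra hX
    have h1 : ∀ s : ℝ≥0, t < s → exitTime Z.X E₀ ω ≤ s := by
      intro s hs
      refine exitTime_le (bot_le.trans_lt hs) ?_
      rwa [Z.absorbed ω t s hs.le hX]
    obtain ⟨c, hc1, hc2⟩ := exists_between h
    lift c to ℝ≥0 using hc2.ne_top
    exact (h1 c (by exact_mod_cast hc1)).not_gt hc2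
  · intro h
    by_contra! hle
    lift exitTime Z.X E₀ ω to ℝ≥0 using (hle.trans_lt ENNReal.coe_lt_top).ne with s hs
    have h1 := notMem_of_exitTime_eq (Z.right_continuous ω) hE₀ hs.symm
    rw [← Z.absorbed ω s t (by exact_mod_cast hle) h1] at h1
    exact h1 h

lemma lifetime_le_iff (hE₀ : IsOpen E₀) {t : ℝ≥0} {ω : Ω} :
    exitTime Z.X E₀ ω ≤ t ↔ Z.X t ω ∉ E₀ := by
  rw [← not_lt, lt_lifetime_iff hE₀]

lemma mem_of_le_of_mem {s t : ℝ≥0} {ω : Ω} (hst : s ≤ t) (h : Z.X t ω ∈ E₀) : Z.X s ω ∈ E₀ := by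
  by_contra hs
  rw [← Z.absorbed ω s t hst hs] at hs
  exact hs h

variable (Z)

lemma ae_mem_of_notMem {x : E} (hx : x ∉ E₀) : ∀ᵐ ω ∂(Z.P x), ∀ t, Z.X t ω = x := by
  filter_upwards [Z.start x] with ω hω t
  rw [Z.absorbed ω 0 t zero_le (by rwa [hω]), hω]

/-- By causality the event does not change when the path is frozen at time `u`, and the frozen path
is `ℱ u`-measurable. -/
lemma measurableSet_pathTime_lt {T : (ℝ≥0 → E) → ℝ≥0∞} (hT : IsPathTime T) (u : ℝ≥0) :
    MeasurableSet[Z.ℱ u] {ω | T (fun t => Z.X t ω) < u} := by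
  have : {ω | T (fun t => Z.X t ω) < u} =
      (fun ω t => Z.X (min t u) ω) ⁻¹' {w | T w < u} := by
    ext ω
    simp only [mem_ofPred_eq, mem_preimage]
    constructor
    · intro h
      rwa [hT.causal _ _ u (fun s hs => by simp [hs]) h]
    · intro h
      rwa [hT.causal _ _ u (fun s hs => by simp [hs]) h]
  rw [this]
  exact Z.measurable_stoppedPath u (hT.measurable measurableSet_Iio)

lemma isStoppingTime_of_lt {τ : Ω → ℝ≥0∞} (hτ : ∀ u : ℝ≥0, MeasurableSet[Z.ℱ u] {ω | τ ω < u}) :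
    IsStoppingTime Z.ℱ τ := by
  have : Z.ℱ.IsRightContinuous := ⟨fun t => by
    rw [Filtration.rightCont_eq]; exact Z.right_continuous_filtration t⟩
  exact isStoppingTime_of_measurableSet_lt_of_isRightContinuous hτ

lemma isStoppingTime_pathTime {T : (ℝ≥0 → E) → ℝ≥0∞} (hT : IsPathTime T) :
    IsStoppingTime Z.ℱ fun ω => T (fun t => Z.X t ω) :=
  Z.isStoppingTime_of_lt (Z.measurableSet_pathTime_lt hT)

/-- Quasi-left-continuity: the exit time from an open set is almost surely the limit of the exit
times from an exhaustion. -/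
lemma pathExit_eq_exitTime [BorelSpace E] {D : Set E}
    (hDE : D ⊆ E₀) {K : ℕ → Set E} (hK : IsExhaustion K D) {x : E} (hx : x ∈ D) :
    ∀ᵐ ω ∂(Z.P x), pathExit K (fun t => Z.X t ω) = exitTime Z.X D ω := by
  have hq := Z.quasi_left_continuous (fun n ω => pathExit (fun _ => K n) fun t => Z.X t ω)
    (fun n => Z.isStoppingTime_pathTime (isPathTime_pathExit fun _ => (hK.closed n).measurableSet))
    (fun ω => pathExit_mono hK.mono _) x
  filter_upwards [hq, Z.start x] with ω hω h0
  simp only [← pathExit_eq_iSup] at hω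
  apply le_antisymm
  · rw [pathExit_eq_iSup]
    refine le_iInf₂ fun t ht => iSup_le fun n => ?_
    exact pathExit_const_le (Z.right_continuous ω t) (hK.closed n) fun h => ht.2 (hK.subset n h)
  · rcases lt_or_ge (pathExit K fun t => Z.X t ω) (exitTime Z.X E₀ ω) with h | h
    · have hlim := hω h
      have hle : ∀ n, pathExit (fun _ => K n) (fun t => Z.X t ω) ≤ pathExit K fun t => Z.X t ω := by
        intro n
        rw [pathExit_eq_iSup K]
        exact le_iSup (fun n => pathExit (fun _ => K n) fun t => Z.X t ω) n
      lift pathExit K (fun t => Z.X t ω) to ℝ≥0 using h.ne_top with T hT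
      rw [ENNReal.toNNReal_coe] at hlim
      -- At its exit time from `K n` the path is in the closure of the complement of `K n`. By
      -- quasi-left-continuity these positions converge to `X_T`, which therefore is in no interior
      -- of a `K m`.
      have hTD : Z.X T ω ∉ D := by
        intro hTD
        obtain ⟨m, hm⟩ := hK.exists_mem _ hTD
        obtain ⟨n, hn, hmn⟩ :=
          ((hlim.eventually (isOpen_interior.mem_nhds hm)).and (eventually_ge_atTop m)).exists
        have hfin : pathExit (fun _ => K n) (fun t => Z.X t ω) ≠ ⊤ :=
          ((hle n).trans_lt ENNReal.coe_lt_top).ne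
        have := mem_closure_of_pathExit_const_eq (Z.right_continuous ω _)
          (ENNReal.coe_toNNReal hfin).symm
        rw [closure_compl] at this
        exact this (interior_mono (hK.mono hmn) hn)
      refine exitTime_le (pos_iff_ne_zero.2 ?_) hTD
      rintro rfl
      rw [h0] at hTD
      exact hTD hx
    · exact (exitTime_mono hDE).trans h

end StandardProcess

/-! ## Cylinder events -/

section Cylinders

variable {E Ω : Type*}

/-- The time reached from `r` after the time increments of the list. -/
def endTime : ℝ≥0 → List (ℝ≥0 × Set E) → ℝ≥0
  | r, [] => r
  | r, (s, _) :: l => endTime (r + s) l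

/-- The increments of a list of times, starting from `r` and ending at `u`. -/
def incrList (B : ℝ≥0 → Set E) (u : ℝ≥0) : ℝ≥0 → List ℝ≥0 → List (ℝ≥0 × Set E)
  | r, [] => [(u - r, univ)]
  | r, t :: l => (t - r, B t) :: incrList B u t l

lemma measurableSet_incrList [MeasurableSpace E] {B : ℝ≥0 → Set E}
    (hB : ∀ t, MeasurableSet (B t)) (u : ℝ≥0) :
    ∀ (l : List ℝ≥0) (r : ℝ≥0), ∀ p ∈ incrList B u r l, MeasurableSet p.2
  | [], r, p, hp => by
    simp only [incrList, List.mem_singleton] at hp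
    subst hp
    exact MeasurableSet.univ
  | t :: l, r, p, hp => by
    simp only [incrList, List.mem_cons] at hp
    rcases hp with rfl | hp
    · exact hB t
    · exact measurableSet_incrList hB u l t p hp

lemma endTime_incrList (B : ℝ≥0 → Set E) (u : ℝ≥0) :
    ∀ (l : List ℝ≥0) (r : ℝ≥0), (r :: l).Pairwise (· ≤ ·) → (∀ t ∈ r :: l, t ≤ u) →
      endTime r (incrList B u r l) = u
  | [], r, _, h => by
    simp only [incrList, endTime]
    exact add_tsub_cancel_of_le (h r (by simp))
  | t :: l, r, h, h' => by
    have hrt : r ≤ t := (List.pairwise_cons.1 h).1 t (by simp)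
    simp only [incrList, endTime]
    rw [add_tsub_cancel_of_le hrt]
    exact endTime_incrList B u l t (List.pairwise_cons.1 h).2
      fun s hs => h' s (List.mem_cons_of_mem _ hs)

lemma fddEvent_incrList (Y : ℝ≥0 → Ω → Option E) (B : ℝ≥0 → Set E) (u : ℝ≥0) :
    ∀ (l : List ℝ≥0) (r : ℝ≥0), (r :: l).Pairwise (· ≤ ·) → (∀ t ∈ r :: l, t ≤ u) →
      fddEvent Y r (incrList B u r l) =
        {ω | (∀ t ∈ l, ∃ y ∈ B t, Y t ω = some y) ∧ ∃ y, Y u ω = some y}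
  | [], r, _, h => by
    simp only [incrList, fddEvent]
    rw [add_tsub_cancel_of_le (h r (by simp))]
    simp
  | t :: l, r, h, h' => by
    have hrt : r ≤ t := (List.pairwise_cons.1 h).1 t (by simp)
    simp only [incrList, fddEvent]
    rw [add_tsub_cancel_of_le hrt, fddEvent_incrList Y B u l t (List.pairwise_cons.1 h).2
      fun s hs => h' s (List.mem_cons_of_mem _ hs)]
    ext ω
    simp only [mem_inter_iff, mem_ofPred_eq, List.mem_cons, forall_eq_or_imp, and_assoc]

/-- The list of increments of a finite set of times, ending at `u`. -/
noncomputable def finsetIncr (J : Finset ℝ≥0) (B : ℝ≥0 → Set E) (u : ℝ≥0) :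
    List (ℝ≥0 × Set E) :=
  incrList B u 0 (J.sort (· ≤ ·))

lemma pairwise_zero_cons_sort (J : Finset ℝ≥0) : (0 :: J.sort (· ≤ ·)).Pairwise (· ≤ ·) :=
  List.pairwise_cons.2 ⟨fun _ _ => zero_le, J.pairwise_sort (· ≤ ·)⟩

lemma le_of_mem_zero_cons_sort {J : Finset ℝ≥0} {u : ℝ≥0} (hJ : ∀ t ∈ J, t ≤ u) :
    ∀ t ∈ 0 :: J.sort (· ≤ ·), t ≤ u := by
  intro t ht
  rcases List.mem_cons.1 ht with rfl | ht
  · exact zero_le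
  · exact hJ t ((Finset.mem_sort _).1 ht)

lemma measurableSet_finsetIncr [MeasurableSpace E] (J : Finset ℝ≥0) (u : ℝ≥0)
    {B : ℝ≥0 → Set E} (hB : ∀ t, MeasurableSet (B t)) :
    ∀ p ∈ finsetIncr J B u, MeasurableSet p.2 :=
  measurableSet_incrList hB u _ _

lemma endTime_finsetIncr {J : Finset ℝ≥0} {u : ℝ≥0} (hJ : ∀ t ∈ J, t ≤ u) (B : ℝ≥0 → Set E) :
    endTime 0 (finsetIncr J B u) = u :=
  endTime_incrList B u _ _ (pairwise_zero_cons_sort J) (le_of_mem_zero_cons_sort hJ)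

/-- Every finite-dimensional event up to time `u` of a process with lifetime can be written with
a list of increments. -/
lemma fddEvent_finsetIncr {J : Finset ℝ≥0} {u : ℝ≥0} (hJ : ∀ t ∈ J, t ≤ u) (B : ℝ≥0 → Set E)
    (Y : ℝ≥0 → Ω → Option E) : fddEvent Y 0 (finsetIncr J B u) =
      {ω | (∀ t ∈ J, ∃ y ∈ B t, Y t ω = some y) ∧ ∃ y, Y u ω = some y} := by
  rw [finsetIncr, fddEvent_incrList Y B u _ _ (pairwise_zero_cons_sort J)
    (le_of_mem_zero_cons_sort hJ)]
  simp

/-- Finite measures on the space of paths that agree on the finite-dimensional events up to time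
`u` agree, if they are carried by the paths stopped at `u`. -/
lemma measure_map_stoppedPath_ext {Ω' : Type*} [MeasurableSpace E] [MeasurableSpace Ω]
    [MeasurableSpace Ω']
    {μ : Measure Ω} {μ' : Measure Ω'} [IsFiniteMeasure μ] {Y : Ω → ℝ≥0 → E} {Y' : Ω' → ℝ≥0 → E}
    (hY : Measurable Y) (hY' : Measurable Y') (u : ℝ≥0)
    (h : ∀ (J : Finset ℝ≥0), (∀ t ∈ J, t ≤ u) → ∀ B : ℝ≥0 → Set E, (∀ t, MeasurableSet (B t)) →
      μ {ω | ∀ t ∈ J, Y ω t ∈ B t} = μ' {ω | ∀ t ∈ J, Y' ω t ∈ B t}) :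
    μ.map (fun ω t => Y ω (min t u)) = μ'.map (fun ω t => Y' ω (min t u)) := by
  have hs : Measurable fun (w : ℝ≥0 → E) (t : ℝ≥0) => w (min t u) :=
    measurable_pi_lambda _ fun t => measurable_pi_apply _
  have hYs : Measurable fun ω t => Y ω (min t u) := hs.comp hY
  have hYs' : Measurable fun ω t => Y' ω (min t u) := hs.comp hY'
  refine ext_of_generate_finite _ (generateFrom_squareCylinders (α := fun _ : ℝ≥0 => E)).symm
    (isPiSystem_squareCylinders (fun _ => MeasurableSpace.isPiSystem_measurableSet)
      (fun _ => MeasurableSet.univ)) ?_ ?_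
  · rintro _ ⟨J, t, ht, rfl⟩
    have hm : MeasurableSet ((J : Set ℝ≥0).pi t) :=
      MeasurableSet.pi J.countable_toSet fun i _ => ht i (mem_univ i)
    rw [Measure.map_apply hYs hm, Measure.map_apply hYs' hm]
    classical
    -- Several indices may be cut down to the same time `min i u`; their constraints are intersected
    -- into one.
    have key : ∀ w : ℝ≥0 → E, ((fun t => w (min t u)) ∈ (J : Set ℝ≥0).pi t) ↔
        ∀ j ∈ J.image (fun i => min i u), w j ∈ ⋂ i ∈ J.filter (fun i => min i u = j), t i := by
      intro w
      simp only [Set.mem_pi, Finset.mem_coe, Finset.mem_image, forall_exists_index, and_imp,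
        forall_apply_eq_imp_iff₂, mem_iInter, Finset.mem_filter]
      constructor
      · intro h i hi i' hi' heq
        rw [← heq]; exact h i' hi'
      · intro h i hi
        exact h i hi i hi rfl
    have := h (J.image fun i => min i u) (by simp)
      (fun j => ⋂ i ∈ J.filter (fun i => min i u = j), t i)
      (fun j => Finset.measurableSet_biInter _ fun i _ => ht i (mem_univ i))
    convert this using 2
    · ext ω; exact key (Y ω)
    · ext ω; exact key (Y' ω)
  · rw [Measure.map_apply hYs MeasurableSet.univ, Measure.map_apply hYs' MeasurableSet.univ]
    simpa using h ∅ (by simp) (fun _ => univ) (fun _ => MeasurableSet.univ)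

end Cylinders

/-! ## Consequences of the strong Markov property -/

namespace StandardProcess

variable {E : Type*} [TopologicalSpace E] [MeasurableSpace E] {E₀ : Set E} {Ω : Type*}
  [MeasurableSpace Ω] (Z : StandardProcess E E₀ Ω)

lemma measurable_of_isStoppingTime {τ : Ω → ℝ≥0∞} (hτ : IsStoppingTime Z.ℱ τ) : Measurable τ := by
  refine measurable_of_Iic fun c => ?_
  induction c using ENNReal.recTopCoe with
  | top => simp
  | coe c => exact Z.ℱ.le c _ (hτ c)

lemma measurable_map_X (t : ℝ≥0) : Measurable fun x => (Z.P x).map (Z.X t) := by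
  refine Measure.measurable_of_measurable_coe _ fun B hB => ?_
  simp_rw [Measure.map_apply (Z.measurable_X t) hB]
  exact Z.measurable_transition t B hB

lemma measurable_lintegral_X (t : ℝ≥0) {f : E → ℝ≥0∞} (hf : Measurable f) :
    Measurable fun x => ∫⁻ ω, f (Z.X t ω) ∂(Z.P x) := by
  simp_rw [← lintegral_map hf (Z.measurable_X t)]
  exact (Measure.measurable_lintegral hf).comp (Z.measurable_map_X t)

lemma fddEvent_cons_some (r s : ℝ≥0) (B : Set E) (l : List (ℝ≥0 × Set E)) :
    fddEvent (fun t ω => some (Z.X t ω)) r ((s, B) :: l) =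
      Z.X (r + s) ⁻¹' B ∩ fddEvent (fun t ω => some (Z.X t ω)) (r + s) l := by
  ext ω; simp [fddEvent]

/-- Iterated integrals of a terminal weight `k` over finite-dimensional events. -/
noncomputable def fddIntegral (k : E → ℝ≥0∞) : E → List (ℝ≥0 × Set E) → ℝ≥0∞
  | x, [] => k x
  | x, (s, B) :: l => ∫⁻ ω, B.indicator (fun y => fddIntegral k y l) (Z.X s ω) ∂(Z.P x)

lemma measurable_fddIntegral {k : E → ℝ≥0∞} (hk : Measurable k) :
    ∀ l : List (ℝ≥0 × Set E), (∀ p ∈ l, MeasurableSet p.2) →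
      Measurable fun x => Z.fddIntegral k x l
  | [], _ => hk
  | (s, B) :: l, h => by
    simp only [fddIntegral]
    exact Z.measurable_lintegral_X s
      ((measurable_fddIntegral hk l fun p hp => h p (List.mem_cons_of_mem _ hp)).indicator
        (h (s, B) (by simp)))

lemma measurableSet_fddEvent (l : List (ℝ≥0 × Set E)) (h : ∀ p ∈ l, MeasurableSet p.2) (r : ℝ≥0) :
    MeasurableSet (fddEvent (fun t ω => some (Z.X t ω)) r l) := by
  induction l generalizing r with
  | nil => exact MeasurableSet.univ
  | cons p l ih =>
    obtain ⟨s, B⟩ := p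
    rw [fddEvent_cons_some]
    exact (Z.measurable_X _ (h (s, B) (by simp))).inter
      (ih (fun p hp => h p (List.mem_cons_of_mem _ hp)) _)

/-- One list of increments serves all starting times `r`, so the Markov property at `r` can compare
a shifted cylinder with the same cylinder started at `0`. -/
lemma exists_fddEvent_shift (J : Finset ℝ≥0) {B : ℝ≥0 → Set E} (hB : ∀ t, MeasurableSet (B t)) :
    ∃ l : List (ℝ≥0 × Set E), (∀ p ∈ l, MeasurableSet p.2) ∧
      (∀ r, {ω | ∀ t ∈ J, Z.X (r + t) ω ∈ B t} = fddEvent (fun t ω => some (Z.X t ω)) r l) := by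
  have h := fddEvent_finsetIncr (Ω := Ω) (J := J) (u := J.sup id)
    (fun t ht => Finset.le_sup (f := id) ht) B
  refine ⟨_, measurableSet_finsetIncr J (J.sup id) hB, fun r => ?_⟩
  have hshift : ∀ (l : List (ℝ≥0 × Set E)) (r' : ℝ≥0),
      fddEvent (fun t ω => some (Z.X (r + t) ω)) r' l =
        fddEvent (fun t ω => some (Z.X t ω)) (r + r') l := by
    intro l
    induction l with
    | nil => intro r'; rfl
    | cons p l ih =>
      intro r'
      obtain ⟨s, B⟩ := p
      simp only [fddEvent, ih, add_assoc]
  have := h fun t ω => some (Z.X (r + t) ω)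
  rw [hshift, add_zero] at this
  rw [this]
  ext ω; simp

variable [TopologicalSpace.MetrizableSpace E] [BorelSpace E]

lemma measurable_uncurry_X : Measurable fun p : ℝ≥0 × Ω => Z.X p.1 p.2 :=
  measurable_uncurry_of_rightContinuous Z.measurable_X Z.right_continuous

lemma measurable_X_comp {σ : Ω → ℝ≥0} (hσ : Measurable σ) : Measurable fun ω => Z.X (σ ω) ω :=
  Z.measurable_uncurry_X.comp (hσ.prodMk measurable_id)

lemma strong_markov_lintegral {τ : Ω → ℝ≥0∞} (hτ : IsStoppingTime Z.ℱ τ) (x : E) (t : ℝ≥0)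
    {L : Set Ω} (hL : MeasurableSet[hτ.measurableSpace] L) {f : E → ℝ≥0∞} (hf : Measurable f) :
    ∫⁻ ω in L ∩ {ω | τ ω < ⊤}, f (Z.X ((τ ω).toNNReal + t) ω) ∂(Z.P x) =
      ∫⁻ ω in L ∩ {ω | τ ω < ⊤}, ∫⁻ ω', f (Z.X t ω') ∂(Z.P (Z.X (τ ω).toNNReal ω)) ∂(Z.P x) := by
  have hτm := Z.measurable_of_isStoppingTime hτ
  have h1 : Measurable fun ω => Z.X ((τ ω).toNNReal + t) ω :=
    Z.measurable_X_comp (hτm.ennreal_toNNReal.add_const t)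
  have h2 : Measurable fun ω => Z.X (τ ω).toNNReal ω := Z.measurable_X_comp hτm.ennreal_toNNReal
  have hLm : MeasurableSet L := hτ.measurableSpace_le L hL
  have hm : MeasurableSet (L ∩ {ω | τ ω < ⊤}) := hLm.inter (hτm measurableSet_Iio)
  have h3 : Measurable fun ω => (Z.P (Z.X (τ ω).toNNReal ω)).map (Z.X t) :=
    (Z.measurable_map_X t).comp h2
  -- The defining identity on Borel sets is an equality of two measures, against which any `f` can
  -- be integrated.
  have key : ((Z.P x).restrict (L ∩ {ω | τ ω < ⊤})).map (fun ω => Z.X ((τ ω).toNNReal + t) ω) =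
      ((Z.P x).restrict (L ∩ {ω | τ ω < ⊤})).bind
        fun ω => (Z.P (Z.X (τ ω).toNNReal ω)).map (Z.X t) := by
    ext B hB
    rw [Measure.map_apply h1 hB, Measure.bind_apply hB h3.aemeasurable,
      Measure.restrict_apply (h1 hB)]
    simp_rw [Measure.map_apply (Z.measurable_X t) hB]
    rw [← Z.strong_markov τ hτ x t B L hB hL]
    congr 1
    ext ω
    simp only [mem_inter_iff, mem_preimage, mem_ofPred_eq]
    tauto
  rw [← lintegral_map hf h1, key, Measure.lintegral_bind h3.aemeasurable hf.aemeasurable]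
  simp_rw [lintegral_map hf (Z.measurable_X t)]

lemma markov_lintegral (x : E) (r t : ℝ≥0) {L : Set Ω} (hL : MeasurableSet[Z.ℱ r] L)
    {f : E → ℝ≥0∞} (hf : Measurable f) :
    ∫⁻ ω in L, f (Z.X (r + t) ω) ∂(Z.P x) =
      ∫⁻ ω in L, ∫⁻ ω', f (Z.X t ω') ∂(Z.P (Z.X r ω)) ∂(Z.P x) := by
  have hτ : IsStoppingTime Z.ℱ fun _ => (r : ℝ≥0∞) := isStoppingTime_const Z.ℱ r
  have hL' : MeasurableSet[hτ.measurableSpace] L := by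
    rw [show hτ.measurableSpace = Z.ℱ r from IsStoppingTime.measurableSpace_const Z.ℱ r]
    exact hL
  simpa using Z.strong_markov_lintegral hτ x t hL' hf

/-- The Markov property for finite-dimensional events with a terminal weight. -/
lemma setLIntegral_fddEvent {k : E → ℝ≥0∞} (hk : Measurable k) (x : E) :
    ∀ (l : List (ℝ≥0 × Set E)), (∀ p ∈ l, MeasurableSet p.2) → ∀ (r : ℝ≥0) (L : Set Ω),
      MeasurableSet[Z.ℱ r] L →
      ∫⁻ ω in L, (fddEvent (fun t ω => some (Z.X t ω)) r l).indicator
          (fun ω => k (Z.X (endTime r l) ω)) ω ∂(Z.P x) =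
        ∫⁻ ω in L, Z.fddIntegral k (Z.X r ω) l ∂(Z.P x)
  | [], _, r, L, hL => by simp [fddEvent, endTime, fddIntegral]
  | (s, B) :: l, h, r, L, hL => by
    have hB : MeasurableSet B := h (s, B) (by simp)
    have hl : ∀ p ∈ l, MeasurableSet p.2 := fun p hp => h p (List.mem_cons_of_mem _ hp)
    have hBr : MeasurableSet[Z.ℱ (r + s)] (Z.X (r + s) ⁻¹' B) := Z.adapted (r + s) hB
    have hL' : MeasurableSet[Z.ℱ (r + s)] (Z.X (r + s) ⁻¹' B ∩ L) :=
      hBr.inter (Z.ℱ.mono le_self_add _ hL)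
    have ih := setLIntegral_fddEvent hk x l hl (r + s) _ hL'
    have hLm : MeasurableSet L := Z.ℱ.le r _ hL
    have hBm : MeasurableSet (Z.X (r + s) ⁻¹' B) := Z.measurable_X _ hB
    simp only [fddIntegral]
    rw [← Z.markov_lintegral x r s hL ((Z.measurable_fddIntegral hk l hl).indicator hB)]
    rw [fddEvent_cons_some, ← indicator_indicator]
    simp only [endTime]
    rw [lintegral_indicator hBm, Measure.restrict_restrict hBm, ih,
      ← Measure.restrict_restrict hBm, ← lintegral_indicator hBm]
    rfl

lemma lintegral_fddEvent {k : E → ℝ≥0∞} (hk : Measurable k) (x : E) {l : List (ℝ≥0 × Set E)}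
    (hl : ∀ p ∈ l, MeasurableSet p.2) :
    ∫⁻ ω, (fddEvent (fun t ω => some (Z.X t ω)) 0 l).indicator
        (fun ω => k (Z.X (endTime 0 l) ω)) ω ∂(Z.P x) = Z.fddIntegral k x l := by
  have := Z.setLIntegral_fddEvent hk x l hl 0 univ MeasurableSet.univ
  rw [Measure.restrict_univ] at this
  rw [this, lintegral_congr_ae (g := fun _ => Z.fddIntegral k x l)]
  · simp
  · filter_upwards [Z.start x] with ω hω
    rw [hω]

/-- The law of the path. -/
noncomputable def pathLaw (x : E) : Measure (ℝ≥0 → E) := (Z.P x).map fun ω t => Z.X t ω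

instance (x : E) : IsProbabilityMeasure (Z.pathLaw x) :=
  Measure.isProbabilityMeasure_map Z.measurable_path.aemeasurable

/-- Cylinders are a generating π-system, and their probabilities are iterated integrals, hence
measurable in the starting point. -/
lemma measurable_pathLaw : Measurable Z.pathLaw := by
  refine Measurable.measure_of_isPiSystem_of_isProbabilityMeasure
    (generateFrom_squareCylinders (α := fun _ : ℝ≥0 => E)).symm
    (isPiSystem_squareCylinders (fun _ => MeasurableSpace.isPiSystem_measurableSet)
      (fun _ => MeasurableSet.univ)) ?_
  rintro _ ⟨J, B, hB, rfl⟩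
  have hB' : ∀ t, MeasurableSet (B t) := fun t => hB t (mem_univ t)
  obtain ⟨l, hl, h⟩ := Z.exists_fddEvent_shift J hB'
  have : ∀ x, Z.pathLaw x ((J : Set ℝ≥0).pi B) = Z.fddIntegral (fun _ => 1) x l := by
    intro x
    rw [pathLaw, Measure.map_apply Z.measurable_path
      (MeasurableSet.pi J.countable_toSet fun i _ => hB' i),
      ← Z.lintegral_fddEvent measurable_const x hl,
      lintegral_indicator (Z.measurableSet_fddEvent l hl 0), ← h 0]
    simp only [lintegral_const, Measure.restrict_apply MeasurableSet.univ, univ_inter, one_mul]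
    congr 1
    ext ω; simp [Set.mem_pi]
  simp_rw [this]
  exact Z.measurable_fddIntegral measurable_const l hl

/-- The Markov property at a fixed time for functionals of the path. -/
lemma markov_path (x : E) (r : ℝ≥0) {L : Set Ω} (hL : MeasurableSet[Z.ℱ r] L)
    {F : (ℝ≥0 → E) → ℝ≥0∞} (hF : Measurable F) :
    ∫⁻ ω in L, F (fun t => Z.X (r + t) ω) ∂(Z.P x) =
      ∫⁻ ω in L, ∫⁻ ω', F (fun t => Z.X t ω') ∂(Z.P (Z.X r ω)) ∂(Z.P x) := by
  have h1 : Measurable fun ω t => Z.X (r + t) ω := measurable_pi_lambda _ fun t => Z.measurable_X _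
  have h2 : Measurable fun ω => Z.pathLaw (Z.X r ω) := Z.measurable_pathLaw.comp (Z.measurable_X r)
  have key : ((Z.P x).restrict L).map (fun ω t => Z.X (r + t) ω) =
      ((Z.P x).restrict L).bind fun ω => Z.pathLaw (Z.X r ω) := by
    have : IsFiniteMeasure (((Z.P x).restrict L).map fun ω t => Z.X (r + t) ω) :=
      Measure.isFiniteMeasure_map _ _
    refine ext_of_generate_finite _ (generateFrom_squareCylinders (α := fun _ : ℝ≥0 => E)).symm
      (isPiSystem_squareCylinders (fun _ => MeasurableSpace.isPiSystem_measurableSet)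
        (fun _ => MeasurableSet.univ)) ?_ ?_
    · rintro _ ⟨J, B, hB, rfl⟩
      have hB' : ∀ t, MeasurableSet (B t) := fun t => hB t (mem_univ t)
      have hm : MeasurableSet ((J : Set ℝ≥0).pi B) :=
        MeasurableSet.pi J.countable_toSet fun i _ => hB' i
      obtain ⟨l, hl, h⟩ := Z.exists_fddEvent_shift J hB'
      have hfd : ∀ r', (fun ω t => Z.X (r' + t) ω) ⁻¹' ((J : Set ℝ≥0).pi B) =
          fddEvent (fun t ω => some (Z.X t ω)) r' l := by
        intro r'
        rw [← h r']
        ext ω; simp [Set.mem_pi]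
      have hlaw : ∀ z, Z.pathLaw z ((J : Set ℝ≥0).pi B) = Z.fddIntegral (fun _ => 1) z l := by
        intro z
        have := hfd 0
        simp only [zero_add] at this
        rw [pathLaw, Measure.map_apply Z.measurable_path hm, this,
          ← Z.lintegral_fddEvent measurable_const z hl,
          lintegral_indicator (Z.measurableSet_fddEvent l hl 0)]
        simp
      rw [Measure.map_apply h1 hm, Measure.bind_apply hm h2.aemeasurable, hfd]
      simp_rw [hlaw]
      rw [← Z.setLIntegral_fddEvent measurable_const x l hl r L hL,
        lintegral_indicator (Z.measurableSet_fddEvent l hl r)]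
      simp
    · rw [Measure.map_apply h1 MeasurableSet.univ, Measure.bind_apply MeasurableSet.univ
        h2.aemeasurable]
      simp
  rw [← lintegral_map hF h1, key, Measure.lintegral_bind h2.aemeasurable hF.aemeasurable]
  simp_rw [pathLaw, lintegral_map hF Z.measurable_path]

end StandardProcess

/-! ## The time change -/

lemma measurable_lintegral_comp_of_rightContinuous {E : Type*} [TopologicalSpace E]
    [TopologicalSpace.MetrizableSpace E] [MeasurableSpace E] [BorelSpace E] {Ω : Type*}
    [MeasurableSpace Ω] {Y : ℝ≥0 → Ω → E} (hY : ∀ t, Measurable (Y t))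
    (hr : ∀ ω t, Tendsto (fun s => Y s ω) (𝓝[>] t) (𝓝 (Y t ω))) {g : E → ℝ≥0∞}
    (hg : Measurable g) (t : ℝ≥0) :
    Measurable fun ω => ∫⁻ s in Icc (0 : ℝ) t, g (Y s.toNNReal ω) := by
  have h2 : Measurable fun p : Ω × ℝ => g (Y p.2.toNNReal p.1) :=
    hg.comp ((measurable_uncurry_of_rightContinuous hY hr).comp
      (measurable_snd.real_toNNReal.prodMk measurable_fst))
  exact h2.lintegral_prod_right'

namespace StandardProcess

variable {E : Type*} [TopologicalSpace E] [MeasurableSpace E] {E₀ : Set E} {Ω : Type*}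
  [MeasurableSpace Ω] (Z : StandardProcess E E₀ Ω) {v : E → ℝ}

lemma clock_mono (v : E → ℝ) (ω : Ω) : Monotone fun t => clock Z v t ω := fun _ _ hst =>
  lintegral_mono_set (Icc_subset_Icc_right (by exact_mod_cast hst))

lemma clock_zero (v : E → ℝ) (ω : Ω) : clock Z v 0 ω = 0 := by simp [clock]

lemma clock_eq_add (v : E → ℝ) (ω : Ω) {s t : ℝ≥0} (hst : s ≤ t) :
    clock Z v t ω = clock Z v s ω + ∫⁻ r in Ioc (s : ℝ) t,
      E₀.indicator (fun y => ENNReal.ofReal (v y)⁻¹) (Z.X r.toNNReal ω) := by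
  rw [clock, clock, ← lintegral_union measurableSet_Ioc,
    Icc_union_Ioc_eq_Icc s.coe_nonneg (NNReal.coe_le_coe.2 hst)]
  rw [Set.disjoint_left]
  intro x hx hx'
  exact hx'.1.not_ge hx.2

/-- The clock is left-continuous. -/
lemma exists_lt_clock_of_lt (v : E → ℝ) (ω : Ω) {t : ℝ≥0} {c : ℝ≥0∞} (h : c < clock Z v t ω) :
    ∃ s < t, c < clock Z v s ω := by
  set g : ℝ → ℝ≥0∞ := fun r => E₀.indicator (fun y => ENNReal.ofReal (v y)⁻¹) (Z.X r.toNNReal ω)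
  have hU : Ico (0 : ℝ) t = ⋃ q : {q : ℚ≥0 // (q : ℝ≥0) < t}, Icc (0 : ℝ) ((q : ℚ≥0) : ℝ≥0) := by
    ext x
    simp only [mem_Ico, mem_iUnion, mem_Icc, Subtype.exists, exists_prop, exists_and_left]
    constructor
    · rintro ⟨h0, hx⟩
      lift x to ℝ≥0 using h0
      obtain ⟨q, hq1, hq2⟩ := exists_nnrat_btwn (show x < t by exact_mod_cast hx)
      exact ⟨x.2, q, hq2, by exact_mod_cast hq1.le⟩
    · rintro ⟨h0, q, hq, hx⟩
      exact ⟨h0, hx.trans_lt (by exact_mod_cast hq)⟩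
  have hmono : Monotone fun q : {q : ℚ≥0 // (q : ℝ≥0) < t} => Icc (0 : ℝ) ((q : ℚ≥0) : ℝ≥0) := by
    intro p q hpq
    refine Icc_subset_Icc_right ?_
    exact_mod_cast hpq
  -- The endpoint `t` carries no Lebesgue mass, and the integral over a countable directed union is
  -- the supremum of the integrals. The clock may be infinite here.
  have h1 : clock Z v t ω = ⨆ q : {q : ℚ≥0 // (q : ℝ≥0) < t}, clock Z v ((q : ℚ≥0) : ℝ≥0) ω := by
    have e1 : clock Z v t ω = ∫⁻ r in Ico (0 : ℝ) t, g r := by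
      rw [clock]
      exact setLIntegral_congr Ico_ae_eq_Icc.symm
    rw [e1, hU]
    exact setLIntegral_iUnion_of_directed g hmono.directed_le
  rw [h1, lt_iSup_iff] at h
  obtain ⟨q, hq⟩ := h
  exact ⟨_, q.2, hq⟩

variable {Z} {ω : Ω}

/-- The clock strictly increases during the lifetime. -/
lemma clock_lt_clock (hE₀ : IsOpen E₀) (hv : ∀ x ∈ E₀, 0 < v x)
    (hm : Measurable fun r : ℝ => E₀.indicator (fun y => ENNReal.ofReal (v y)⁻¹) (Z.X r.toNNReal ω))
    {s t : ℝ≥0} (hs : Z.X s ω ∈ E₀) (hfin : clock Z v s ω < ⊤) (hst : s < t) :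
    clock Z v s ω < clock Z v t ω := by
  rw [clock_eq_add Z v ω hst.le]
  refine ENNReal.lt_add_right hfin.ne (ne_of_gt ?_)
  have h1 : ∀ᶠ r in 𝓝[>] s, Z.X r ω ∈ E₀ := Z.right_continuous ω s (hE₀.mem_nhds hs)
  obtain ⟨u, hsu, hu⟩ := (mem_nhdsGT_iff_exists_Ioo_subset).1 h1
  rw [lintegral_pos_iff_support hm, Measure.restrict_apply (measurableSet_support hm)]
  have hsub : Ioo (s : ℝ) (min t u : ℝ≥0) ⊆ (Function.support fun r : ℝ =>
      E₀.indicator (fun y => ENNReal.ofReal (v y)⁻¹) (Z.X r.toNNReal ω)) ∩ Ioc (s : ℝ) t := by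
    rintro r ⟨hr1, hr2⟩
    lift r to ℝ≥0 using s.2.trans hr1.le
    have hr1' : s < r := by exact_mod_cast hr1
    have hr2' : r < min t u := by exact_mod_cast hr2
    have hX : Z.X r ω ∈ E₀ := hu ⟨hr1', hr2'.trans_le (min_le_right _ _)⟩
    refine ⟨?_, hr1, ?_⟩
    · rw [Function.mem_support, Real.toNNReal_coe, indicator_of_mem hX]
      exact (ENNReal.ofReal_pos.2 (inv_pos.2 (hv _ hX))).ne'
    · exact_mod_cast (hr2'.trans_le (min_le_left _ _)).le
  refine lt_of_lt_of_le ?_ (measure_mono hsub)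
  rw [Real.volume_Ioo, ENNReal.ofReal_pos, sub_pos]
  exact_mod_cast lt_min hst hsu

/-- The clock is right-continuous during the lifetime, if it is finite there. -/
lemma exists_clock_lt_of_lt (hE₀ : IsOpen E₀) (hfin : ∀ t, Z.X t ω ∈ E₀ → clock Z v t ω < ⊤)
    {s : ℝ≥0} (hs : Z.X s ω ∈ E₀) {c : ℝ≥0∞} (h : clock Z v s ω < c) :
    ∃ t > s, clock Z v t ω < c := by
  have h1 : ∀ᶠ r in 𝓝[>] s, Z.X r ω ∈ E₀ := Z.right_continuous ω s (hE₀.mem_nhds hs)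
  obtain ⟨u, hu1, hu2⟩ := (h1.and self_mem_nhdsWithin).exists
  set μ : Measure ℝ := volume.withDensity fun r : ℝ =>
    E₀.indicator (fun y => ENNReal.ofReal (v y)⁻¹) (Z.X r.toNNReal ω) with hμ
  have hμc : ∀ t : ℝ≥0, μ (Icc (0 : ℝ) t) = clock Z v t ω := fun t =>
    withDensity_apply _ measurableSet_Icc
  -- Continuity from above needs one interval of finite mass; the interval up to `u` has it, because
  -- the path is still in `E₀` at `u`.
  have h2 := tendsto_measure_biInter_gt (μ := μ) (s := fun t : ℝ≥0 => Icc (0 : ℝ) t) (a := s)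
    (fun _ _ => measurableSet_Icc.nullMeasurableSet)
    (fun i j _ hij => Icc_subset_Icc_right (by exact_mod_cast hij))
    ⟨u, hu2, by rw [hμc]; exact (hfin u hu1).ne⟩
  have h3 : ⋂ r > s, Icc (0 : ℝ) (r : ℝ≥0) = Icc (0 : ℝ) s := by
    ext x
    simp only [mem_iInter, mem_Icc]
    constructor
    · intro hx
      have hx0 := (hx u hu2).1
      refine ⟨hx0, ?_⟩
      lift x to ℝ≥0 using hx0
      have : x ≤ s := le_of_forall_gt fun r hr => by
        obtain ⟨r', h1, h2⟩ := exists_between hr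
        exact lt_of_le_of_lt (by exact_mod_cast (hx r' h1).2) h2
      exact_mod_cast this
    · rintro ⟨h0, hx⟩ r hr
      exact ⟨h0, hx.trans (by exact_mod_cast le_of_lt hr)⟩
  rw [h3, hμc] at h2
  obtain ⟨t, ht, hts⟩ := ((h2.eventually_lt_const h).and self_mem_nhdsWithin).exists
  refine ⟨t, hts, ?_⟩
  rwa [Function.comp_apply, hμc] at ht

lemma clock_eq_of_notMem (v : E → ℝ) {s t : ℝ≥0} (hst : s ≤ t) (hs : Z.X s ω ∉ E₀) :
    clock Z v t ω = clock Z v s ω := by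
  rw [clock_eq_add Z v ω hst, setLIntegral_congr_fun (g := fun _ => 0) measurableSet_Ioc,
    lintegral_zero, add_zero]
  intro r hr
  lift r to ℝ≥0 using s.2.trans hr.1.le
  have : s ≤ r := by exact_mod_cast hr.1.le
  simp only [Real.toNNReal_coe]
  rw [Z.absorbed ω s r this hs, indicator_of_notMem hs]

lemma invClock_le {t s : ℝ≥0} (h : (t : ℝ≥0∞) < clock Z v s ω) : invClock Z v t ω ≤ s :=
  iInf₂_le s h

lemma invClock_lt_iff {t : ℝ≥0} {c : ℝ≥0∞} :
    invClock Z v t ω < c ↔ ∃ s : ℝ≥0, (t : ℝ≥0∞) < clock Z v s ω ∧ (s : ℝ≥0∞) < c := by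
  simp [invClock, iInf_lt_iff]

lemma invClock_mono (Z : StandardProcess E E₀ Ω) (v : E → ℝ) (ω : Ω) :
    Monotone fun t => invClock Z v t ω := by
  intro s t hst
  refine le_iInf₂ fun r hr => invClock_le (lt_of_le_of_lt ?_ hr)
  exact_mod_cast hst

lemma invClock_clock (hE₀ : IsOpen E₀) (hv : ∀ x ∈ E₀, 0 < v x)
    (hm : Measurable fun r : ℝ => E₀.indicator (fun y => ENNReal.ofReal (v y)⁻¹) (Z.X r.toNNReal ω))
    {s t : ℝ≥0} (hs : Z.X s ω ∈ E₀) (h : clock Z v s ω = t) : invClock Z v t ω = s := by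
  apply le_antisymm
  · refine le_of_forall_gt fun c hc => ?_
    obtain ⟨r, h1, h2⟩ := exists_between hc
    lift r to ℝ≥0 using h2.ne_top
    refine invClock_lt_iff.2 ⟨r, ?_, h2⟩
    rw [← h]
    exact clock_lt_clock hE₀ hv hm hs (h ▸ ENNReal.coe_lt_top) (by exact_mod_cast h1)
  · refine le_iInf₂ fun r hr => ?_
    by_contra! hlt
    have : clock Z v r ω ≤ clock Z v s ω := Z.clock_mono v ω (by exact_mod_cast hlt.le)
    exact (h ▸ this).not_gt hr

/-- Left-continuity of the clock gives `A_s ≤ t`. Were the path outside `E₀` at `s`, the clock would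
be constant from then on and never exceed `t`; so right-continuity at `s` is available and gives the
reverse inequality. -/
lemma of_invClock_eq (hE₀ : IsOpen E₀) (hfin : ∀ t, Z.X t ω ∈ E₀ → clock Z v t ω < ⊤)
    {s t : ℝ≥0} (h : invClock Z v t ω = s) : Z.X s ω ∈ E₀ ∧ clock Z v s ω = t := by
  have hle : clock Z v s ω ≤ t := by
    by_contra! hlt
    obtain ⟨s', hs', hlt'⟩ := Z.exists_lt_clock_of_lt v ω hlt
    have := invClock_le hlt'
    rw [h] at this
    exact this.not_gt (by exact_mod_cast hs')
  have hX : Z.X s ω ∈ E₀ := by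
    by_contra hX
    obtain ⟨r, hr, -⟩ := invClock_lt_iff.1 (show invClock Z v t ω < ⊤ by
      rw [h]; exact ENNReal.coe_lt_top)
    have hsr : s ≤ r := by
      have := invClock_le hr
      rw [h] at this
      exact_mod_cast this
    rw [clock_eq_of_notMem v hsr hX] at hr
    exact hle.not_gt hr
  refine ⟨hX, hle.antisymm ?_⟩
  by_contra! hlt
  obtain ⟨r, hsr, hr⟩ := exists_clock_lt_of_lt hE₀ hfin hX hlt
  obtain ⟨r', hr', hr's⟩ := invClock_lt_iff.1 (show invClock Z v t ω < r by
    rw [h]; exact_mod_cast hsr)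
  have : clock Z v r' ω ≤ clock Z v r ω := Z.clock_mono v ω (by exact_mod_cast hr's.le)
  exact (hr'.trans_le this).not_gt hr

/-- The inverse clock is right-continuous, with strict increase, at each time when it is finite. -/
lemma tendsto_invClock (hE₀ : IsOpen E₀) (hv : ∀ x ∈ E₀, 0 < v x)
    (hm : Measurable fun r : ℝ => E₀.indicator (fun y => ENNReal.ofReal (v y)⁻¹) (Z.X r.toNNReal ω))
    (hfin : ∀ t, Z.X t ω ∈ E₀ → clock Z v t ω < ⊤) {u : ℝ≥0} (h : invClock Z v u ω < ⊤) :
    (∀ᶠ t in 𝓝[>] u, invClock Z v t ω < ⊤) ∧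
      Tendsto (fun t => (invClock Z v t ω).toNNReal) (𝓝[>] u) (𝓝[>] (invClock Z v u ω).toNNReal) := by
  lift invClock Z v u ω to ℝ≥0 using h.ne with s hs
  obtain ⟨hX, hc⟩ := of_invClock_eq hE₀ hfin hs.symm
  have key : ∀ b, s < b → ∀ᶠ t in 𝓝[>] u, invClock Z v t ω ≤ b := by
    intro b hb
    have h1 : (u : ℝ≥0∞) < clock Z v b ω := by
      rw [← hc]; exact clock_lt_clock hE₀ hv hm hX (hfin s hX) hb
    have h2 : ∀ᶠ t : ℝ≥0 in 𝓝[>] u, (t : ℝ≥0∞) < clock Z v b ω :=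
      nhdsWithin_le_nhds ((ENNReal.continuous_coe.tendsto u).eventually_lt_const h1)
    filter_upwards [h2] with t ht using invClock_le ht
  have hfinite : ∀ᶠ t in 𝓝[>] u, invClock Z v t ω < ⊤ := by
    filter_upwards [key (s + 1) (by simp)] with t ht using ht.trans_lt ENNReal.coe_lt_top
  refine ⟨hfinite, ?_⟩
  rw [ENNReal.toNNReal_coe]
  refine tendsto_nhdsWithin_iff.2 ⟨?_, ?_⟩
  · refine tendsto_order.2 ⟨fun a ha => ?_, fun b hb => ?_⟩
    · filter_upwards [hfinite, self_mem_nhdsWithin] with t ht hut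
      have := invClock_mono Z v ω (le_of_lt hut)
      simp only at this
      rw [← hs] at this
      exact ha.trans_le ((ENNReal.le_toNNReal_of_coe_le this ht.ne))
    · obtain ⟨b', h1, h2⟩ := exists_between hb
      filter_upwards [key b' h1] with t ht
      exact (ENNReal.toNNReal_mono ENNReal.coe_ne_top ht).trans_lt h2
  · filter_upwards [hfinite, self_mem_nhdsWithin] with t ht hut
    lift invClock Z v t ω to ℝ≥0 using ht.ne with r hr
    have hc' := (of_invClock_eq hE₀ hfin hr.symm).2
    rw [ENNReal.toNNReal_coe]
    by_contra! hle
    have hle' : r ≤ s := not_lt.1 hle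
    have : clock Z v r ω ≤ clock Z v s ω := Z.clock_mono v ω hle'
    rw [hc, hc'] at this
    exact (show u < t from hut).not_ge (by exact_mod_cast this)

variable (Z)

lemma invClock_lt_iff_nnrat {ω : Ω} {t : ℝ≥0} {c : ℝ≥0∞} :
    invClock Z v t ω < c ↔
      ∃ q : ℚ≥0, ((q : ℝ≥0) : ℝ≥0∞) < c ∧ (t : ℝ≥0∞) < clock Z v (q : ℝ≥0) ω := by
  rw [invClock_lt_iff]
  constructor
  · rintro ⟨s, h1, h2⟩
    obtain ⟨q, hq1, hq2⟩ := exists_nnrat_btwn_ennreal h2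
    exact ⟨q, hq2, h1.trans_le (Z.clock_mono v ω (by exact_mod_cast hq1.le))⟩
  · rintro ⟨q, h1, h2⟩
    exact ⟨q, h2, h1⟩

lemma measurable_rate [OpensMeasurableSpace E] (hE₀ : IsOpen E₀) (hv : ∀ x ∈ E₀, 0 < v x)
    (hvc : ContinuousOn v E₀) :
    Measurable (E₀.indicator fun y => ENNReal.ofReal (v y)⁻¹) := by
  classical
  rw [← Set.piecewise_eq_indicator]
  refine ContinuousOn.measurable_piecewise ?_ continuousOn_const hE₀.measurableSet
  exact ENNReal.continuous_ofReal.comp_continuousOn (hvc.inv₀ fun x hx => (hv x hx).ne')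

variable [TopologicalSpace.MetrizableSpace E] [BorelSpace E]

lemma measurable_clock_uncurry (hE₀ : IsOpen E₀) (hv : ∀ x ∈ E₀, 0 < v x)
    (hvc : ContinuousOn v E₀) : Measurable fun p : ℝ≥0 × Ω => clock Z v p.1 p.2 := by
  have h1 : Measurable fun p : (ℝ≥0 × Ω) × ℝ => (Icc (0 : ℝ) p.1.1).indicator (fun r =>
      E₀.indicator (fun y => ENNReal.ofReal (v y)⁻¹) (Z.X r.toNNReal p.1.2)) p.2 := by
    have h2 : Measurable fun p : (ℝ≥0 × Ω) × ℝ =>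
        E₀.indicator (fun y => ENNReal.ofReal (v y)⁻¹) (Z.X p.2.toNNReal p.1.2) :=
      (measurable_rate hE₀ hv hvc).comp (Z.measurable_uncurry_X.comp
        (measurable_snd.real_toNNReal.prodMk (measurable_snd.comp measurable_fst)))
    have h3 : MeasurableSet {p : (ℝ≥0 × Ω) × ℝ | p.2 ∈ Icc (0 : ℝ) p.1.1} := by
      refine (measurableSet_le measurable_const measurable_snd).inter
        (measurableSet_le measurable_snd ?_)
      exact (measurable_fst.comp measurable_fst).coe_nnreal_real
    exact h2.indicator h3
  have := h1.lintegral_prod_right' (ν := volume)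
  convert this using 2 with p
  rw [clock, ← lintegral_indicator measurableSet_Icc]

/-- The clock at `t` is an integral along the path stopped at `t`, all of whose values are `ℱ
t`-measurable. -/
lemma measurable_clock (hE₀ : IsOpen E₀) (hv : ∀ x ∈ E₀, 0 < v x)
    (hvc : ContinuousOn v E₀) (t : ℝ≥0) : Measurable[Z.ℱ t] fun ω => clock Z v t ω := by
  have h := @measurable_lintegral_comp_of_rightContinuous E _ _ _ _ Ω (Z.ℱ t)
    (fun s ω => Z.X (min s t) ω)
    (fun s => (Z.adapted _).mono (Z.ℱ.mono (min_le_right _ _)) le_rfl) (fun ω s => ?_) _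
    (measurable_rate hE₀ hv hvc) t
  · convert h using 2 with ω
    rw [clock]
    refine setLIntegral_congr_fun measurableSet_Icc fun r hr => ?_
    rw [min_eq_left]
    exact Real.toNNReal_le_iff_le_coe.2 hr.2
  · rcases lt_or_ge s t with hst | hst
    · rw [min_eq_left hst.le]
      refine (Z.right_continuous ω s).congr' ?_
      filter_upwards [nhdsWithin_le_nhds (Iio_mem_nhds hst)] with r hr
      rw [min_eq_left (le_of_lt hr)]
    · rw [min_eq_right hst]
      refine tendsto_const_nhds.congr' ?_
      filter_upwards [self_mem_nhdsWithin] with r hr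
      rw [min_eq_right (hst.trans (le_of_lt hr))]

lemma measurable_invClock_uncurry (hE₀ : IsOpen E₀) (hv : ∀ x ∈ E₀, 0 < v x)
    (hvc : ContinuousOn v E₀) : Measurable fun p : ℝ≥0 × Ω => invClock Z v p.1 p.2 := by
  refine measurable_of_Iio fun c => ?_
  have : (fun p : ℝ≥0 × Ω => invClock Z v p.1 p.2) ⁻¹' Iio c =
      ⋃ (q : ℚ≥0) (_ : ((q : ℝ≥0) : ℝ≥0∞) < c),
        {p : ℝ≥0 × Ω | (p.1 : ℝ≥0∞) < clock Z v (q : ℝ≥0) p.2} := by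
    ext p
    simp only [mem_preimage, mem_Iio, Z.invClock_lt_iff_nnrat, mem_iUnion, exists_prop,
      mem_ofPred_eq]
  rw [this]
  refine MeasurableSet.iUnion fun q => MeasurableSet.iUnion fun _ => measurableSet_lt
    measurable_fst.coe_nnreal_ennreal ?_
  exact (Z.measurable_clock_uncurry hE₀ hv hvc).comp (measurable_const.prodMk measurable_snd)

lemma isStoppingTime_invClock (hE₀ : IsOpen E₀) (hv : ∀ x ∈ E₀, 0 < v x)
    (hvc : ContinuousOn v E₀) (t u : ℝ≥0) : MeasurableSet[Z.ℱ u] {ω | invClock Z v t ω < u} := by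
  have : {ω | invClock Z v t ω < u} =
      ⋃ (q : ℚ≥0) (_ : ((q : ℝ≥0) : ℝ≥0∞) < u), {ω | (t : ℝ≥0∞) < clock Z v (q : ℝ≥0) ω} := by
    ext ω
    simp only [Z.invClock_lt_iff_nnrat, mem_iUnion, exists_prop, mem_ofPred_eq]
  rw [this]
  refine MeasurableSet.iUnion fun q => MeasurableSet.iUnion fun hq => ?_
  have hqu : (q : ℝ≥0) ≤ u := by exact_mod_cast hq.le
  exact Z.ℱ.mono hqu _ (Z.measurable_clock hE₀ hv hvc q measurableSet_Ioi)

/-- Almost surely, the clock is finite during the lifetime. -/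
lemma ae_clock_lt_top [CompactSpace E] (hE₀ : IsOpen E₀) (hv : ∀ x ∈ E₀, 0 < v x)
    (hvc : ContinuousOn v E₀) {x : E} (hx : x ∈ E₀) :
    ∀ᵐ ω ∂(Z.P x), ∀ t, Z.X t ω ∈ E₀ → clock Z v t ω < ⊤ := by
  obtain ⟨K, hK⟩ := exists_isExhaustion hE₀
  filter_upwards [Z.pathExit_eq_exitTime subset_rfl hK hx] with ω hω t ht
  -- Before its lifetime the path has stayed in a single `K n`. This set is compact, so `v⁻¹` is
  -- bounded along the path.
  have h1 : (t : ℝ≥0∞) < pathExit K fun t => Z.X t ω := by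
    rw [hω]; exact (lt_lifetime_iff hE₀).2 ht
  rw [pathExit_eq_iSup, lt_iSup_iff] at h1
  obtain ⟨n, hn⟩ := h1
  have h2 : ∀ s ≤ t, Z.X s ω ∈ K n := fun s hs =>
    mem_of_lt_pathExit_const (Z.right_continuous ω s) (hK.closed n)
      (lt_of_le_of_lt (by exact_mod_cast hs) hn)
  have hcomp : IsCompact (K n) := (hK.closed n).isCompact
  obtain ⟨C, hC⟩ := hcomp.bddAbove_image (f := fun y => (v y)⁻¹)
    ((hvc.mono (hK.subset n)).inv₀ fun y hy => (hv y (hK.subset n hy)).ne')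
  have h3 : clock Z v t ω ≤ ∫⁻ _ in Icc (0 : ℝ) t, ENNReal.ofReal C := by
    refine setLIntegral_mono measurable_const fun r hr => ?_
    have hmem := h2 r.toNNReal (Real.toNNReal_le_iff_le_coe.2 hr.2)
    rw [indicator_of_mem (hK.subset n hmem)]
    exact ENNReal.ofReal_le_ofReal (hC ⟨_, hmem, rfl⟩)
  refine h3.trans_lt ?_
  rw [setLIntegral_const]
  exact ENNReal.mul_lt_top ENNReal.ofReal_lt_top (by simp)

end StandardProcess

/-! ## Change of measure at fixed times -/

lemma measurable_map_stop {E : Type*} [MeasurableSpace E] (u : ℝ≥0) :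
    Measurable fun (w : ℝ≥0 → E) (t : ℝ≥0) => w (min t u) :=
  measurable_pi_lambda _ fun _ => measurable_pi_apply _

/-- The time-changed process `X_{γ_t}`, which only makes sense before its lifetime. -/
noncomputable def StandardProcess.changed {E : Type*} [TopologicalSpace E] [MeasurableSpace E]
    {E₀ : Set E} {Ω : Type*} [MeasurableSpace Ω] (Z : StandardProcess E E₀ Ω) (v : E → ℝ) (t : ℝ≥0)
    (ω : Ω) : E :=
  Z.X (invClock Z v t ω).toNNReal ω

namespace DualInversionProperty

variable {E : Type*} [TopologicalSpace E] [MeasurableSpace E] {E₀ : Set E}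
  {Ω Ω' : Type*} [MeasurableSpace Ω] [MeasurableSpace Ω'] {Z : StandardProcess E E₀ Ω}
  {Z' : StandardProcess E E₀ Ω'} {I : E → E} {h v : E → ℝ} {m : Measure E}
  (hD : DualInversionProperty Z Z' I h v m)

include hD

lemma pos_iff {x : E} : 0 < h x ↔ x ∈ E₀ := by
  refine ⟨fun hx => ?_, hD.pos x⟩
  by_contra hxE
  exact hx.ne' (hD.zero_boundary x hxE)

lemma nonneg (x : E) : 0 ≤ h x := by
  by_cases hx : x ∈ E₀
  · exact (hD.pos x hx).le
  · exact (hD.zero_boundary x hx).ge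

lemma measurable_weight : Measurable fun x => ENNReal.ofReal (h x) := hD.harmonic.1.ennreal_ofReal

lemma weight_eq_zero {x : E} (hx : x ∉ E₀) : ENNReal.ofReal (h x) = 0 := by
  rw [hD.zero_boundary x hx, ENNReal.ofReal_zero]

lemma weight_ne_zero {x : E} (hx : x ∈ E₀) : ENNReal.ofReal (h x) ≠ 0 :=
  (ENNReal.ofReal_pos.2 (hD.pos x hx)).ne'

lemma lintegral_weight_of_notMem {x : E} (hx : x ∉ E₀) (t : ℝ≥0) (f : E → ℝ≥0∞) :
    ∫⁻ ω, ENNReal.ofReal (h (Z'.X t ω)) * f (Z'.X t ω) ∂(Z'.P x) = 0 := by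
  rw [lintegral_congr_ae (g := fun _ => 0), lintegral_zero]
  filter_upwards [Z'.ae_mem_of_notMem hx] with ω hω
  rw [hω, hD.weight_eq_zero hx, zero_mul]

/-- Multiplication by `h x` clears the denominator of the kernel. The killing disappears from the
right side because `h` vanishes off `E₀`; for `h x = 0` absorption makes both sides `0`. -/
lemma lintegral_doobKernel (hE₀ : IsOpen E₀) [OpensMeasurableSpace E] (t : ℝ≥0) (x : E)
    {f : E → ℝ≥0∞} (hf : Measurable f) :
    ENNReal.ofReal (h x) * ∫⁻ y, f y ∂(doobKernel Z' h t x) =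
      ∫⁻ ω, ENNReal.ofReal (h (Z'.X t ω)) * f (Z'.X t ω) ∂(Z'.P x) := by
  have hset : {y | 0 < h y} = E₀ := by ext y; exact hD.pos_iff
  by_cases hx : 0 < h x
  · have hlife : {ω | (t : ℝ≥0∞) < exitTime Z'.X E₀ ω} = Z'.X t ⁻¹' E₀ := by
      ext ω; exact StandardProcess.lt_lifetime_iff hE₀
    have hmeas : Measurable fun y => ENNReal.ofReal (h y / h x) :=
      (hD.harmonic.1.div_const _).ennreal_ofReal
    rw [doobKernel, if_pos hx, lintegral_withDensity_eq_lintegral_mul _ hmeas hf,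
      lintegral_map (hmeas.mul hf) (Z'.measurable_X t),
      ← lintegral_const_mul _ (show Measurable fun ω => ((fun y => ENNReal.ofReal (h y / h x)) * f)
        (Z'.X t ω) from (hmeas.mul hf).comp (Z'.measurable_X t)), hset, hlife,
      ← lintegral_indicator (Z'.measurable_X t hE₀.measurableSet)]
    congr 1
    ext ω
    by_cases hω : Z'.X t ω ∈ E₀
    · rw [indicator_of_mem (show ω ∈ Z'.X t ⁻¹' E₀ from hω), Pi.mul_apply, ← mul_assoc,
        ← ENNReal.ofReal_mul hx.le, mul_div_cancel₀ _ hx.ne']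
    · rw [indicator_of_notMem (show ω ∉ Z'.X t ⁻¹' E₀ from hω), hD.weight_eq_zero hω, zero_mul]
  · rw [hD.lintegral_weight_of_notMem (fun hx' => hx (hD.pos x hx')), ENNReal.ofReal_of_nonpos
      (not_lt.1 hx), zero_mul]

/-- The ratios `h(y)/h(x)` telescope along the list and leave only `h` at the final time.
Measurability goes into the same induction, since the step integrates the function obtained from the
tail. -/
lemma markovFdd_doobKernel (hE₀ : IsOpen E₀) [OpensMeasurableSpace E] :
    ∀ l : List (ℝ≥0 × Set E), (∀ p ∈ l, MeasurableSet p.2) →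
      Measurable (fun x => markovFdd (doobKernel Z' h) x l) ∧
      ∀ x, ENNReal.ofReal (h x) * markovFdd (doobKernel Z' h) x l =
        Z'.fddIntegral (fun y => ENNReal.ofReal (h y)) x l
  | [], _ => ⟨measurable_const, fun x => by simp [markovFdd, StandardProcess.fddIntegral]⟩
  | (s, B) :: l, hl => by
    have hB : MeasurableSet B := hl (s, B) (by simp)
    have hl' : ∀ p ∈ l, MeasurableSet p.2 := fun p hp => hl p (List.mem_cons_of_mem _ hp)
    obtain ⟨ih1, ih2⟩ := markovFdd_doobKernel hE₀ l hl'
    have key : ∀ x, ENNReal.ofReal (h x) * markovFdd (doobKernel Z' h) x ((s, B) :: l) =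
        Z'.fddIntegral (fun y => ENNReal.ofReal (h y)) x ((s, B) :: l) := by
      intro x
      simp only [markovFdd, StandardProcess.fddIntegral]
      rw [← lintegral_indicator hB, hD.lintegral_doobKernel hE₀ s x (ih1.indicator hB)]
      congr 1
      ext ω
      by_cases hω : Z'.X s ω ∈ B
      · simp only [indicator_of_mem hω, ih2]
      · simp only [indicator_of_notMem hω, mul_zero]
    refine ⟨?_, key⟩
    -- The identity may be divided by `h x` everywhere: where `h` vanishes the kernel is zero by
    -- definition.
    have heq : (fun x => markovFdd (doobKernel Z' h) x ((s, B) :: l)) = fun x =>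
        (ENNReal.ofReal (h x))⁻¹ * Z'.fddIntegral (fun y => ENNReal.ofReal (h y)) x ((s, B) :: l) := by
      ext x
      rw [← key, ← mul_assoc]
      by_cases hx : 0 < h x
      · rw [ENNReal.inv_mul_cancel (ENNReal.ofReal_pos.2 hx).ne' ENNReal.ofReal_ne_top, one_mul]
      · rw [ENNReal.ofReal_of_nonpos (not_lt.1 hx), mul_zero, zero_mul, markovFdd, doobKernel,
          if_neg hx]
        simp
    rw [heq]
    exact hD.measurable_weight.inv.mul (Z'.measurable_fddIntegral hD.measurable_weight _ hl)

variable [TopologicalSpace.MetrizableSpace E] [BorelSpace E]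

lemma measurable_changed (hE₀ : IsOpen E₀) : Measurable fun p : ℝ≥0 × Ω => Z.changed v p.1 p.2 :=
  Z.measurable_uncurry_X.comp ((Z.measurable_invClock_uncurry hE₀ hD.v_pos
    hD.v_continuous).ennreal_toNNReal.prodMk measurable_snd)

lemma measurable_invClock (hE₀ : IsOpen E₀) (u : ℝ≥0) : Measurable fun ω => invClock Z v u ω :=
  Measurable.comp (g := fun p : ℝ≥0 × Ω => invClock Z v p.1 p.2) (f := fun ω => (u, ω))
    (Z.measurable_invClock_uncurry hE₀ hD.v_pos hD.v_continuous) measurable_prodMk_left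

lemma measurableSet_alive (hE₀ : IsOpen E₀) (u : ℝ≥0) : MeasurableSet {ω | invClock Z v u ω < ⊤} :=
  hD.measurable_invClock hE₀ u measurableSet_Iio

lemma measurable_inverted (hE₀ : IsOpen E₀) : Measurable fun ω t => I (Z.changed v t ω) :=
  measurable_pi_lambda _ fun t => hD.measurable_I.comp
    (Measurable.comp (g := fun p : ℝ≥0 × Ω => Z.changed v p.1 p.2) (f := fun ω => (t, ω))
      (hD.measurable_changed hE₀) measurable_prodMk_left)

/-- On functionals of the path up to time `u`, the law of `I(X_{γ})` started at `x` has density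
`h(X̂_u) / h(I x)` with respect to the law of `X̂` started at `I x`. -/
lemma change_of_measure (hE₀ : IsOpen E₀) (x : E) (u : ℝ≥0) {F : (ℝ≥0 → E) → ℝ≥0∞}
    (hF : Measurable F) :
    ∫⁻ ω, ENNReal.ofReal (h (Z'.X u ω)) * F (fun t => Z'.X (min t u) ω) ∂(Z'.P (I x)) =
      ENNReal.ofReal (h (I x)) * ∫⁻ ω in {ω | invClock Z v u ω < ⊤},
        F (fun t => I (Z.changed v (min t u) ω)) ∂(Z.P x) := by
  have hY := hD.measurable_inverted hE₀
  have hY' := Z'.measurable_path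
  have hw : Measurable fun ω => ENNReal.ofReal (h (Z'.X u ω)) :=
    hD.measurable_weight.comp (Z'.measurable_X u)
  have hfin : IsFiniteMeasure (ENNReal.ofReal (h (I x)) •
      (Z.P x).restrict {ω | invClock Z v u ω < ⊤}) :=
    Measure.smul_finite _ ENNReal.ofReal_ne_top
  have key := measure_map_stoppedPath_ext (μ := ENNReal.ofReal (h (I x)) •
      (Z.P x).restrict {ω | invClock Z v u ω < ⊤})
    (μ' := (Z'.P (I x)).withDensity fun ω => ENNReal.ofReal (h (Z'.X u ω))) hY hY' u ?_
  · have h1 := congrArg (fun μ => ∫⁻ w, F w ∂μ) key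
    have hYs : Measurable fun ω t => I (Z.changed v (min t u) ω) := (measurable_map_stop u).comp hY
    have hYs' : Measurable fun ω t => Z'.X (min t u) ω := (measurable_map_stop u).comp hY'
    rw [lintegral_map hF hYs, lintegral_map hF hYs', lintegral_smul_measure,
      lintegral_withDensity_eq_lintegral_mul _ hw
        (show Measurable fun ω => F fun t => Z'.X (min t u) ω from hF.comp hYs')] at h1
    exact h1.symm
  · intro J hJ B hB
    have hm' : MeasurableSet {ω | ∀ t ∈ J, Z'.X t ω ∈ B t} := by
      have : {ω | ∀ t ∈ J, Z'.X t ω ∈ B t} = ⋂ t ∈ J, Z'.X t ⁻¹' B t := by ext; simp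
      rw [this]
      exact Finset.measurableSet_biInter _ fun t _ => Z'.measurable_X t (hB t)
    have hm : MeasurableSet {ω | ∀ t ∈ J, I (Z.changed v t ω) ∈ B t} := by
      have : {ω | ∀ t ∈ J, I (Z.changed v t ω) ∈ B t} =
          ⋂ t ∈ J, (fun ω => I (Z.changed v t ω)) ⁻¹' B t := by ext; simp
      rw [this]
      exact Finset.measurableSet_biInter _ fun t _ => (measurable_pi_iff.1 hY t) (hB t)
    have hl := measurableSet_finsetIncr J u hB
    -- The list of increments ends exactly at `u`, so the telescoped weight is `h(X̂_u)`, and the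
    -- event on the other side includes survival up to `u`.
    have h1 := hD.law x _ hl
    have h2 := (hD.markovFdd_doobKernel hE₀ _ hl).2 (I x)
    rw [← h1, ← Z'.lintegral_fddEvent hD.measurable_weight (I x) hl, endTime_finsetIncr hJ,
      fddEvent_finsetIncr hJ, fddEvent_finsetIncr hJ] at h2
    rw [withDensity_apply _ hm', ← lintegral_indicator hm', Measure.smul_apply, smul_eq_mul,
      Measure.restrict_apply hm]
    convert h2 using 2
    · congr 1
      ext ω
      simp only [mem_inter_iff, mem_ofPred_eq]
      have hal : (∃ y, invertedProcess Z I v u ω = some y) ↔ invClock Z v u ω < ⊤ := by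
        simp only [invertedProcess]
        split_ifs with hc
        · simp [hc]
        · simp [hc]
      rw [hal]
      refine and_congr_left fun hu => forall₂_congr fun t ht => ?_
      have ht' : invClock Z v t ω < ⊤ := (StandardProcess.invClock_mono Z v ω (hJ t ht)).trans_lt hu
      rw [invertedProcess, if_pos ht']
      simp [StandardProcess.changed]
    · ext ω
      simp

/-- The involution preserves the interior of the state space. -/
lemma mem_iff (hE₀ : IsOpen E₀) {x : E} : I x ∈ E₀ ↔ x ∈ E₀ := by
  have key : ∀ x, x ∉ E₀ → I x ∉ E₀ := by
    intro x hx hIx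
    -- Started outside `E₀`, the clock of `X` stays at `0` and the time-changed process is never
    -- alive, so the right side is `0`; the left side is `h(I x)`.
    have h1 := hD.change_of_measure hE₀ x 0 (F := fun _ => 1) measurable_const
    have h2 : (Z.P x) {ω | invClock Z v 0 ω < ⊤} = 0 := by
      rw [← nonpos_iff_eq_zero, ← measure_empty (μ := Z.P x)]
      refine measure_mono_ae ?_
      filter_upwards [Z.start x] with ω hω
      intro hlt
      obtain ⟨s, hs, -⟩ := StandardProcess.invClock_lt_iff.1 hlt
      rw [StandardProcess.clock_eq_of_notMem v (zero_le (a := s)) (by rwa [hω]),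
        StandardProcess.clock_zero] at hs
      exact absurd hs (by simp)
    rw [Measure.restrict_eq_zero.2 h2, lintegral_zero_measure, mul_zero,
      lintegral_congr_ae (g := fun _ => ENNReal.ofReal (h (I x)))] at h1
    · simp only [lintegral_const, measure_univ, mul_one] at h1
      exact hD.weight_ne_zero hIx h1
    · filter_upwards [Z'.start (I x)] with ω hω
      rw [hω, mul_one]
  refine ⟨fun h1 => ?_, fun h1 => ?_⟩
  · by_contra hx
    exact key x hx h1
  · by_contra hx
    have := key _ hx
    rw [hD.involutive] at this
    exact this h1

end DualInversionProperty

/-! ## Change of measure at random times -/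

/-- Fubini's theorem after shifting the time by a random time. -/
lemma lintegral_shift_eq {Ω : Type*} [MeasurableSpace Ω] (μ : Measure Ω) [SFinite μ] {σ : Ω → ℝ≥0}
    (hσ : Measurable σ) {G : ℝ≥0 × Ω → ℝ≥0∞} (hG : Measurable G) {A : Set ℝ}
    (hA : MeasurableSet A) (hA0 : A ⊆ Ioi 0) :
    ∫⁻ s in A, ∫⁻ ω, G (σ ω + s.toNNReal, ω) ∂μ =
      ∫⁻ u in Ioi (0 : ℝ), ∫⁻ ω, A.indicator 1 (u - σ ω) * G (u.toNNReal, ω) ∂μ := by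
  have h1 : Measurable fun p : ℝ × Ω => G (σ p.2 + p.1.toNNReal, p.2) :=
    hG.comp (((hσ.comp measurable_snd).add measurable_fst.real_toNNReal).prodMk measurable_snd)
  have h2 : Measurable fun p : ℝ × Ω => A.indicator (1 : ℝ → ℝ≥0∞) (p.1 - σ p.2) *
      G (p.1.toNNReal, p.2) := by
    refine Measurable.mul ?_ (hG.comp (measurable_fst.real_toNNReal.prodMk measurable_snd))
    exact (measurable_one.indicator hA).comp
      (measurable_fst.sub (hσ.comp measurable_snd).coe_nnreal_real)
  rw [lintegral_lintegral_swap h1.aemeasurable]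
  conv_rhs => rw [lintegral_lintegral_swap h2.aemeasurable]
  congr 1
  ext ω
  rw [← lintegral_indicator hA, ← lintegral_indicator measurableSet_Ioi,
    ← lintegral_sub_right_eq_self _ (σ ω : ℝ)]
  congr 1
  ext u
  by_cases hu : u - σ ω ∈ A
  · have h0 : 0 < u - σ ω := hA0 hu
    have hu0 : 0 < u := by
      have := (σ ω).2
      linarith [(σ ω).coe_nonneg]
    rw [indicator_of_mem hu, indicator_of_mem (show u ∈ Ioi 0 from hu0), indicator_of_mem hu,
      Pi.one_apply, one_mul]
    congr 2
    rw [← Real.toNNReal_coe (r := σ ω), ← Real.toNNReal_add (σ ω).coe_nonneg (by simpa using h0.le)]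
    simp
  · rw [indicator_of_notMem hu]
    by_cases hu0 : u ∈ Ioi (0 : ℝ)
    · rw [indicator_of_mem hu0, indicator_of_notMem hu, zero_mul]
    · rw [indicator_of_notMem hu0]

/-- Every interval `(0, u)` has positive length, so an almost everywhere identity holds at points
arbitrarily close to `0`. That suffices to identify limits at `0`. -/
lemma frequently_eq_of_ae {α β : ℝ≥0 → ℝ≥0∞}
    (h : (fun s : ℝ => α s.toNNReal) =ᵐ[volume.restrict (Ioi 0)] fun s => β s.toNNReal) :
    ∃ᶠ s in 𝓝[>] (0 : ℝ≥0), α s = β s := by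
  intro hn
  obtain ⟨u, hu0, hu⟩ := (mem_nhdsGT_iff_exists_Ioo_subset).1 hn
  have h1 : Ioo (0 : ℝ) u ⊆ {s : ℝ | ¬ α s.toNNReal = β s.toNNReal} := by
    rintro s ⟨hs0, hsu⟩
    lift s to ℝ≥0 using hs0.le
    have := hu ⟨show 0 < s by exact_mod_cast hs0, show s < u by exact_mod_cast hsu⟩
    simpa using this
  have h2 := measure_mono_null h1 (ae_iff.1 h)
  rw [Measure.restrict_apply measurableSet_Ioo, inter_eq_left.2 Ioo_subset_Ioi_self,
    Real.volume_Ioo, ENNReal.ofReal_eq_zero, sub_zero] at h2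
  exact (show 0 < u from hu0).not_ge (by exact_mod_cast h2)

namespace DualInversionProperty

variable {E : Type*} [TopologicalSpace E] [MeasurableSpace E] {E₀ : Set E}
  {Ω Ω' : Type*} [MeasurableSpace Ω] [MeasurableSpace Ω'] {Z : StandardProcess E E₀ Ω}
  {Z' : StandardProcess E E₀ Ω'} {I : E → E} {h v : E → ℝ} {m : Measure E}
  [TopologicalSpace.MetrizableSpace E] [BorelSpace E]
  (hD : DualInversionProperty Z Z' I h v m)

include hD

/-- Right-continuity of the time-changed process, killed at the end of its lifetime. -/
lemma tendsto_changed (hE₀ : IsOpen E₀) {ω : Ω}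
    (hfin : ∀ t, Z.X t ω ∈ E₀ → clock Z v t ω < ⊤) {φ : E → ℝ≥0∞} (hφ : Continuous φ) (u : ℝ≥0) :
    Tendsto (fun t => {t | invClock Z v t ω < ⊤}.indicator (fun t => φ (Z.changed v t ω)) t)
      (𝓝[>] u) (𝓝 ({t | invClock Z v t ω < ⊤}.indicator (fun t => φ (Z.changed v t ω)) u)) := by
  have hm : Measurable fun r : ℝ =>
      E₀.indicator (fun y => ENNReal.ofReal (v y)⁻¹) (Z.X r.toNNReal ω) :=
    (StandardProcess.measurable_rate hE₀ hD.v_pos hD.v_continuous).comp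
      (Z.measurable_uncurry_X.comp (measurable_real_toNNReal.prodMk measurable_const))
  by_cases hu : invClock Z v u ω < ⊤
  · obtain ⟨h1, h2⟩ := StandardProcess.tendsto_invClock hE₀ hD.v_pos hm hfin hu
    rw [indicator_of_mem (show u ∈ {t | invClock Z v t ω < ⊤} from hu)]
    have h3 : Tendsto (fun t => φ (Z.changed v t ω)) (𝓝[>] u) (𝓝 (φ (Z.changed v u ω))) :=
      (hφ.tendsto _).comp ((Z.right_continuous ω _).comp h2)
    refine h3.congr' ?_
    filter_upwards [h1] with t ht
    rw [indicator_of_mem (show t ∈ {t | invClock Z v t ω < ⊤} from ht)]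
  -- Once dead, the time-changed process stays dead.
  · rw [indicator_of_notMem (show u ∉ {t | invClock Z v t ω < ⊤} from hu)]
    refine tendsto_const_nhds.congr' ?_
    filter_upwards [self_mem_nhdsWithin] with t ht
    rw [indicator_of_notMem]
    intro ht'
    exact hu ((StandardProcess.invClock_mono Z v ω (le_of_lt ht)).trans_lt ht')

lemma measurable_killed (hE₀ : IsOpen E₀) {φ : E → ℝ≥0∞} (hφ : Measurable φ) :
    Measurable fun p : ℝ≥0 × Ω =>
      {t | invClock Z v t p.2 < ⊤}.indicator (fun t => φ (Z.changed v t p.2)) p.1 := by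
  have h1 : MeasurableSet {p : ℝ≥0 × Ω | invClock Z v p.1 p.2 < ⊤} :=
    Z.measurable_invClock_uncurry hE₀ hD.v_pos hD.v_continuous measurableSet_Iio
  exact (hφ.comp (hD.measurable_changed hE₀)).indicator h1

lemma ae_changed_zero [CompactSpace E] (hE₀ : IsOpen E₀) {x : E} (hx : x ∈ E₀) :
    ∀ᵐ ω ∂(Z.P x), invClock Z v 0 ω = 0 ∧ Z.changed v 0 ω = x := by
  filter_upwards [Z.start x] with ω hω
  have hm : Measurable fun r : ℝ =>
      E₀.indicator (fun y => ENNReal.ofReal (v y)⁻¹) (Z.X r.toNNReal ω) :=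
    (StandardProcess.measurable_rate hE₀ hD.v_pos hD.v_continuous).comp
      (Z.measurable_uncurry_X.comp (measurable_real_toNNReal.prodMk measurable_const))
  have h0 : invClock Z v 0 ω = 0 := by
    have := StandardProcess.invClock_clock (s := 0) (t := 0) hE₀ hD.v_pos hm (by rwa [hω])
      (by rw [StandardProcess.clock_zero]; simp)
    simpa using this
  exact ⟨h0, by rw [StandardProcess.changed, h0]; simpa using hω⟩

/-- The `h`-weighted semigroup of the dual process in terms of the time-changed process. -/
lemma lintegral_weight_mul (hE₀ : IsOpen E₀) (z : E) (s : ℝ≥0) {φ : E → ℝ≥0∞} (hφ : Measurable φ) :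
    ∫⁻ ω, ENNReal.ofReal (h (Z'.X s ω)) * φ (I (Z'.X s ω)) ∂(Z'.P z) =
      ENNReal.ofReal (h z) * ∫⁻ ω, {t | invClock Z v t ω < ⊤}.indicator
        (fun t => φ (Z.changed v t ω)) s ∂(Z.P (I z)) := by
  have h1 := hD.change_of_measure hE₀ (I z) s (F := fun w => φ (I (w s)))
    (hφ.comp (hD.measurable_I.comp (measurable_pi_apply s)))
  rw [hD.involutive z] at h1
  simp only [min_self, hD.involutive (Z.changed v s _)] at h1
  rw [h1, ← lintegral_indicator (hD.measurableSet_alive hE₀ s)]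
  rfl

/-- With `φ = 1` this is the supermean property of `h` for the dual process. The bound is uniform in
`s` and serves as dominating function when `s` decreases to `0`. -/
lemma lintegral_weight_mul_le (hE₀ : IsOpen E₀) (z : E) (s : ℝ≥0) {φ : E → ℝ≥0∞}
    (hφ : Measurable φ) {C : ℝ≥0∞} (hC : ∀ z, φ z ≤ C) :
    ∫⁻ ω, ENNReal.ofReal (h (Z'.X s ω)) * φ (I (Z'.X s ω)) ∂(Z'.P z) ≤ ENNReal.ofReal (h z) * C := by
  rw [hD.lintegral_weight_mul hE₀ z s hφ]
  gcongr
  calc _ ≤ ∫⁻ _, C ∂(Z.P (I z)) := by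
        refine lintegral_mono fun ω => indicator_le' (fun t _ => hC _) (fun _ _ => zero_le) s
    _ = C := by simp

/-- The change of measure trades the weight `h(X̂_s)` for the constant `h z` and `I` for the
identity, so neither has to be continuous: the limit is that of `φ(X_{γ_s})`, a right-continuous
process. -/
lemma tendsto_lintegral_weight_mul [CompactSpace E] (hE₀ : IsOpen E₀) (z : E) {φ : E → ℝ≥0∞}
    (hφm : Measurable φ) (hφ : Continuous φ) {C : ℝ≥0∞} (hC : ∀ z, φ z ≤ C) (hC' : C ≠ ⊤) :
    Tendsto (fun s => ∫⁻ ω, ENNReal.ofReal (h (Z'.X s ω)) * φ (I (Z'.X s ω)) ∂(Z'.P z)) (𝓝[>] 0)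
      (𝓝 (ENNReal.ofReal (h z) * φ (I z))) := by
  by_cases hz : z ∈ E₀
  · simp_rw [hD.lintegral_weight_mul hE₀ z _ hφm]
    refine ENNReal.Tendsto.const_mul ?_ (Or.inr ENNReal.ofReal_ne_top)
    have hz' : I z ∈ E₀ := (hD.mem_iff hE₀).2 hz
    have h1 : ∫⁻ _, φ (I z) ∂(Z.P (I z)) = φ (I z) := by simp
    rw [← h1]
    refine tendsto_lintegral_filter_of_dominated_convergence (fun _ => C) ?_ ?_ (by simpa) ?_
    · exact Eventually.of_forall fun s => Measurable.comp (f := fun ω => (s, ω))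
        (hD.measurable_killed hE₀ hφm) measurable_prodMk_left
    · exact Eventually.of_forall fun s => Eventually.of_forall fun ω =>
        indicator_le' (fun t _ => hC _) (fun _ _ => zero_le) s
    · filter_upwards [Z.ae_clock_lt_top hE₀ hD.v_pos hD.v_continuous hz',
        hD.ae_changed_zero hE₀ hz'] with ω hfin h0
      have := hD.tendsto_changed hE₀ hfin hφ 0
      rwa [indicator_of_mem (show (0 : ℝ≥0) ∈ {t | invClock Z v t ω < ⊤} by
        simp [h0.1]), h0.2] at this
  · simp_rw [hD.lintegral_weight_of_notMem hz _ (fun y => φ (I y)), hD.weight_eq_zero hz, zero_mul]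
    exact tendsto_const_nhds

variable {T : (ℝ≥0 → E) → ℝ≥0∞}

/-- The `h`-weighted expectation at `T + s` for the dual process, and the corresponding
expectation for the time-changed process, agree for almost all `s`. -/
lemma frequently_shift_eq (hE₀ : IsOpen E₀) (hT : IsPathTime T) (x : E) {φ : E → ℝ≥0∞}
    (hφ : Measurable φ) :
    ∃ᶠ s in 𝓝[>] (0 : ℝ≥0),
      ∫⁻ ω in {ω | T (fun t => Z'.X t ω) < ⊤},
        ENNReal.ofReal (h (Z'.X ((T fun t => Z'.X t ω).toNNReal + s) ω)) *
          φ (I (Z'.X ((T fun t => Z'.X t ω).toNNReal + s) ω)) ∂(Z'.P (I x)) =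
      ENNReal.ofReal (h (I x)) * ∫⁻ ω in {ω | T (fun t => I (Z.changed v t ω)) < ⊤},
        {t | invClock Z v t ω < ⊤}.indicator (fun t => φ (Z.changed v t ω))
          ((T fun t => I (Z.changed v t ω)).toNNReal + s) ∂(Z.P x) := by
  have hτ : Measurable fun ω => T fun t => I (Z.changed v t ω) :=
    hT.measurable.comp (hD.measurable_inverted hE₀)
  have hτ' : Measurable fun ω => T fun t => Z'.X t ω := hT.measurable.comp Z'.measurable_path
  set σ : Ω → ℝ≥0 := fun ω => (T fun t => I (Z.changed v t ω)).toNNReal with hσ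
  set σ' : Ω' → ℝ≥0 := fun ω => (T fun t => Z'.X t ω).toNNReal with hσ'
  have hσm : Measurable σ := hτ.ennreal_toNNReal
  have hσm' : Measurable σ' := hτ'.ennreal_toNNReal
  set G : ℝ≥0 × Ω → ℝ≥0∞ := fun p =>
    {t | invClock Z v t p.2 < ⊤}.indicator (fun t => φ (Z.changed v t p.2)) p.1 with hG
  set G' : ℝ≥0 × Ω' → ℝ≥0∞ := fun p =>
    ENNReal.ofReal (h (Z'.X p.1 p.2)) * φ (I (Z'.X p.1 p.2)) with hG'
  have hGm : Measurable G := hD.measurable_killed hE₀ hφ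
  have hGm' : Measurable G' := (hD.measurable_weight.comp Z'.measurable_uncurry_X).mul
    ((hφ.comp hD.measurable_I).comp Z'.measurable_uncurry_X)
  set μ := ENNReal.ofReal (h (I x)) • (Z.P x).restrict {ω | T (fun t => I (Z.changed v t ω)) < ⊤}
  have hμ : IsFiniteMeasure μ := Measure.smul_finite _ ENNReal.ofReal_ne_top
  set μ' := (Z'.P (I x)).restrict {ω | T (fun t => Z'.X t ω) < ⊤}
  have key : ∃ᶠ s in 𝓝[>] (0 : ℝ≥0), ∫⁻ ω, G' (σ' ω + s, ω) ∂μ' = ∫⁻ ω, G (σ ω + s, ω) ∂μ := by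
    refine frequently_eq_of_ae ?_
    have hm1 : Measurable fun p : ℝ × Ω => G (σ p.2 + p.1.toNNReal, p.2) :=
      hGm.comp (((hσm.comp measurable_snd).add measurable_fst.real_toNNReal).prodMk measurable_snd)
    have hm2 : Measurable fun p : ℝ × Ω' => G' (σ' p.2 + p.1.toNNReal, p.2) :=
      hGm'.comp (((hσm'.comp measurable_snd).add measurable_fst.real_toNNReal).prodMk measurable_snd)
    -- It suffices to compare integrals over Borel sets `A` of shifts. Substituting `u = T + s`
    -- turns each into an integral over fixed times `u` with the weight `1_A(u - T)`.
    refine ae_eq_of_forall_setLIntegral_eq_of_sigmaFinite hm2.lintegral_prod_right'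
      hm1.lintegral_prod_right' fun A hA _ => ?_
    rw [Measure.restrict_restrict hA]
    have hA' : MeasurableSet (A ∩ Ioi 0) := hA.inter measurableSet_Ioi
    have hA0 : A ∩ Ioi 0 ⊆ Ioi (0 : ℝ) := inter_subset_right
    rw [lintegral_shift_eq μ' hσm' hGm' hA' hA0, lintegral_shift_eq μ hσm hGm hA' hA0]
    refine setLIntegral_congr_fun measurableSet_Ioi fun u hu => ?_
    lift u to ℝ≥0 using (le_of_lt hu)
    simp only [Real.toNNReal_coe]
    -- Since `A` is cut down to positive shifts, `k c` vanishes for `c ≥ u`. By causality `k ∘ T`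
    -- then depends only on the path up to `u`, as the fixed-time change of measure requires.
    set k : ℝ≥0∞ → ℝ≥0∞ := (Iio ⊤).indicator fun c =>
      (A ∩ Ioi (0 : ℝ)).indicator 1 ((u : ℝ) - c.toNNReal) with hk
    have hkm : Measurable k := ((measurable_one.indicator hA').comp
      (measurable_const.sub ENNReal.measurable_toNNReal.coe_nnreal_real)).indicator measurableSet_Iio
    have hk0 : ∀ c : ℝ≥0∞, (u : ℝ≥0∞) ≤ c → k c = 0 := by
      intro c hc
      by_cases hc' : c ∈ Iio ⊤
      · rw [hk, indicator_of_mem hc', indicator_of_notMem]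
        rintro ⟨-, h0⟩
        lift c to ℝ≥0 using (show c ≠ ⊤ from LT.lt.ne hc')
        have h1 : (u : ℝ) ≤ c := by exact_mod_cast hc
        have h2 : 0 < (u : ℝ) - c := h0
        linarith
      · rw [hk, indicator_of_notMem hc']
    have hkT : ∀ w : ℝ≥0 → E, k (T fun t => w (min t u)) = k (T w) := by
      intro w
      rcases lt_or_ge (T w) u with hw | hw
      · rw [hT.causal w (fun t => w (min t u)) u (fun s hs => by simp [hs]) hw]
      · rcases lt_or_ge (T fun t => w (min t u)) u with hw' | hw'
        · rw [hT.causal (fun t => w (min t u)) w u (fun s hs => by simp [hs]) hw']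
        · rw [hk0 _ hw, hk0 _ hw']
    have hkX' : ∀ ω, k (T fun t => Z'.X (min t u) ω) = k (T fun t => Z'.X t ω) :=
      fun ω => hkT fun t => Z'.X t ω
    have hkX : ∀ ω, k (T fun t => I (Z.changed v (min t u) ω)) =
        k (T fun t => I (Z.changed v t ω)) := fun ω => hkT fun t => I (Z.changed v t ω)
    have h1 := hD.change_of_measure hE₀ x u (F := fun w => k (T w) * φ (I (w u)))
      ((hkm.comp hT.measurable).mul (hφ.comp (hD.measurable_I.comp (measurable_pi_apply u))))
    simp only [hkX, hkX', min_self,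
      hD.involutive (Z.changed v u _)] at h1
    have hS' : MeasurableSet {ω | T (fun t => Z'.X t ω) < ⊤} := hτ' measurableSet_Iio
    have hS : MeasurableSet {ω | T (fun t => I (Z.changed v t ω)) < ⊤} := hτ measurableSet_Iio
    rw [lintegral_smul_measure, ← lintegral_indicator hS', ← lintegral_indicator hS, smul_eq_mul]
    rw [← lintegral_indicator (hD.measurableSet_alive hE₀ u)] at h1
    convert h1 using 2
    · ext ω
      by_cases hω : T (fun t => Z'.X t ω) < ⊤
      · rw [indicator_of_mem (show ω ∈ {ω | T (fun t => Z'.X t ω) < ⊤} from hω), hk,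
          indicator_of_mem (show T (fun t => Z'.X t ω) ∈ Iio ⊤ from hω), hG']
        ring
      · rw [indicator_of_notMem (show ω ∉ {ω | T (fun t => Z'.X t ω) < ⊤} from hω), hk,
          indicator_of_notMem (show T (fun t => Z'.X t ω) ∉ Iio ⊤ from hω), zero_mul, mul_zero]
    · congr 1
      ext ω
      by_cases hω : T (fun t => I (Z.changed v t ω)) < ⊤
      · rw [indicator_of_mem (show ω ∈ {ω | T (fun t => I (Z.changed v t ω)) < ⊤} from hω), hG]
        simp only
        by_cases hc : invClock Z v u ω < ⊤
        · rw [indicator_of_mem (show u ∈ {t | invClock Z v t ω < ⊤} from hc),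
            indicator_of_mem (show ω ∈ {ω | invClock Z v u ω < ⊤} from hc), hk,
            indicator_of_mem (show T (fun t => I (Z.changed v t ω)) ∈ Iio ⊤ from hω)]
        · rw [indicator_of_notMem (show u ∉ {t | invClock Z v t ω < ⊤} from hc),
            indicator_of_notMem (show ω ∉ {ω | invClock Z v u ω < ⊤} from hc), mul_zero]
      · rw [indicator_of_notMem (show ω ∉ {ω | T (fun t => I (Z.changed v t ω)) < ⊤} from hω)]
        symm
        refine indicator_apply_eq_zero.2 fun _ => ?_
        rw [hk, indicator_of_notMem (show T (fun t => I (Z.changed v t ω)) ∉ Iio ⊤ from hω), zero_mul]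
  refine key.mono fun s hs => ?_
  rw [lintegral_smul_measure, smul_eq_mul] at hs
  exact hs

end DualInversionProperty

lemma killed_le {E Ω : Type*} [TopologicalSpace E] [MeasurableSpace E] {E₀ : Set E}
    [MeasurableSpace Ω] (Z : StandardProcess E E₀ Ω) (v : E → ℝ) (s : ℝ≥0) (ω : Ω) {φ : E → ℝ≥0∞}
    {C : ℝ≥0∞} (hC : ∀ z, φ z ≤ C) :
    {t | invClock Z v t ω < ⊤}.indicator (fun t => φ (Z.changed v t ω)) s ≤ C :=
  indicator_le' (fun _ _ => hC _) (fun _ _ => zero_le) s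

namespace DualInversionProperty

variable {E : Type*} [TopologicalSpace E] [MeasurableSpace E] {E₀ : Set E}
  {Ω Ω' : Type*} [MeasurableSpace Ω] [MeasurableSpace Ω'] {Z : StandardProcess E E₀ Ω}
  {Z' : StandardProcess E E₀ Ω'} {I : E → E} {h v : E → ℝ} {m : Measure E}
  [TopologicalSpace.MetrizableSpace E] [BorelSpace E]
  (hD : DualInversionProperty Z Z' I h v m) {T : (ℝ≥0 → E) → ℝ≥0∞}

include hD

/-- The shift `s` moves into an inner expectation started at `X̂_T`, whose limit as `s` decreases to
`0` is known at every point. -/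
lemma lintegral_shift_markov (hT : IsPathTime T) (y : E) (s : ℝ≥0) {φ : E → ℝ≥0∞}
    (hφ : Measurable φ) :
    ∫⁻ ω in {ω | T (fun t => Z'.X t ω) < ⊤},
        ENNReal.ofReal (h (Z'.X ((T fun t => Z'.X t ω).toNNReal + s) ω)) *
          φ (I (Z'.X ((T fun t => Z'.X t ω).toNNReal + s) ω)) ∂(Z'.P y) =
      ∫⁻ ω in {ω | T (fun t => Z'.X t ω) < ⊤},
        ∫⁻ ω', ENNReal.ofReal (h (Z'.X s ω')) * φ (I (Z'.X s ω'))
          ∂(Z'.P (Z'.X (T fun t => Z'.X t ω).toNNReal ω)) ∂(Z'.P y) := by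
  have := Z'.strong_markov_lintegral (Z'.isStoppingTime_pathTime hT) y s (L := univ)
    MeasurableSet.univ (f := fun z => ENNReal.ofReal (h z) * φ (I z))
    (hD.measurable_weight.mul (hφ.comp hD.measurable_I))
  simpa only [univ_inter] using this

lemma measurable_weight_exit (hT : IsPathTime T) : Measurable fun ω =>
    ENNReal.ofReal (h (Z'.X (T fun t => Z'.X t ω).toNNReal ω)) :=
  hD.measurable_weight.comp
    (Z'.measurable_X_comp (hT.measurable.comp Z'.measurable_path).ennreal_toNNReal)

lemma measurable_killed_shift (hE₀ : IsOpen E₀) (hT : IsPathTime T) (s : ℝ≥0) {φ : E → ℝ≥0∞}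
    (hφ : Measurable φ) : Measurable fun ω =>
    {t | invClock Z v t ω < ⊤}.indicator (fun t => φ (Z.changed v t ω))
      ((T fun t => I (Z.changed v t ω)).toNNReal + s) :=
  Measurable.comp (f := fun ω => ((T fun t => I (Z.changed v t ω)).toNNReal + s, ω))
    (hD.measurable_killed hE₀ hφ)
    (((hT.measurable.comp (hD.measurable_inverted hE₀)).ennreal_toNNReal.add_const s).prodMk
      measurable_id)

/-- Along a sequence of good shifts decreasing to `0`, the weighted mass at `T + s` is at most `h(I
x)`; Fatou's lemma carries the bound to `T`. This supplies the integrability for dominated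
convergence with an unbounded `h`. -/
lemma lintegral_weight_exit_lt_top [CompactSpace E] (hE₀ : IsOpen E₀) (hT : IsPathTime T) (x : E) :
    ∫⁻ ω in {ω | T (fun t => Z'.X t ω) < ⊤},
      ENNReal.ofReal (h (Z'.X (T fun t => Z'.X t ω).toNNReal ω)) ∂(Z'.P (I x)) < ⊤ := by
  have hfreq := hD.frequently_shift_eq hE₀ hT x (φ := fun _ => 1) measurable_const
  obtain ⟨s, hs, hseq⟩ := exists_seq_forall_of_frequently hfreq
  set q : ℝ≥0 → E → ℝ≥0∞ := fun s z =>
    ∫⁻ ω', ENNReal.ofReal (h (Z'.X s ω')) * (1 : ℝ≥0∞) ∂(Z'.P z)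
  have hqm : ∀ s, Measurable (q s) := fun s =>
    Z'.measurable_lintegral_X s (hD.measurable_weight.mul measurable_const)
  have hqt : ∀ z, Tendsto (fun n => q (s n) z) atTop (𝓝 (ENNReal.ofReal (h z))) := by
    intro z
    have := (hD.tendsto_lintegral_weight_mul hE₀ z (φ := fun _ => 1) measurable_const
      continuous_const (C := 1) (fun _ => le_rfl) ENNReal.one_ne_top).comp hs
    rw [mul_one] at this
    exact this
  have hXm : Measurable fun ω => Z'.X (T fun t => Z'.X t ω).toNNReal ω :=
    Z'.measurable_X_comp (hT.measurable.comp Z'.measurable_path).ennreal_toNNReal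
  calc ∫⁻ ω in {ω | T (fun t => Z'.X t ω) < ⊤},
        ENNReal.ofReal (h (Z'.X (T fun t => Z'.X t ω).toNNReal ω)) ∂(Z'.P (I x))
      = ∫⁻ ω in {ω | T (fun t => Z'.X t ω) < ⊤},
          liminf (fun n => q (s n) (Z'.X (T fun t => Z'.X t ω).toNNReal ω)) atTop ∂(Z'.P (I x)) := by
        refine lintegral_congr fun ω => ?_
        rw [(hqt _).liminf_eq]
    _ ≤ liminf (fun n => ∫⁻ ω in {ω | T (fun t => Z'.X t ω) < ⊤},
          q (s n) (Z'.X (T fun t => Z'.X t ω).toNNReal ω) ∂(Z'.P (I x))) atTop :=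
        lintegral_liminf_le fun n => (hqm _).comp hXm
    _ ≤ liminf (fun _ : ℕ => ENNReal.ofReal (h (I x))) atTop := by
        refine liminf_le_liminf (Eventually.of_forall fun n => ?_)
        rw [← hD.lintegral_shift_markov hT (I x) (s n) (φ := fun _ => 1) measurable_const, hseq n]
        refine (mul_le_mul_right (b := _) (c := 1) ?_ _).trans_eq (mul_one _)
        calc _ ≤ ∫⁻ _, 1 ∂(Z.P x) := (lintegral_mono fun ω =>
                killed_le Z v _ ω fun _ => le_rfl).trans (setLIntegral_le_lintegral _ _)
          _ = 1 := by simp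
    _ < ⊤ := by simp

/-- Both sides of the identity at `T + s` converge as `s` decreases to `0`, so the limits agree
because the identity holds for arbitrarily small `s`. -/
lemma lintegral_exit_eq_of_continuous [CompactSpace E] (hE₀ : IsOpen E₀) (hT : IsPathTime T) {x : E}
    (hx : x ∈ E₀) {φ : E → ℝ≥0∞} (hφ : Continuous φ) {C : ℝ≥0∞} (hC : ∀ z, φ z ≤ C)
    (hC' : C ≠ ⊤) :
    ∫⁻ ω in {ω | T (fun t => Z'.X t ω) < ⊤},
        ENNReal.ofReal (h (Z'.X (T fun t => Z'.X t ω).toNNReal ω)) *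
          φ (I (Z'.X (T fun t => Z'.X t ω).toNNReal ω)) ∂(Z'.P (I x)) =
      ENNReal.ofReal (h (I x)) * ∫⁻ ω in {ω | T (fun t => I (Z.changed v t ω)) < ⊤},
        {t | invClock Z v t ω < ⊤}.indicator (fun t => φ (Z.changed v t ω))
          (T fun t => I (Z.changed v t ω)).toNNReal ∂(Z.P x) := by
  have hφm : Measurable φ := hφ.measurable
  have hXm : Measurable fun ω => Z'.X (T fun t => Z'.X t ω).toNNReal ω :=
    Z'.measurable_X_comp (hT.measurable.comp Z'.measurable_path).ennreal_toNNReal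
  refine tendsto_nhds_unique_of_frequently_eq (l := 𝓝[>] (0 : ℝ≥0)) ?_ ?_
    (hD.frequently_shift_eq hE₀ hT x hφm)
  · simp_rw [hD.lintegral_shift_markov hT (I x) _ hφm]
    refine tendsto_lintegral_filter_of_dominated_convergence
      (fun ω => ENNReal.ofReal (h (Z'.X (T fun t => Z'.X t ω).toNNReal ω)) * C) ?_ ?_ ?_ ?_
    · exact Eventually.of_forall fun s => (Z'.measurable_lintegral_X s
        (hD.measurable_weight.mul (hφm.comp hD.measurable_I))).comp hXm
    · exact Eventually.of_forall fun s => Eventually.of_forall fun ω =>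
        hD.lintegral_weight_mul_le hE₀ _ s hφm hC
    · rw [lintegral_mul_const _ (hD.measurable_weight_exit hT)]
      exact ENNReal.mul_ne_top (hD.lintegral_weight_exit_lt_top hE₀ hT x).ne hC'
    · exact Eventually.of_forall fun ω => hD.tendsto_lintegral_weight_mul hE₀ _ hφm hφ hC hC'
  · refine ENNReal.Tendsto.const_mul ?_ (Or.inr ENNReal.ofReal_ne_top)
    refine tendsto_lintegral_filter_of_dominated_convergence (fun _ => C) ?_ ?_ ?_ ?_
    · exact Eventually.of_forall fun s => hD.measurable_killed_shift hE₀ hT s hφm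
    · exact Eventually.of_forall fun s => Eventually.of_forall fun ω => killed_le Z v _ ω hC
    · rw [lintegral_const]
      exact ENNReal.mul_ne_top hC' (measure_ne_top _ _)
    · refine ae_restrict_of_ae ?_
      filter_upwards [Z.ae_clock_lt_top hE₀ hD.v_pos hD.v_continuous hx] with ω hfin
      refine (hD.tendsto_changed hE₀ hfin hφ (T fun t => I (Z.changed v t ω)).toNNReal).comp ?_
      refine tendsto_nhdsWithin_iff.2 ⟨?_, ?_⟩
      · have : Tendsto (fun s : ℝ≥0 => (T fun t => I (Z.changed v t ω)).toNNReal + s) (𝓝 0)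
            (𝓝 ((T fun t => I (Z.changed v t ω)).toNNReal + 0)) :=
          tendsto_const_nhds.add tendsto_id
        rw [add_zero] at this
        exact this.mono_left nhdsWithin_le_nhds
      · filter_upwards [self_mem_nhdsWithin] with s hs
        exact lt_add_of_pos_right _ (show 0 < s from hs)

/-- The change of measure at a random time which is a functional of the path. -/
lemma lintegral_exit_eq [CompactSpace E] (hE₀ : IsOpen E₀) (hT : IsPathTime T) {x : E}
    (hx : x ∈ E₀) {g : E → ℝ≥0∞} (hg : Measurable g) :
    ∫⁻ ω in {ω | T (fun t => Z'.X t ω) < ⊤},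
        ENNReal.ofReal (h (Z'.X (T fun t => Z'.X t ω).toNNReal ω)) *
          g (I (Z'.X (T fun t => Z'.X t ω).toNNReal ω)) ∂(Z'.P (I x)) =
      ENNReal.ofReal (h (I x)) * ∫⁻ ω in {ω | T (fun t => I (Z.changed v t ω)) < ⊤},
        {t | invClock Z v t ω < ⊤}.indicator (fun t => g (Z.changed v t ω))
          (T fun t => I (Z.changed v t ω)).toNNReal ∂(Z.P x) := by
  have hXm : Measurable fun ω => I (Z'.X (T fun t => Z'.X t ω).toNNReal ω) :=
    hD.measurable_I.comp
      (Z'.measurable_X_comp (hT.measurable.comp Z'.measurable_path).ennreal_toNNReal)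
  have hσ : Measurable fun ω => (T fun t => I (Z.changed v t ω)).toNNReal :=
    (hT.measurable.comp (hD.measurable_inverted hE₀)).ennreal_toNNReal
  have hYm : Measurable fun ω => Z.changed v (T fun t => I (Z.changed v t ω)).toNNReal ω :=
    Measurable.comp (f := fun ω => ((T fun t => I (Z.changed v t ω)).toNNReal, ω))
      (hD.measurable_changed hE₀) (hσ.prodMk measurable_id)
  have hal : MeasurableSet {ω | invClock Z v (T fun t => I (Z.changed v t ω)).toNNReal ω < ⊤} :=
    Measurable.comp (f := fun ω => ((T fun t => I (Z.changed v t ω)).toNNReal, ω))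
      (Z.measurable_invClock_uncurry hE₀ hD.v_pos hD.v_continuous)
      (hσ.prodMk measurable_id) measurableSet_Iio
  set μ' := (((Z'.P (I x)).restrict {ω | T (fun t => Z'.X t ω) < ⊤}).withDensity fun ω =>
    ENNReal.ofReal (h (Z'.X (T fun t => Z'.X t ω).toNNReal ω))).map
      fun ω => I (Z'.X (T fun t => Z'.X t ω).toNNReal ω) with hμ'
  set μ := (ENNReal.ofReal (h (I x)) • (((Z.P x).restrict
    {ω | T (fun t => I (Z.changed v t ω)) < ⊤}).restrict
      {ω | invClock Z v (T fun t => I (Z.changed v t ω)).toNNReal ω < ⊤})).map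
        fun ω => Z.changed v (T fun t => I (Z.changed v t ω)).toNNReal ω with hμ
  have e' : ∀ g : E → ℝ≥0∞, Measurable g → ∫⁻ z, g z ∂μ' =
      ∫⁻ ω in {ω | T (fun t => Z'.X t ω) < ⊤},
        ENNReal.ofReal (h (Z'.X (T fun t => Z'.X t ω).toNNReal ω)) *
          g (I (Z'.X (T fun t => Z'.X t ω).toNNReal ω)) ∂(Z'.P (I x)) := by
    intro g hg
    rw [hμ', lintegral_map hg hXm, lintegral_withDensity_eq_lintegral_mul _
      (hD.measurable_weight_exit hT) (show Measurable fun ω =>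
        g (I (Z'.X (T fun t => Z'.X t ω).toNNReal ω)) from hg.comp hXm)]
    rfl
  have e : ∀ g : E → ℝ≥0∞, Measurable g → ∫⁻ z, g z ∂μ =
      ENNReal.ofReal (h (I x)) * ∫⁻ ω in {ω | T (fun t => I (Z.changed v t ω)) < ⊤},
        {t | invClock Z v t ω < ⊤}.indicator (fun t => g (Z.changed v t ω))
          (T fun t => I (Z.changed v t ω)).toNNReal ∂(Z.P x) := by
    intro g hg
    rw [hμ, lintegral_map hg hYm, lintegral_smul_measure, ← lintegral_indicator hal, smul_eq_mul]
    rfl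
  have hfin : IsFiniteMeasure μ := by
    have := Measure.smul_finite (((Z.P x).restrict
      {ω | T (fun t => I (Z.changed v t ω)) < ⊤}).restrict
        {ω | invClock Z v (T fun t => I (Z.changed v t ω)).toNNReal ω < ⊤})
      (ENNReal.ofReal_ne_top (r := h (I x)))
    exact Measure.isFiniteMeasure_map _ _
  have hfin' : IsFiniteMeasure μ' := by
    refine ⟨?_⟩
    have := e' (fun _ => 1) measurable_const
    simp only [lintegral_one, mul_one] at this
    rw [this]
    exact hD.lintegral_weight_exit_lt_top hE₀ hT x
  -- Both sides are integrals of `g` against finite measures on a metrizable space, and such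
  -- measures are determined by bounded continuous functions.
  have key : μ' = μ := by
    refine ext_of_forall_lintegral_eq_of_IsFiniteMeasure fun f => ?_
    rw [e' _ (by fun_prop), e _ (by fun_prop)]
    refine hD.lintegral_exit_eq_of_continuous hE₀ hT hx
      (ENNReal.continuous_coe.comp f.continuous) (C := (nndist f 0 : ℝ≥0)) (fun z => ?_)
      ENNReal.coe_ne_top
    exact ENNReal.coe_le_coe.2 (BoundedContinuousFunction.NNReal.upper_bound f z)
  rw [← e' g hg, key, e g hg]

end DualInversionProperty

/-! ## Exit times of the time-changed process -/

section ChangedExit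

variable {E : Type*} [TopologicalSpace E] [MeasurableSpace E] {E₀ : Set E}
  {Ω : Type*} [MeasurableSpace Ω] {Z : StandardProcess E E₀ Ω} {v : E → ℝ} {ω : Ω}
  {B : Set E} {K : ℕ → Set E}

/-- Up to a time `t' < t` the path stays in a single `K n`. A rational time `q` below the clock
value at `t'` has `γ_q ≤ t'`, so the time-changed path is still in `K n` at `q`. -/
lemma clock_le_pathExit_changed (hK : IsExhaustion K B)
    (hexit : pathExit K (fun t => Z.X t ω) = exitTime Z.X B ω) {t : ℝ≥0}
    (ht : (t : ℝ≥0∞) ≤ exitTime Z.X B ω) :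
    clock Z v t ω ≤ pathExit K fun t => Z.changed v t ω := by
  refine le_of_forall_lt fun c hc => ?_
  obtain ⟨u, hcu, hu⟩ := exists_between hc
  refine hcu.trans_le ?_
  lift u to ℝ≥0 using hu.ne_top
  obtain ⟨t', ht', hut'⟩ := Z.exists_lt_clock_of_lt v ω hu
  have h1 : (t' : ℝ≥0∞) < pathExit K fun t => Z.X t ω := by
    rw [hexit]; exact lt_of_lt_of_le (by exact_mod_cast ht') ht
  rw [pathExit_eq_iSup, lt_iSup_iff] at h1
  obtain ⟨n, hn⟩ := h1
  rw [pathExit_eq_iSup]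
  refine le_trans ?_ (le_iSup (fun n => pathExit (fun _ => K n) fun t => Z.changed v t ω) n)
  by_contra! hlt
  obtain ⟨q, hq, hqu⟩ := pathExit_const_lt_iff.1 hlt
  have h2 : invClock Z v q ω ≤ t' := StandardProcess.invClock_le (hqu.trans hut')
  refine hq (mem_of_lt_pathExit_const (Z.right_continuous ω _) (hK.closed n) (lt_of_le_of_lt ?_ hn))
  rw [ENNReal.coe_toNNReal (h2.trans_lt ENNReal.coe_lt_top).ne]
  exact h2

lemma tendsto_changed_path (hE₀ : IsOpen E₀) (hv : ∀ x ∈ E₀, 0 < v x)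
    (hm : Measurable fun r : ℝ => E₀.indicator (fun y => ENNReal.ofReal (v y)⁻¹) (Z.X r.toNNReal ω))
    (hfin : ∀ t, Z.X t ω ∈ E₀ → clock Z v t ω < ⊤) {u : ℝ≥0} (h : invClock Z v u ω < ⊤) :
    Tendsto (fun t => Z.changed v t ω) (𝓝[>] u) (𝓝 (Z.changed v u ω)) :=
  (Z.right_continuous ω _).comp (StandardProcess.tendsto_invClock hE₀ hv hm hfin h).2

/-- If the process is in the interior when it exits `B`, then the time-changed process exits `B`
at the corresponding time of the clock. -/
lemma pathExit_changed_eq (hE₀ : IsOpen E₀) (hv : ∀ x ∈ E₀, 0 < v x)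
    (hm : Measurable fun r : ℝ => E₀.indicator (fun y => ENNReal.ofReal (v y)⁻¹) (Z.X r.toNNReal ω))
    (hfin : ∀ t, Z.X t ω ∈ E₀ → clock Z v t ω < ⊤) (hB : IsOpen B) (hK : IsExhaustion K B)
    (hexit : pathExit K (fun t => Z.X t ω) = exitTime Z.X B ω) {s : ℝ≥0}
    (hs : exitTime Z.X B ω = s) (hX : Z.X s ω ∈ E₀) :
    (pathExit K fun t => Z.changed v t ω) = clock Z v s ω ∧
      invClock Z v (clock Z v s ω).toNNReal ω = s := by
  have hγ : invClock Z v (clock Z v s ω).toNNReal ω = s :=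
    StandardProcess.invClock_clock hE₀ hv hm hX (ENNReal.coe_toNNReal (hfin s hX).ne).symm
  refine ⟨le_antisymm ?_ (clock_le_pathExit_changed hK hexit hs.ge), hγ⟩
  rw [pathExit_eq_iSup, ← ENNReal.coe_toNNReal (hfin s hX).ne]
  refine iSup_le fun n => pathExit_const_le (tendsto_changed_path hE₀ hv hm hfin
    (by rw [hγ]; exact ENNReal.coe_lt_top)) (hK.closed n) fun hmem => ?_
  rw [StandardProcess.changed, hγ, ENNReal.toNNReal_coe] at hmem
  exact notMem_of_exitTime_eq (Z.right_continuous ω) hB hs (hK.subset n hmem)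

/-- Otherwise `X` would stay in `B` a little beyond `r`, where the clock strictly exceeds the exit
time of the time-changed path, against `clock_le_pathExit_changed`. -/
lemma exitTime_le_of_invClock_pathExit (hE₀ : IsOpen E₀) (hv : ∀ x ∈ E₀, 0 < v x)
    (hm : Measurable fun r : ℝ => E₀.indicator (fun y => ENNReal.ofReal (v y)⁻¹) (Z.X r.toNNReal ω))
    (hfin : ∀ t, Z.X t ω ∈ E₀ → clock Z v t ω < ⊤) (hK : IsExhaustion K B)
    (hexit : pathExit K (fun t => Z.X t ω) = exitTime Z.X B ω) {r : ℝ≥0}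
    (hS : (pathExit K fun t => Z.changed v t ω) < ⊤)
    (hr : invClock Z v (pathExit K fun t => Z.changed v t ω).toNNReal ω = r) :
    exitTime Z.X B ω ≤ r := by
  by_contra! hlt
  obtain ⟨hX, hc⟩ := StandardProcess.of_invClock_eq hE₀ hfin hr
  rw [ENNReal.coe_toNNReal hS.ne] at hc
  obtain ⟨r', h1, h2⟩ := exists_between hlt
  lift r' to ℝ≥0 using h2.ne_top
  have h3 := StandardProcess.clock_lt_clock hE₀ hv hm hX (hfin r hX) (show r < r' by exact_mod_cast h1)
  have h4 := clock_le_pathExit_changed (v := v) hK hexit h2.le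
  rw [hc] at h3
  exact h3.not_ge h4

/-- The value of the time-changed process when it exits `B`. -/
lemma indicator_changed_exit_eq (hE₀ : IsOpen E₀) (hv : ∀ x ∈ E₀, 0 < v x)
    (hm : Measurable fun r : ℝ => E₀.indicator (fun y => ENNReal.ofReal (v y)⁻¹) (Z.X r.toNNReal ω))
    (hfin : ∀ t, Z.X t ω ∈ E₀ → clock Z v t ω < ⊤) (hB : IsOpen B) (hK : IsExhaustion K B)
    (hexit : pathExit K (fun t => Z.X t ω) = exitTime Z.X B ω) {g : E → ℝ≥0∞}
    (hg : ∀ z ∉ E₀, g z = 0) :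
    {ω | (pathExit K fun t => Z.changed v t ω) < ⊤}.indicator (fun ω =>
      {t | invClock Z v t ω < ⊤}.indicator (fun t => g (Z.changed v t ω))
        (pathExit K fun t => Z.changed v t ω).toNNReal) ω = atExit Z.X B g ω := by
  by_cases hS : ω ∈ {ω | (pathExit K fun t => Z.changed v t ω) < ⊤} ∧
      (pathExit K fun t => Z.changed v t ω).toNNReal ∈ {t | invClock Z v t ω < ⊤}
  · obtain ⟨hS, hγ⟩ := hS
    rw [indicator_of_mem hS, indicator_of_mem hγ]
    have hr := (ENNReal.coe_toNNReal (LT.lt.ne hγ)).symm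
    set r := (invClock Z v (pathExit K fun t => Z.changed v t ω).toNNReal ω).toNNReal with hrdef
    have hle := exitTime_le_of_invClock_pathExit hE₀ hv hm hfin hK hexit hS hr
    have hXr := (StandardProcess.of_invClock_eq hE₀ hfin hr).1
    have hs : exitTime Z.X B ω = ((exitTime Z.X B ω).toNNReal : ℝ≥0) :=
      (ENNReal.coe_toNNReal (hle.trans_lt ENNReal.coe_lt_top).ne).symm
    set s := (exitTime Z.X B ω).toNNReal with hsdef
    have hXs : Z.X s ω ∈ E₀ :=
      StandardProcess.mem_of_le_of_mem (by rw [hs] at hle; exact_mod_cast hle) hXr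
    obtain ⟨h1, h2⟩ := pathExit_changed_eq hE₀ hv hm hfin hB hK hexit hs hXs
    rw [atExit, indicator_of_mem (show ω ∈ {ω | exitTime Z.X B ω < ⊤} by
      rw [mem_ofPred_eq, hs]; exact ENNReal.coe_lt_top), h1, StandardProcess.changed, h2,
      ENNReal.toNNReal_coe]
  -- A nonzero value forces `X` to exit `B` inside `E₀`, where `g` can be nonzero. The time-changed
  -- process would then exit `B` while alive, which this case excludes.
  · have hz : atExit Z.X B g ω = 0 := by
      by_contra hne
      have hlt : ω ∈ {ω | exitTime Z.X B ω < ⊤} := mem_of_indicator_ne_zero hne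
      rw [atExit, indicator_of_mem hlt] at hne
      have hX : Z.X (exitTime Z.X B ω).toNNReal ω ∈ E₀ := by
        by_contra hX
        exact hne (hg _ hX)
      obtain ⟨h1, h2⟩ := pathExit_changed_eq hE₀ hv hm hfin hB hK hexit
        (ENNReal.coe_toNNReal (LT.lt.ne hlt)).symm hX
      refine hS ⟨?_, ?_⟩
      · rw [mem_ofPred_eq, h1]; exact hfin _ hX
      · rw [mem_ofPred_eq, h1, h2]; exact ENNReal.coe_lt_top
    rw [hz]
    by_cases h1 : ω ∈ {ω | (pathExit K fun t => Z.changed v t ω) < ⊤}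
    · rw [indicator_of_mem h1, indicator_of_notMem fun h2 => hS ⟨h1, h2⟩]
    · rw [indicator_of_notMem h1]

end ChangedExit

namespace StandardProcess

variable {E : Type*} [TopologicalSpace E] [TopologicalSpace.MetrizableSpace E] [MeasurableSpace E]
  [BorelSpace E] {E₀ : Set E} {Ω : Type*} [MeasurableSpace Ω] (Z : StandardProcess E E₀ Ω)

/-- The exit time is an infimum over uncountably many times; measurability comes from its almost
sure equality with `pathExit`. -/
lemma aemeasurable_atExit {D : Set E} (hD : IsOpen D) (hDE : D ⊆ E₀) {x : E} (hx : x ∈ D)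
    {β : Type*} [MeasurableSpace β] [Zero β] {f : E → β} (hf : Measurable f) :
    AEMeasurable (atExit Z.X D f) (Z.P x) := by
  obtain ⟨K, hK⟩ := exists_isExhaustion hD
  have hT := (isPathTime_pathExit fun n => (hK.closed n).measurableSet).measurable.comp
    Z.measurable_path
  refine ⟨{ω | pathExit K (fun t => Z.X t ω) < ⊤}.indicator fun ω =>
    f (Z.X (pathExit K fun t => Z.X t ω).toNNReal ω), ?_, ?_⟩
  · exact (hf.comp (Z.measurable_X_comp hT.ennreal_toNNReal)).indicator (hT measurableSet_Iio)
  · filter_upwards [Z.pathExit_eq_exitTime hDE hK hx] with ω hω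
    simp only [atExit, indicator, mem_ofPred_eq, hω]

end StandardProcess

/-! ### Identification of exit from `B` with exit of the dual process from `I '' B` -/

namespace DualInversionProperty

variable {E : Type*} [TopologicalSpace E] [MeasurableSpace E] {E₀ : Set E}
  {Ω Ω' : Type*} [MeasurableSpace Ω] [MeasurableSpace Ω'] {Z : StandardProcess E E₀ Ω}
  {Z' : StandardProcess E E₀ Ω'} {I : E → E} {h v : E → ℝ} {m : Measure E}
  (hD : DualInversionProperty Z Z' I h v m)

include hD

lemma pathExit_preimage (K : ℕ → Set E) (ω : Ω) :
    pathExit (fun n => I ⁻¹' K n) (fun t => I (Z.changed v t ω)) =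
      pathExit K fun t => Z.changed v t ω := by
  simp only [pathExit, mem_preimage, hD.involutive (Z.changed v _ ω)]

lemma mem_image_iff {B : Set E} {z : E} : z ∈ I '' B ↔ I z ∈ B := by
  constructor
  · rintro ⟨y, hy, rfl⟩
    rwa [hD.involutive]
  · intro hz
    exact ⟨I z, hz, hD.involutive z⟩

variable [TopologicalSpace.MetrizableSpace E] [BorelSpace E]

lemma measurable_rate_path (hE₀ : IsOpen E₀) (ω : Ω) : Measurable fun r : ℝ =>
    E₀.indicator (fun y => ENNReal.ofReal (v y)⁻¹) (Z.X r.toNNReal ω) :=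
  (StandardProcess.measurable_rate hE₀ hD.v_pos hD.v_continuous).comp
    (Z.measurable_uncurry_X.comp (measurable_real_toNNReal.prodMk measurable_const))

lemma image_subset (hE₀ : IsOpen E₀) {B : Set E} (hB : B ⊆ E₀) : I '' B ⊆ E₀ := by
  intro z hz
  exact (hD.mem_iff hE₀).1 (hB (hD.mem_image_iff.1 hz))

variable {B : Set E} {K K' : ℕ → Set E} {x : E}

/-- Because `I` is an involution, `X_γ` leaves `K n` when `I(X_γ)` leaves `I ⁻¹' K n`. These
preimages are only Borel, so the dual path time here is not yet known to be the exit time from `I ''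
B`. -/
lemma lintegral_changed_exit [CompactSpace E] (hE₀ : IsOpen E₀) (hB : IsOpen B) (hBE : B ⊆ E₀)
    (hK : IsExhaustion K B) (hx : x ∈ B) {g : E → ℝ≥0∞} (hgm : Measurable g)
    (hg : ∀ z ∉ E₀, g z = 0) :
    ∫⁻ ω, {ω | pathExit (fun n => I ⁻¹' K n) (fun t => Z'.X t ω) < ⊤}.indicator (fun ω =>
        ENNReal.ofReal (h (Z'.X (pathExit (fun n => I ⁻¹' K n) fun t => Z'.X t ω).toNNReal ω)) *
          g (I (Z'.X (pathExit (fun n => I ⁻¹' K n) fun t => Z'.X t ω).toNNReal ω))) ω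
            ∂(Z'.P (I x)) =
      ENNReal.ofReal (h (I x)) * ∫⁻ ω, atExit Z.X B g ω ∂(Z.P x) := by
  have hT : IsPathTime (pathExit fun n => I ⁻¹' K n) :=
    isPathTime_pathExit fun n => hD.measurable_I (hK.closed n).measurableSet
  have h1 := hD.lintegral_exit_eq hE₀ hT (hBE hx) hgm
  have hm' : MeasurableSet {ω | pathExit (fun n => I ⁻¹' K n) (fun t => Z'.X t ω) < ⊤} :=
    (hT.measurable.comp Z'.measurable_path) measurableSet_Iio
  have hm : MeasurableSet {ω | pathExit (fun n => I ⁻¹' K n) (fun t => I (Z.changed v t ω)) < ⊤} :=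
    (hT.measurable.comp (hD.measurable_inverted hE₀)) measurableSet_Iio
  rw [lintegral_indicator hm', h1, ← lintegral_indicator hm]
  congr 1
  refine lintegral_congr_ae ?_
  filter_upwards [Z.ae_clock_lt_top hE₀ hD.v_pos hD.v_continuous (hBE hx),
    Z.pathExit_eq_exitTime hBE hK hx] with ω hfin hexit
  simp only [hD.pathExit_preimage]
  exact indicator_changed_exit_eq hE₀ hD.v_pos (hD.measurable_rate_path hE₀ ω) hfin hB hK hexit hg

/-- The change of measure is applied at `T = pathExit K'` with the indicator of `B` as test
function. The dual process is outside `I '' B` at that time, so both sides vanish, and the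
time-changed process, if alive at `T`, is outside `B`: by then `X` has left `B`. -/
lemma ae_pathExit_le_changed [CompactSpace E] (hE₀ : IsOpen E₀) (hB : IsOpen B) (hBE : B ⊆ E₀)
    (hB' : IsOpen (I '' B)) (hK : IsExhaustion K B) (hK' : IsExhaustion K' (I '' B)) (hx : x ∈ B) :
    ∀ᵐ ω ∂(Z.P x), pathExit K' (fun t => I (Z.changed v t ω)) < ⊤ →
      invClock Z v (pathExit K' fun t => I (Z.changed v t ω)).toNNReal ω < ⊤ →
      (pathExit K fun t => Z.changed v t ω) ≤ pathExit K' fun t => I (Z.changed v t ω) := by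
  have hT : IsPathTime (pathExit K') := isPathTime_pathExit fun n => (hK'.closed n).measurableSet
  have hIx : I x ∈ I '' B := ⟨x, hx, rfl⟩
  have hgm : Measurable (B.indicator (1 : E → ℝ≥0∞)) := measurable_one.indicator hB.measurableSet
  have h1 := hD.lintegral_exit_eq hE₀ hT (hBE hx) hgm
  have hm' : MeasurableSet {ω | pathExit K' (fun t => Z'.X t ω) < ⊤} :=
    (hT.measurable.comp Z'.measurable_path) measurableSet_Iio
  have hm : MeasurableSet {ω | pathExit K' (fun t => I (Z.changed v t ω)) < ⊤} :=
    (hT.measurable.comp (hD.measurable_inverted hE₀)) measurableSet_Iio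
  have h0 : ∫⁻ ω in {ω | pathExit K' (fun t => Z'.X t ω) < ⊤},
      ENNReal.ofReal (h (Z'.X (pathExit K' fun t => Z'.X t ω).toNNReal ω)) *
        B.indicator 1 (I (Z'.X (pathExit K' fun t => Z'.X t ω).toNNReal ω)) ∂(Z'.P (I x)) = 0 := by
    rw [setLIntegral_congr_fun_ae (g := fun _ => 0) hm', lintegral_zero]
    filter_upwards [Z'.pathExit_eq_exitTime (hD.image_subset hE₀ hBE) hK' hIx] with ω hω hlt
    rw [indicator_of_notMem, mul_zero]
    intro hmem
    rw [← hD.mem_image_iff] at hmem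
    exact notMem_of_exitTime_eq (Z'.right_continuous ω) hB'
      (by rw [← hω]; exact (ENNReal.coe_toNNReal (LT.lt.ne hlt)).symm) hmem
  have hkm := hD.measurable_killed_shift hE₀ hT 0 hgm
  simp only [add_zero] at hkm
  rw [h0, eq_comm, mul_eq_zero, or_iff_right (hD.weight_ne_zero ((hD.mem_iff hE₀).2 (hBE hx))),
    lintegral_eq_zero_iff hkm] at h1
  have h2 := (ae_restrict_iff' hm).1 h1
  filter_upwards [h2, Z.start x, Z.ae_clock_lt_top hE₀ hD.v_pos hD.v_continuous (hBE hx),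
    Z.pathExit_eq_exitTime hBE hK hx] with ω hω hstart hfin hexit hlt hγ
  have h3 := hω hlt
  rw [indicator_of_mem (show _ ∈ {t | invClock Z v t ω < ⊤} from hγ)] at h3
  have h4 : Z.changed v (pathExit K' fun t => I (Z.changed v t ω)).toNNReal ω ∉ B := by
    intro hmem
    rw [indicator_of_mem hmem] at h3
    exact one_ne_zero h3
  have hr := (ENNReal.coe_toNNReal hγ.ne).symm
  obtain ⟨hXr, hcr⟩ := StandardProcess.of_invClock_eq hE₀ hfin hr
  rw [StandardProcess.changed] at h4
  set r := (invClock Z v (pathExit K' fun t => I (Z.changed v t ω)).toNNReal ω).toNNReal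
  have hr0 : 0 < r := by
    rw [pos_iff_ne_zero]
    intro h0
    rw [h0, hstart] at h4
    exact h4 hx
  have hle := exitTime_le hr0 h4
  have hs : exitTime Z.X B ω = ((exitTime Z.X B ω).toNNReal : ℝ≥0) :=
    (ENNReal.coe_toNNReal (hle.trans_lt ENNReal.coe_lt_top).ne).symm
  have hsr : (exitTime Z.X B ω).toNNReal ≤ r := by rw [hs] at hle; exact_mod_cast hle
  obtain ⟨h5, -⟩ := pathExit_changed_eq hE₀ hD.v_pos (hD.measurable_rate_path hE₀ ω) hfin hB hK
    hexit hs (StandardProcess.mem_of_le_of_mem hsr hXr)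
  rw [h5, ← ENNReal.coe_toNNReal hlt.ne, ← hcr]
  exact Z.clock_mono v ω hsr

/-- `lintegral_changed_exit` with the indicator of `B` has right side `0`, since `X` is outside `B`
when it exits. So at the time of the `I ⁻¹' K n` the dual process is either outside `E₀` or in `E₀`
but outside `I '' B`, and it has left `I '' B` in both cases. -/
lemma ae_pathExit_le [CompactSpace E] (hE₀ : IsOpen E₀) (hB : IsOpen B) (hBE : B ⊆ E₀)
    (hK : IsExhaustion K B) (hK' : IsExhaustion K' (I '' B)) (hx : x ∈ B) :
    ∀ᵐ ω ∂(Z'.P (I x)), pathExit K' (fun t => Z'.X t ω) ≤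
      pathExit (fun n => I ⁻¹' K n) fun t => Z'.X t ω := by
  have hT : IsPathTime (pathExit fun n => I ⁻¹' K n) :=
    isPathTime_pathExit fun n => hD.measurable_I (hK.closed n).measurableSet
  have hIx : I x ∈ I '' B := ⟨x, hx, rfl⟩
  have hgm : Measurable (B.indicator (1 : E → ℝ≥0∞)) := measurable_one.indicator hB.measurableSet
  have h1 := hD.lintegral_changed_exit hE₀ hB hBE hK hx hgm
    (fun z hz => indicator_of_notMem (fun hz' => hz (hBE hz')) _)
  have h0 : ∀ ω, atExit Z.X B (B.indicator (1 : E → ℝ≥0∞)) ω = 0 := by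
    intro ω
    refine indicator_apply_eq_zero.2 fun hlt => indicator_of_notMem ?_ _
    exact notMem_of_exitTime_eq (Z.right_continuous ω) hB (ENNReal.coe_toNNReal (LT.lt.ne hlt)).symm
  have hXm : Measurable fun ω => Z'.X (pathExit (fun n => I ⁻¹' K n) fun t => Z'.X t ω).toNNReal ω :=
    Z'.measurable_X_comp (hT.measurable.comp Z'.measurable_path).ennreal_toNNReal
  simp only [h0, lintegral_zero, mul_zero] at h1
  rw [lintegral_eq_zero_iff] at h1
  swap
  · exact ((hD.measurable_weight_exit hT).mul (hgm.comp (hD.measurable_I.comp hXm))).indicator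
      ((hT.measurable.comp Z'.measurable_path) measurableSet_Iio)
  filter_upwards [h1, Z'.start (I x), Z'.pathExit_eq_exitTime (hD.image_subset hE₀ hBE) hK' hIx]
    with ω hω hstart hexit
  rw [hexit]
  rcases eq_or_ne (pathExit (fun n => I ⁻¹' K n) fun t => Z'.X t ω) ⊤ with htop | htop
  · rw [htop]; exact le_top
  rw [indicator_of_mem (show ω ∈ {ω | pathExit (fun n => I ⁻¹' K n) (fun t => Z'.X t ω) < ⊤} from
    htop.lt_top)] at hω
  rw [← ENNReal.coe_toNNReal htop]
  set s := (pathExit (fun n => I ⁻¹' K n) fun t => Z'.X t ω).toNNReal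
  by_cases hX : Z'.X s ω ∈ E₀
  · have h2 : Z'.X s ω ∉ I '' B := by
      intro hmem
      rw [hD.mem_image_iff] at hmem
      rw [indicator_of_mem hmem, Pi.one_apply, mul_one] at hω
      exact hD.weight_ne_zero hX hω
    refine exitTime_le (pos_iff_ne_zero.2 ?_) h2
    intro hs0
    rw [hs0, hstart] at h2
    exact h2 hIx
  · exact (exitTime_mono (hD.image_subset hE₀ hBE)).trans
      ((StandardProcess.lifetime_le_iff hE₀).2 hX)

/-- The order of exit times known for the time-changed process passes to the dual only where the
density `h(X̂_u)` is positive, hence the restriction to exits inside `E₀`. The transfer is done at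
all rational `u`. -/
lemma ae_pathExit_ge [CompactSpace E] (hE₀ : IsOpen E₀) (hB : IsOpen B) (hBE : B ⊆ E₀)
    (hB' : IsOpen (I '' B)) (hK : IsExhaustion K B) (hK' : IsExhaustion K' (I '' B)) (hx : x ∈ B) :
    ∀ᵐ ω ∂(Z'.P (I x)), ∀ t : ℝ≥0, pathExit K' (fun t => Z'.X t ω) = t → Z'.X t ω ∈ E₀ →
      pathExit (fun n => I ⁻¹' K n) (fun t => Z'.X t ω) ≤ t := by
  have hT : IsPathTime (pathExit fun n => I ⁻¹' K n) :=
    isPathTime_pathExit fun n => hD.measurable_I (hK.closed n).measurableSet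
  have hT' : IsPathTime (pathExit K') := isPathTime_pathExit fun n => (hK'.closed n).measurableSet
  have key : ∀ u : ℚ≥0, ∀ᵐ ω ∂(Z'.P (I x)), Z'.X u ω ∈ E₀ →
      pathExit K' (fun t => Z'.X t ω) < (u : ℝ≥0) →
        pathExit (fun n => I ⁻¹' K n) (fun t => Z'.X t ω) < (u : ℝ≥0) := by
    intro u
    -- The paths that violate the claim before `u`; causality makes this an event of the path
    -- stopped at `u`.
    set A : Set (ℝ≥0 → E) := {w | pathExit K' w < (u : ℝ≥0)} \
      {w | pathExit (fun n => I ⁻¹' K n) w < (u : ℝ≥0)} with hA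
    have hAm : MeasurableSet A :=
      (hT'.measurable measurableSet_Iio).diff (hT.measurable measurableSet_Iio)
    have hAu : ∀ w : ℝ≥0 → E, (fun t => w (min t u)) ∈ A ↔ w ∈ A := by
      intro w
      simp only [hA, Set.mem_sdiff, mem_ofPred_eq, hT.lt_stopped_iff, hT'.lt_stopped_iff]
    have h1 := hD.change_of_measure hE₀ x u (F := A.indicator 1) (measurable_one.indicator hAm)
    have h2 : ∫⁻ ω in {ω | invClock Z v u ω < ⊤},
        A.indicator (1 : (ℝ≥0 → E) → ℝ≥0∞) (fun t => I (Z.changed v (min t u) ω)) ∂(Z.P x) = 0 := by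
      rw [setLIntegral_congr_fun_ae (g := fun _ => 0) (hD.measurableSet_alive hE₀ u),
        lintegral_zero]
      filter_upwards [hD.ae_pathExit_le_changed hE₀ hB hBE hB' hK hK' hx] with ω hω hγ
      refine indicator_of_notMem ?_ _
      rw [hAu fun t => I (Z.changed v t ω)]
      rintro ⟨h3, h4⟩
      simp only [mem_ofPred_eq, hD.pathExit_preimage] at h3 h4
      have h5 : pathExit K' (fun t => I (Z.changed v t ω)) < ⊤ := h3.trans ENNReal.coe_lt_top
      refine h4 ((hω h5 ?_).trans_lt h3)
      refine (StandardProcess.invClock_mono Z v ω ?_).trans_lt hγ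
      simpa using ENNReal.toNNReal_mono ENNReal.coe_ne_top h3.le
    have hYm : Measurable fun ω t => Z'.X (min t u) ω :=
      (measurable_map_stop (u : ℝ≥0)).comp Z'.measurable_path
    have hgm : Measurable fun ω => ENNReal.ofReal (h (Z'.X u ω)) *
        A.indicator (1 : (ℝ≥0 → E) → ℝ≥0∞) (fun t => Z'.X (min t u) ω) :=
      (hD.measurable_weight.comp (Z'.measurable_X u)).mul
        ((measurable_one.indicator hAm).comp hYm)
    rw [h2, mul_zero, lintegral_eq_zero_iff hgm] at h1
    filter_upwards [h1] with ω hω hX h3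
    by_contra h4
    have h5 : (fun t => Z'.X t ω) ∈ A := ⟨h3, h4⟩
    rw [indicator_of_mem ((hAu fun t => Z'.X t ω).2 h5), Pi.one_apply, mul_one] at hω
    exact hD.weight_ne_zero hX hω
  filter_upwards [ae_all_iff.2 key] with ω hω t ht hX
  by_contra! hlt
  -- Right-continuity provides a rational time just after `t`, before the other exit, with the
  -- process still in `E₀`.
  have h1 : ∀ᶠ s in 𝓝[>] t, Z'.X s ω ∈ E₀ := Z'.right_continuous ω t (hE₀.mem_nhds hX)
  obtain ⟨u, htu, hu⟩ := (mem_nhdsGT_iff_exists_Ioo_subset).1 h1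
  obtain ⟨q, hq1, hq2⟩ := exists_nnrat_btwn_ennreal (lt_min hlt (ENNReal.coe_lt_coe.2 htu))
  have h2 := hω q (hu ⟨by exact_mod_cast hq1, by exact_mod_cast hq2.trans_le (min_le_right _ _)⟩)
    (by rw [ht]; exact hq1)
  exact (h2.trans (hq2.trans_le (min_le_left _ _))).false

/-- Exit from `B` for the process `X` and exit from `I '' B` for its dual. -/
theorem lintegral_atExit [CompactSpace E] (hE₀ : IsOpen E₀) (hB : IsOpen B) (hBE : B ⊆ E₀)
    (hB' : IsOpen (I '' B)) (hx : x ∈ B) {g : E → ℝ≥0∞} (hgm : Measurable g)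
    (hg : ∀ z ∉ E₀, g z = 0) :
    ∫⁻ ω, atExit Z'.X (I '' B) (fun z => ENNReal.ofReal (h z) * g (I z)) ω ∂(Z'.P (I x)) =
      ENNReal.ofReal (h (I x)) * ∫⁻ ω, atExit Z.X B g ω ∂(Z.P x) := by
  obtain ⟨K, hK⟩ := exists_isExhaustion hB
  obtain ⟨K', hK'⟩ := exists_isExhaustion hB'
  rw [← hD.lintegral_changed_exit hE₀ hB hBE hK hx hgm hg]
  refine lintegral_congr_ae ?_
  filter_upwards [hD.ae_pathExit_le hE₀ hB hBE hK hK' hx,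
    hD.ae_pathExit_ge hE₀ hB hBE hB' hK hK' hx,
    Z'.pathExit_eq_exitTime (hD.image_subset hE₀ hBE) hK' (mem_image_of_mem I hx)] with ω h1 h2 h3
  rw [h3] at h1 h2
  set S := pathExit (fun n => I ⁻¹' K n) fun t => Z'.X t ω with hS
  rw [atExit]
  rcases eq_or_ne (exitTime Z'.X (I '' B) ω) ⊤ with htop | htop
  · have hS' : S = ⊤ := by rw [htop] at h1; exact top_le_iff.1 h1
    rw [indicator_of_notMem, indicator_of_notMem]
    · simp [← hS, hS']
    · simp [htop]
  · rw [indicator_of_mem (show ω ∈ {ω | exitTime Z'.X (I '' B) ω < ⊤} from htop.lt_top)]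
    have ht := (ENNReal.coe_toNNReal htop).symm
    set t := (exitTime Z'.X (I '' B) ω).toNNReal
    by_cases hX : Z'.X t ω ∈ E₀
    · have hSt : S = t := le_antisymm (h2 t ht hX) (ht ▸ h1)
      rw [indicator_of_mem]
      · simp only [← hS, hSt, ENNReal.toNNReal_coe]
      · rw [mem_ofPred_eq, ← hS, hSt]; exact ENNReal.coe_lt_top
    -- On exit outside `E₀` the two times may differ, but the second is not the earlier one and
    -- absorption makes the weight vanish at both.
    · rw [hD.weight_eq_zero hX, zero_mul]
      symm
      refine indicator_apply_eq_zero.2 fun hlt => ?_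
      rw [hD.weight_eq_zero, zero_mul]
      intro hXS
      refine hX (StandardProcess.mem_of_le_of_mem ?_ hXS)
      rw [← hS]
      rw [ht] at h1
      exact ENNReal.le_toNNReal_of_coe_le h1 (LT.lt.ne hlt)

end DualInversionProperty

lemma apply_atExit {E Ω β γ : Type*} [Zero β] [Zero γ] (X : ℝ≥0 → Ω → E) (D : Set E) (f : E → β)
    {φ : β → γ} (hφ : φ 0 = 0) (ω : Ω) :
    φ (atExit X D f ω) = atExit X D (fun z => φ (f z)) ω := by
  by_cases hω : ω ∈ {ω | exitTime X D ω < ⊤}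
  · rw [atExit, atExit, indicator_of_mem hω, indicator_of_mem hω]
  · rw [atExit, atExit, indicator_of_notMem hω, indicator_of_notMem hω, hφ]

/-! ### Regular harmonic and superharmonic functions -/

namespace DualInversionProperty

variable {E : Type*} [TopologicalSpace E] [MeasurableSpace E] {E₀ : Set E}
  {Ω Ω' : Type*} [MeasurableSpace Ω] [MeasurableSpace Ω'] {Z : StandardProcess E E₀ Ω}
  {Z' : StandardProcess E E₀ Ω'} {I : E → E} {h v : E → ℝ} {m : Measure E}
  [TopologicalSpace.MetrizableSpace E] [BorelSpace E] [CompactSpace E]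
  (hD : DualInversionProperty Z Z' I h v m) {D : Set E}

include hD

/-- The Kelvin transform preserves regular harmonic functions. -/
theorem regularHarmonicOn (hE₀ : IsOpen E₀) (hDo : IsOpen D) (hDE : D ⊆ E₀)
    (hDo' : IsOpen (I '' D)) {f : E → ℝ} (hf0 : ∀ x ∉ E₀, f x = 0) (hf : RegularHarmonicOn Z D f) :
    RegularHarmonicOn Z' (I '' D) fun x => h x * f (I x) := by
  have hkm : Measurable fun x => h x * f (I x) := hD.harmonic.1.mul (hf.1.comp hD.measurable_I)
  refine ⟨hkm, ?_⟩
  rintro _ ⟨x, hx, rfl⟩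
  obtain ⟨hint, heq⟩ := hf.2 x hx
  -- Positive homogeneity lets the factor `h` pass through `φ`. The norm gives integrability, the
  -- positive and negative parts give the value of the integral.
  have key : ∀ φ : ℝ → ℝ≥0∞, Measurable φ → φ 0 = 0 →
      (∀ a b : ℝ, 0 ≤ a → φ (a * b) = ENNReal.ofReal a * φ b) →
      ∫⁻ ω, φ (atExit Z'.X (I '' D) (fun x => h x * f (I x)) ω) ∂(Z'.P (I x)) =
        ENNReal.ofReal (h (I x)) * ∫⁻ ω, φ (atExit Z.X D f ω) ∂(Z.P x) := by
    intro φ hφm hφ0 hφ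
    simp only [apply_atExit _ _ _ hφ0, hφ _ _ (hD.nonneg _)]
    exact hD.lintegral_atExit hE₀ hDo hDE hDo' hx (hφm.comp hf.1) fun z hz => by
      rw [Function.comp_apply, hf0 z hz, hφ0]
  have hint' : Integrable (atExit Z'.X (I '' D) fun x => h x * f (I x)) (Z'.P (I x)) := by
    refine ⟨(Z'.aemeasurable_atExit hDo' (hD.image_subset hE₀ hDE) (mem_image_of_mem I hx)
      hkm).aestronglyMeasurable, ?_⟩
    rw [HasFiniteIntegral, key (fun r => ‖r‖ₑ) measurable_enorm enorm_zero fun a b ha => by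
      rw [enorm_mul, Real.enorm_of_nonneg ha]]
    exact ENNReal.mul_lt_top ENNReal.ofReal_lt_top hint.2
  refine ⟨hint', ?_⟩
  rw [integral_eq_lintegral_pos_part_sub_lintegral_neg_part hint',
    key ENNReal.ofReal ENNReal.measurable_ofReal ENNReal.ofReal_zero fun a b ha =>
      ENNReal.ofReal_mul ha,
    key (fun r => ENNReal.ofReal (-r)) (ENNReal.measurable_ofReal.comp measurable_neg) (by simp)
      fun a b ha => by rw [← mul_neg, ENNReal.ofReal_mul ha],
    ENNReal.toReal_mul, ENNReal.toReal_mul, ENNReal.toReal_ofReal (hD.nonneg _), ← mul_sub,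
    ← integral_eq_lintegral_pos_part_sub_lintegral_neg_part hint, heq]
  simp only [hD.involutive x]

end DualInversionProperty

lemma toENNReal_coe_mul {a : ℝ} (ha : 0 ≤ a) (b : EReal) :
    ((a : EReal) * b).toENNReal = ENNReal.ofReal a * b.toENNReal := by
  rw [EReal.toENNReal_mul (EReal.coe_nonneg.2 ha), EReal.toENNReal_of_ne_top (EReal.coe_ne_top a),
    EReal.toReal_coe]

lemma toENNReal_neg_coe_mul {a : ℝ} (ha : 0 ≤ a) (b : EReal) :
    (-((a : EReal) * b)).toENNReal = ENNReal.ofReal a * (-b).toENNReal := by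
  rw [← mul_neg, toENNReal_coe_mul ha]

lemma coe_mul_sub_le {c : ℝ} (hc : 0 < c) {a b : ℝ≥0∞} {f : EReal}
    (hab : (a : EReal) - (b : EReal) ≤ f) :
    ((ENNReal.ofReal c * a : ℝ≥0∞) : EReal) - ((ENNReal.ofReal c * b : ℝ≥0∞) : EReal) ≤ c * f := by
  have hc' : ((ENNReal.ofReal c : ℝ≥0∞) : EReal) = c := by
    rw [EReal.coe_ennreal_ofReal, max_eq_left hc.le]
  rw [EReal.coe_ennreal_mul, EReal.coe_ennreal_mul, hc']
  rw [← EReal.mul_sub_of_nonneg_of_ne_top (EReal.coe_nonneg.2 hc.le) (EReal.coe_ne_top c)]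
  exact mul_le_mul_of_nonneg_left hab (EReal.coe_nonneg.2 hc.le)

namespace DualInversionProperty

variable {E : Type*} [TopologicalSpace E] [MeasurableSpace E] {E₀ : Set E}
  {Ω Ω' : Type*} [MeasurableSpace Ω] [MeasurableSpace Ω'] {Z : StandardProcess E E₀ Ω}
  {Z' : StandardProcess E E₀ Ω'} {I : E → E} {h v : E → ℝ} {m : Measure E}
  [TopologicalSpace.MetrizableSpace E] [BorelSpace E]
  (hD : DualInversionProperty Z Z' I h v m) {D : Set E}

include hD

/-- The involution is its own inverse and preserves `E₀`, so the image is the preimage within the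
open set `E₀`. -/
lemma isOpen_image (hE₀ : IsOpen E₀) (hI : ContinuousOn I E₀) (hDo : IsOpen D) (hDE : D ⊆ E₀) :
    IsOpen (I '' D) := by
  convert hI.isOpen_inter_preimage hE₀ hDo using 1
  ext z
  rw [hD.mem_image_iff]
  exact ⟨fun hz => ⟨(hD.mem_iff hE₀).1 (hDE hz), hz⟩, fun hz => hz.2⟩

variable [CompactSpace E]

/-- The Kelvin transform preserves superharmonic functions. -/
theorem superharmonicOn (hE₀ : IsOpen E₀) (hDE : D ⊆ E₀) (hI : ContinuousOn I E₀) {f : E → EReal}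
    (hf0 : ∀ x ∉ E₀, f x = 0) (hf : SuperharmonicOn Z D f) :
    SuperharmonicOn Z' (I '' D) fun x => (h x : EReal) * f (I x) := by
  have hkm : Measurable fun x => (h x : EReal) * f (I x) :=
    (measurable_coe_real_ereal.comp hD.harmonic.1).mul (hf.1.comp hD.measurable_I)
  refine ⟨hkm, fun B' hBo' hBD' y hy => ?_⟩
  have hDE' := hD.image_subset hE₀ hDE
  have hBE' : closure B' ⊆ E₀ := hBD'.trans hDE'
  set B := I '' B' with hBdef
  have hB' : I '' B = B' := by rw [hBdef, image_image]; simp [hD.involutive _]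
  have hBo : IsOpen B := hD.isOpen_image hE₀ hI hBo' (subset_closure.trans hBE')
  have hBcl : closure B ⊆ D := by
    -- The closure of `B'` is compact and inside `E₀`, where `I` is continuous. Its image is then
    -- closed and contains the closure of `I '' B'`.
    have h1 : IsClosed (I '' closure B') :=
      (isClosed_closure.isCompact.image_of_continuousOn (hI.mono hBE')).isClosed
    refine (closure_minimal (image_mono subset_closure) h1).trans fun z hz => ?_
    have h2 := hBD' (hD.mem_image_iff.1 hz)
    rwa [hD.mem_image_iff, hD.involutive] at h2
  have hBE : B ⊆ E₀ := subset_closure.trans (hBcl.trans hDE)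
  have hx : I y ∈ B := mem_image_of_mem I hy
  have hIy := hD.involutive y
  have key : ∀ φ : EReal → ℝ≥0∞, Measurable φ → φ 0 = 0 →
      (∀ (a : ℝ) (b : EReal), 0 ≤ a → φ (a * b) = ENNReal.ofReal a * φ b) →
      ∫⁻ ω, φ (atExit Z'.X B' (fun x => (h x : EReal) * f (I x)) ω) ∂(Z'.P y) =
        ENNReal.ofReal (h y) * ∫⁻ ω, φ (atExit Z.X B f ω) ∂(Z.P (I y)) := by
    intro φ hφm hφ0 hφ
    simp only [apply_atExit _ _ _ hφ0, hφ _ _ (hD.nonneg _)]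
    have := hD.lintegral_atExit hE₀ hBo hBE (by rwa [hB']) hx (hφm.comp hf.1)
      fun z hz => by rw [Function.comp_apply, hf0 z hz, hφ0]
    rwa [hB', hIy] at this
  obtain ⟨h1, h2⟩ := hf.2 B hBo hBcl (I y) hx
  rw [key (fun r => (-r).toENNReal) (measurable_ereal_toENNReal.comp measurable_neg) (by simp)
      fun a b ha => toENNReal_neg_coe_mul ha b,
    key EReal.toENNReal measurable_ereal_toENNReal (by simp) fun a b ha => toENNReal_coe_mul ha b]
  exact ⟨ENNReal.mul_lt_top ENNReal.ofReal_lt_top h1,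
    coe_mul_sub_le (hD.pos y (hBE' (subset_closure hy))) h2⟩

end DualInversionProperty

/-- Fatou's lemma along a countably generated filter. -/
lemma eventually_lt_lintegral {Ω ι : Type*} [MeasurableSpace Ω] {μ : Measure Ω} {l : Filter ι}
    [l.IsCountablyGenerated] {G : Ω → ℝ≥0∞} {F : ι → Ω → ℝ≥0∞} (hF : ∀ i, Measurable (F i))
    (h : ∀ᵐ ω ∂μ, ∀ c < G ω, ∀ᶠ i in l, c < F i ω) {c : ℝ≥0∞} (hc : c < ∫⁻ ω, G ω ∂μ) :
    ∀ᶠ i in l, c < ∫⁻ ω, F i ω ∂μ := by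
  by_contra hcon
  obtain ⟨s, hs, hsc⟩ := exists_seq_forall_of_frequently (not_eventually.1 hcon)
  have h1 : ∫⁻ ω, G ω ∂μ ≤ ∫⁻ ω, liminf (fun n => F (s n) ω) atTop ∂μ := by
    refine lintegral_mono_ae ?_
    filter_upwards [h] with ω hω
    exact le_of_forall_lt fun c hc => by
      obtain ⟨c', h1, h2⟩ := exists_between hc
      exact h1.trans_le (le_liminf_of_le (by isBoundedDefault)
        ((hs.eventually (hω c' h2)).mono fun n hn => hn.le))
  obtain ⟨n, hn⟩ := (eventually_lt_of_lt_liminf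
    (hc.trans_le (h1.trans (lintegral_liminf_le fun n => hF (s n))))).exists
  exact hsc n hn

/-! ## Path functionals killed at the exit time -/

section KilledPath

variable {E : Type*}

/-- The value `g (w s)` on the paths `w` that have not left `⋃ n, K n` before time `s`. -/
noncomputable def killedPath (K : ℕ → Set E) (g : E → ℝ≥0∞) (s : ℝ≥0) (w : ℝ≥0 → E) : ℝ≥0∞ :=
  {w | (s : ℝ≥0∞) ≤ pathExit K w}.indicator (fun w => g (w s)) w

lemma killedPath_of_le {K : ℕ → Set E} {g : E → ℝ≥0∞} {s : ℝ≥0} {w : ℝ≥0 → E}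
    (h : (s : ℝ≥0∞) ≤ pathExit K w) : killedPath K g s w = g (w s) :=
  indicator_of_mem (s := {w | (s : ℝ≥0∞) ≤ pathExit K w}) h _

lemma killedPath_of_lt {K : ℕ → Set E} {g : E → ℝ≥0∞} {s : ℝ≥0} {w : ℝ≥0 → E}
    (h : pathExit K w < s) : killedPath K g s w = 0 :=
  indicator_of_notMem (s := {w | (s : ℝ≥0∞) ≤ pathExit K w}) h.not_ge _

/-- The shift must be rational so that rational times of the shifted path are rational times of the
path. -/
lemma pathExit_le_add (K : ℕ → Set E) (w : ℝ≥0 → E) (r : ℚ≥0) :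
    pathExit K w ≤ (r : ℝ≥0) + pathExit K fun t => w (r + t) := by
  rw [pathExit_eq_iSup]
  refine iSup_le fun n => ?_
  have hn : pathExit (fun _ => K n) (fun t => w (r + t)) ≤ pathExit K fun t => w (r + t) := by
    rw [pathExit_eq_iSup K]
    exact le_iSup (fun n => pathExit (fun _ => K n) fun t => w (r + t)) n
  refine le_trans (le_of_forall_gt fun c hc => ?_) (add_le_add_right hn _)
  obtain ⟨q, hq, hqc⟩ := pathExit_const_lt_iff.1 (lt_tsub_iff_left.2 hc)
  refine pathExit_const_lt_iff.2 ⟨r + q, by simpa using hq, ?_⟩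
  simpa using lt_tsub_iff_left.1 hqc

lemma killedPath_add_le (K : ℕ → Set E) (g : E → ℝ≥0∞) (r : ℚ≥0) (u : ℝ≥0) (w : ℝ≥0 → E) :
    killedPath K g (r + u) w ≤ killedPath K g u fun t => w (r + t) := by
  rcases le_or_gt ((r + u : ℝ≥0) : ℝ≥0∞) (pathExit K w) with h | h
  · rw [killedPath_of_le h, killedPath_of_le]
    have := h.trans (pathExit_le_add K w r)
    rw [ENNReal.coe_add] at this
    exact (ENNReal.add_le_add_iff_left ENNReal.coe_ne_top).1 this
  · rw [killedPath_of_lt h]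
    exact zero_le

lemma measurable_killedPath [MeasurableSpace E] {K : ℕ → Set E} (hK : ∀ n, MeasurableSet (K n))
    {g : E → ℝ≥0∞} (hg : Measurable g) (s : ℝ≥0) : Measurable (killedPath K g s) :=
  (hg.comp (measurable_pi_apply s)).indicator
    ((isPathTime_pathExit hK).measurable measurableSet_Ici)

end KilledPath

/-! ### Supermartingale property and optional stopping for excessive functions -/

namespace StandardProcess

variable {E : Type*} [TopologicalSpace E] [MeasurableSpace E] [BorelSpace E] {E₀ : Set E}
  {Ω : Type*} [MeasurableSpace Ω] {Z : StandardProcess E E₀ Ω}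
  {D : Set E} {K : ℕ → Set E} {f : E → ℝ≥0∞} {x : E}

/-- The weak inequality in `killedPath` makes it a function of the path up to `s`. It differs from
killing by a strict inequality only when `s` is the exit time, and there `X_s` is outside `D` and
the indicator of `D` gives `0`. -/
lemma lintegral_killedPath (hDo : IsOpen D) (hDE : D ⊆ E₀) (hK : IsExhaustion K D) (hx : x ∈ D)
    (s : ℝ≥0) :
    ∫⁻ ω, killedPath K (D.indicator f) s (fun t => Z.X t ω) ∂(Z.P x) = killedExpect Z D f s x := by
  refine lintegral_congr_ae ?_
  filter_upwards [Z.pathExit_eq_exitTime hDE hK hx, Z.start x] with ω hω hstart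
  rcases lt_trichotomy (s : ℝ≥0∞) (exitTime Z.X D ω) with hs | hs | hs
  · rw [killedPath_of_le (by rw [hω]; exact hs.le),
      indicator_of_mem (s := {ω | (s : ℝ≥0∞) < exitTime Z.X D ω}) hs, indicator_of_mem]
    rcases eq_or_ne s 0 with rfl | h0
    · rwa [hstart]
    · exact mem_of_lt_exitTime (pos_iff_ne_zero.2 h0) hs
  · rw [killedPath_of_le (by rw [hω]; exact hs.le),
      indicator_of_notMem (s := {ω | (s : ℝ≥0∞) < exitTime Z.X D ω}) hs.not_lt,
      indicator_of_notMem (notMem_of_exitTime_eq (Z.right_continuous ω) hDo hs.symm)]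
  · rw [killedPath_of_lt (by rwa [hω]),
      indicator_of_notMem (s := {ω | (s : ℝ≥0∞) < exitTime Z.X D ω}) hs.not_gt]

/-- Lower semicontinuity from the right: a positive value means that `s` is strictly before the
exit, and just after `s` the path is still in `D`, where `f` is continuous. -/
lemma ae_eventually_lt_killedPath (hDo : IsOpen D) (hDE : D ⊆ E₀) (hK : IsExhaustion K D)
    (hf : ContinuousOn f D) (hx : x ∈ D) :
    ∀ᵐ ω ∂(Z.P x), ∀ s, ∀ c < killedPath K (D.indicator f) s (fun t => Z.X t ω),
      ∀ᶠ r in 𝓝[>] s, c < killedPath K (D.indicator f) r fun t => Z.X t ω := by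
  filter_upwards [Z.pathExit_eq_exitTime hDE hK hx] with ω hω s c hc
  have hs : (s : ℝ≥0∞) ≤ pathExit K fun t => Z.X t ω := by
    by_contra! hlt
    rw [killedPath_of_lt hlt] at hc
    exact not_lt_zero hc
  rw [killedPath_of_le hs] at hc
  have hX : Z.X s ω ∈ D := mem_of_indicator_ne_zero (bot_lt_iff_ne_bot.1 (bot_le.trans_lt hc))
  rw [indicator_of_mem hX] at hc
  have hlt : (s : ℝ≥0∞) < pathExit K fun t => Z.X t ω := by
    refine lt_of_le_of_ne hs fun heq => ?_
    exact notMem_of_exitTime_eq (Z.right_continuous ω) hDo (by rw [← hω, ← heq]) hX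
  have h1 : ∀ᶠ r : ℝ≥0 in 𝓝[>] s, (r : ℝ≥0∞) < pathExit K fun t => Z.X t ω :=
    (ENNReal.continuous_coe.tendsto s).mono_left nhdsWithin_le_nhds (isOpen_Iio.mem_nhds hlt)
  have h2 : ∀ᶠ r in 𝓝[>] s, Z.X r ω ∈ D := Z.right_continuous ω s (hDo.mem_nhds hX)
  have h3 : ∀ᶠ r in 𝓝[>] s, c < f (Z.X r ω) :=
    ((hf.continuousAt (hDo.mem_nhds hX)).tendsto.comp (Z.right_continuous ω s))
      (isOpen_Ioi.mem_nhds hc)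
  filter_upwards [h1, h2, h3] with r h1 h2 h3
  rwa [killedPath_of_le h1.le, indicator_of_mem h2]

variable [TopologicalSpace.MetrizableSpace E]

variable (Z) in
lemma measurable_killedPath_comp (hK : ∀ n, MeasurableSet (K n)) {g : E → ℝ≥0∞} (hg : Measurable g)
    {σ : Ω → ℝ≥0} (hσ : Measurable σ) :
    Measurable fun ω => killedPath K g (σ ω) fun t => Z.X t ω := by
  have hm : MeasurableSet {ω | (σ ω : ℝ≥0∞) ≤ pathExit K fun t => Z.X t ω} :=
    measurableSet_le hσ.coe_nnreal_ennreal ((isPathTime_pathExit hK).measurable.comp Z.measurable_path)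
  exact (hg.comp (Z.measurable_X_comp hσ)).indicator hm

/-- The supermartingale property of an excessive function along the killed process. -/
lemma setLIntegral_killedPath_le (hDo : IsOpen D) (hDE : D ⊆ E₀) (hK : IsExhaustion K D)
    (hf : ExcessiveOn Z D f) (hx : x ∈ D) (r : ℚ≥0) (u : ℝ≥0) {L : Set Ω}
    (hL : MeasurableSet[Z.ℱ r] L) :
    ∫⁻ ω in L, killedPath K (D.indicator f) (r + u) (fun t => Z.X t ω) ∂(Z.P x) ≤
      ∫⁻ ω in L, killedPath K (D.indicator f) r (fun t => Z.X t ω) ∂(Z.P x) := by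
  have hKm : ∀ n, MeasurableSet (K n) := fun n => (hK.closed n).measurableSet
  -- The event of being alive in `D` at time `r`. It is `ℱ r`-measurable, and off it the functional
  -- is almost surely `0` at time `r + u` too. On it the Markov property at `r` reduces the claim to
  -- the inequality defining excessiveness at the point `X_r`.
  set A : Set Ω := {ω | pathExit K (fun t => Z.X t ω) < (r : ℝ≥0)}ᶜ ∩ Z.X r ⁻¹' D with hA
  have hAm : MeasurableSet[Z.ℱ r] A :=
    (Z.measurableSet_pathTime_lt (isPathTime_pathExit hKm) r).compl.inter
      (Z.adapted r hDo.measurableSet)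
  have hAm' : MeasurableSet A := Z.ℱ.le _ _ hAm
  have h1 : ∀ᵐ ω ∂(Z.P x), killedPath K (D.indicator f) (r + u) (fun t => Z.X t ω) ≤
      A.indicator (fun ω => killedPath K (D.indicator f) u fun t => Z.X (r + t) ω) ω := by
    filter_upwards [Z.pathExit_eq_exitTime hDE hK hx, Z.start x] with ω hω hstart
    by_cases hωA : ω ∈ A
    · rw [indicator_of_mem hωA]
      exact killedPath_add_le _ _ _ _ _
    · rw [indicator_of_notMem hωA, nonpos_iff_eq_zero]
      by_contra hne
      have h2 : ((r + u : ℝ≥0) : ℝ≥0∞) ≤ pathExit K fun t => Z.X t ω := by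
        by_contra! hlt
        exact hne (killedPath_of_lt hlt)
      rw [killedPath_of_le h2] at hne
      have h3 : Z.X (r + u) ω ∈ D := mem_of_indicator_ne_zero hne
      have h4 : ((r : ℝ≥0) : ℝ≥0∞) ≤ pathExit K fun t => Z.X t ω :=
        le_trans (ENNReal.coe_le_coe.2 le_self_add) h2
      have h5 : Z.X r ω ∉ D := fun hmem => hωA ⟨h4.not_gt, hmem⟩
      have hr0 : 0 < (r : ℝ≥0) := by
        rw [pos_iff_ne_zero]
        intro h0
        rw [h0, hstart] at h5
        exact h5 hx
      rw [hω] at h2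
      have h6 : (r : ℝ≥0) + u ≤ r := ENNReal.coe_le_coe.1 (h2.trans (exitTime_le hr0 h5))
      have h7 : (r : ℝ≥0) + u = r := le_antisymm h6 le_self_add
      rw [h7] at h3
      exact h5 h3
  have h2 : ∀ ω, killedPath K (D.indicator f) r (fun t => Z.X t ω) =
      A.indicator (fun ω => f (Z.X r ω)) ω := by
    intro ω
    rcases le_or_gt ((r : ℝ≥0) : ℝ≥0∞) (pathExit K fun t => Z.X t ω) with h | h
    · rw [killedPath_of_le h]
      by_cases hX : Z.X r ω ∈ D
      · rw [indicator_of_mem hX, indicator_of_mem (show ω ∈ A from ⟨h.not_gt, hX⟩)]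
      · rw [indicator_of_notMem hX, indicator_of_notMem fun hωA => hX hωA.2]
    · rw [killedPath_of_lt h, indicator_of_notMem fun hωA => hωA.1 h]
  simp only [h2]
  refine (lintegral_mono_ae (ae_restrict_of_ae h1)).trans ?_
  rw [lintegral_indicator hAm', lintegral_indicator hAm', Measure.restrict_restrict hAm',
    Z.markov_path x r (hAm.inter hL) (measurable_killedPath hKm hf.1 u)]
  refine setLIntegral_mono' (hAm'.inter (Z.ℱ.le _ _ hL)) fun ω hω => ?_
  rw [lintegral_killedPath hDo hDE hK hω.1.2]
  exact (hf.2 _ hω.1.2).1 u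

/-- The dyadic approximation takes the value `p (j + 1)` on `B (j + 1) \ B j`, so discrete optional
stopping on the grid `p` applies. -/
lemma lintegral_killedPath_dyadicAfter_le (hDo : IsOpen D) (hDE : D ⊆ E₀) (hK : IsExhaustion K D)
    (hf : ExcessiveOn Z D f) (hx : x ∈ D) {σ : Ω → ℝ≥0∞}
    (hσ : ∀ u : ℝ≥0, MeasurableSet[Z.ℱ u] {ω | σ ω < u}) (k : ℕ) :
    ∫⁻ ω in {ω | σ ω < ⊤}, killedPath K (D.indicator f) (dyadicAfter k (σ ω).toNNReal)
      (fun t => Z.X t ω) ∂(Z.P x) ≤ f x := by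
  set M : ℝ≥0 → Ω → ℝ≥0∞ := fun s ω => killedPath K (D.indicator f) s fun t => Z.X t ω with hM
  set p : ℕ → ℚ≥0 := fun j => j / 2 ^ k with hp
  set B : ℕ → Set Ω := fun j => {ω | σ ω < (p j : ℝ≥0)} with hB
  have hpm : Monotone p := fun i j hij => by
    simp only [hp]
    gcongr
  have hBm : Monotone B := fun i j hij ω hω =>
    lt_of_lt_of_le hω (ENNReal.coe_le_coe.2 (by exact_mod_cast hpm hij))
  have hBF : ∀ j, MeasurableSet[Z.ℱ (p j)] (B j) := fun j => hσ (p j)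
  have hBM : ∀ j, MeasurableSet (B j) := fun j => Z.ℱ.le _ _ (hBF j)
  -- The left side is the expectation of `M` at the minimum of the dyadic time and `p n`. From `n`
  -- to `n + 1` only the part on the complement of `B n` moves, and that event is known at time `p
  -- n`.
  have hstep : ∀ n, ∑ j ∈ Finset.range n, ∫⁻ ω in B (j + 1) \ B j, M (p (j + 1)) ω ∂(Z.P x) +
      ∫⁻ ω in (B n)ᶜ, M (p n) ω ∂(Z.P x) ≤ f x := by
    intro n
    induction n with
    | zero =>
      rw [Finset.sum_range_zero, zero_add]
      refine (setLIntegral_le_lintegral _ _).trans ?_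
      simp only [hM, hp, Nat.cast_zero, zero_div, NNRat.cast_zero]
      rw [lintegral_killedPath hDo hDE hK hx]
      exact (hf.2 x hx).1 0
    | succ n ih =>
      refine le_trans ?_ ih
      rw [Finset.sum_range_succ, add_assoc]
      gcongr
      have hsplit : (B n)ᶜ = (B (n + 1) \ B n) ∪ (B (n + 1))ᶜ := by
        ext ω
        have := @hBm n (n + 1) (Nat.le_succ n) ω
        simp only [mem_compl_iff, mem_union, Set.mem_sdiff]
        tauto
      rw [← lintegral_union (hBM _).compl
        (disjoint_compl_right_iff_subset.2 Set.sdiff_subset), ← hsplit]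
      have h1 := setLIntegral_killedPath_le hDo hDE hK hf hx (p n) (p (n + 1) - p n : ℚ≥0)
        (hBF n).compl
      have h2 : ((p n : ℚ≥0) : ℝ≥0) + ((p (n + 1) - p n : ℚ≥0) : ℝ≥0) = (p (n + 1) : ℝ≥0) := by
        rw [← NNRat.cast_add, add_tsub_cancel_of_le (hpm (Nat.le_succ n))]
      rwa [h2] at h1
  have hU : {ω | σ ω < ⊤} = ⋃ j, B (j + 1) \ B j := by
    ext ω
    simp only [mem_iUnion, Set.mem_sdiff, hB, mem_ofPred_eq, not_lt]
    constructor
    · intro hω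
      have hs := ENNReal.coe_toNNReal (LT.lt.ne hω)
      set s := (σ ω).toNNReal
      refine ⟨⌊2 ^ k * s⌋₊, ?_, ?_⟩
      · rw [← hs]
        have := lt_dyadicAfter k s
        rw [dyadicAfter] at this
        refine ENNReal.coe_lt_coe.2 ?_
        simp only [hp]
        push_cast
        exact this
      · rw [← hs]
        have : (⌊2 ^ k * s⌋₊ : ℝ≥0) ≤ 2 ^ k * s := Nat.floor_le (by positivity)
        refine ENNReal.coe_le_coe.2 ?_
        simp only [hp]
        push_cast
        rwa [div_le_iff₀ (by positivity), mul_comm s]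
    · rintro ⟨j, hj, -⟩
      exact hj.trans ENNReal.coe_lt_top
  have hval : ∀ j, ∀ ω ∈ B (j + 1) \ B j, dyadicAfter k (σ ω).toNNReal = (p (j + 1) : ℝ≥0) := by
    intro j ω hω
    have h1 : σ ω < (p (j + 1) : ℝ≥0) := hω.1
    have h2 : ((p j : ℝ≥0) : ℝ≥0∞) ≤ σ ω := not_lt.1 hω.2
    have hs := ENNReal.coe_toNNReal (h1.trans ENNReal.coe_lt_top).ne
    set s := (σ ω).toNNReal
    rw [← hs, ENNReal.coe_lt_coe] at h1
    rw [← hs, ENNReal.coe_le_coe] at h2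
    simp only [hp] at h1 h2 ⊢
    push_cast at h1 h2 ⊢
    rw [lt_div_iff₀ (by positivity), mul_comm] at h1
    rw [div_le_iff₀ (by positivity), mul_comm] at h2
    have : ⌊2 ^ k * s⌋₊ = j := (Nat.floor_eq_iff (by positivity)).2 ⟨h2, h1⟩
    rw [dyadicAfter, this]
  have hdisj : Pairwise (Function.onFun Disjoint fun j => B (j + 1) \ B j) := by
    have key : ∀ i j, i < j → Disjoint (B (i + 1) \ B i) (B (j + 1) \ B j) := fun i j hij =>
      Set.disjoint_left.2 fun ω h1 h2 => h2.2 (hBm hij h1.1)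
    intro i j hij
    rcases lt_or_gt_of_ne hij with h | h
    · exact key i j h
    · exact (key j i h).symm
  rw [hU, lintegral_iUnion (fun j => (hBM _).diff (hBM _)) hdisj, ENNReal.tsum_eq_iSup_nat]
  refine iSup_le fun n => le_trans ?_ (hstep n)
  refine le_trans (Finset.sum_le_sum fun j _ => le_of_eq ?_) le_self_add
  exact setLIntegral_congr_fun ((hBM _).diff (hBM _)) fun ω hω => by simp only [hM, hval j ω hω]

/-- Optional stopping for a continuous excessive function. -/
lemma lintegral_killedPath_stopped_le (hDo : IsOpen D) (hDE : D ⊆ E₀) (hK : IsExhaustion K D)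
    (hf : ExcessiveOn Z D f) (hfc : ContinuousOn f D) (hx : x ∈ D) {σ : Ω → ℝ≥0∞}
    (hσ : ∀ u : ℝ≥0, MeasurableSet[Z.ℱ u] {ω | σ ω < u}) :
    ∫⁻ ω in {ω | σ ω < ⊤}, killedPath K (D.indicator f) (σ ω).toNNReal
      (fun t => Z.X t ω) ∂(Z.P x) ≤ f x := by
  have hσm := Z.measurable_of_isStoppingTime (Z.isStoppingTime_of_lt hσ)
  have hdm : ∀ k, Measurable (dyadicAfter k) := fun k => by
    unfold dyadicAfter
    fun_prop
  have hlim : ∀ᵐ ω ∂(Z.P x).restrict {ω | σ ω < ⊤},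
      ∀ c < killedPath K (D.indicator f) (σ ω).toNNReal (fun t => Z.X t ω), ∀ᶠ k in atTop,
        c < killedPath K (D.indicator f) (dyadicAfter k (σ ω).toNNReal) fun t => Z.X t ω := by
    filter_upwards [ae_restrict_of_ae (ae_eventually_lt_killedPath hDo hDE hK hfc hx)] with ω hω c hc
    exact (tendsto_dyadicAfter _).eventually (hω _ c hc)
  refine le_of_forall_lt fun c hc => ?_
  obtain ⟨k, hk⟩ := (eventually_lt_lintegral (fun k => Z.measurable_killedPath_comp
    (fun n => (hK.closed n).measurableSet) hf.1 ((hdm k).comp hσm.ennreal_toNNReal)) hlim hc).exists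
  exact hk.trans_le (lintegral_killedPath_dyadicAfter_le hDo hDE hK hf hx hσ k)

end StandardProcess

lemma killedPath_stopped {E : Type*} [MeasurableSpace E] {K : ℕ → Set E}
    (hK : ∀ n, MeasurableSet (K n)) (g : E → ℝ≥0∞) (u : ℝ≥0) (w : ℝ≥0 → E) :
    killedPath K g u (fun t => w (min t u)) = killedPath K g u w := by
  have h := (isPathTime_pathExit hK).lt_stopped_iff w u
  rcases lt_or_ge (pathExit K w) u with h1 | h1
  · rw [killedPath_of_lt h1, killedPath_of_lt (h.2 h1)]
  · rw [killedPath_of_le h1, killedPath_of_le (not_lt.1 fun h2 => h1.not_gt (h.1 h2)), min_self]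

/-! ### Excessive functions under the Kelvin transform -/

namespace DualInversionProperty

variable {E : Type*} [TopologicalSpace E] [MeasurableSpace E] {E₀ : Set E}
  {Ω Ω' : Type*} [MeasurableSpace Ω] [MeasurableSpace Ω'] {Z : StandardProcess E E₀ Ω}
  {Z' : StandardProcess E E₀ Ω'} {I : E → E} {h v : E → ℝ} {m : Measure E}
  [TopologicalSpace.MetrizableSpace E] [BorelSpace E] [CompactSpace E]
  (hD : DualInversionProperty Z Z' I h v m) {D : Set E} {K K' : ℕ → Set E} {f : E → ℝ≥0∞} {x : E}

include hD

/-- A nonzero weight puts the dual process in `E₀` at time `t`, hence also at any earlier exit from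
`I '' D`; at such exits the time computed from the sets `I ⁻¹' K n` coincides with the exit time. -/
lemma ae_weight_mul_killedPath (hE₀ : IsOpen E₀) (hDo : IsOpen D) (hDE : D ⊆ E₀)
    (hDo' : IsOpen (I '' D)) (hK : IsExhaustion K D) (hx : x ∈ D) (t : ℝ≥0) :
    ∀ᵐ ω ∂(Z'.P (I x)), {ω | (t : ℝ≥0∞) < exitTime Z'.X (I '' D) ω}.indicator
        (fun ω => ENNReal.ofReal (h (Z'.X t ω)) * f (I (Z'.X t ω))) ω =
      ENNReal.ofReal (h (Z'.X t ω)) * killedPath (fun n => I ⁻¹' K n)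
        (fun z => D.indicator f (I z)) t fun s => Z'.X s ω := by
  obtain ⟨K', hK'⟩ := exists_isExhaustion hDo'
  have hIx : I x ∈ I '' D := mem_image_of_mem I hx
  have hDE' := hD.image_subset hE₀ hDE
  filter_upwards [hD.ae_pathExit_le hE₀ hDo hDE hK hK' hx,
    hD.ae_pathExit_ge hE₀ hDo hDE hDo' hK hK' hx, Z'.pathExit_eq_exitTime hDE' hK' hIx,
    Z'.start (I x)] with ω h1 h2 h3 hstart
  rw [h3] at h1 h2
  by_cases hX : Z'.X t ω ∈ E₀
  swap
  · rw [hD.weight_eq_zero hX, zero_mul]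
    exact indicator_apply_eq_zero.2 fun _ => by simp only [hD.weight_eq_zero hX, zero_mul]
  rcases lt_trichotomy (t : ℝ≥0∞) (exitTime Z'.X (I '' D) ω) with hs | hs | hs
  · have hmem : I (Z'.X t ω) ∈ D := by
      rw [← hD.mem_image_iff]
      rcases eq_or_ne t 0 with rfl | h0
      · rwa [hstart]
      · exact mem_of_lt_exitTime (pos_iff_ne_zero.2 h0) hs
    rw [killedPath_of_le (hs.le.trans h1), indicator_of_mem hmem,
      indicator_of_mem (s := {ω | (t : ℝ≥0∞) < exitTime Z'.X (I '' D) ω}) hs]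
  · have hmem : I (Z'.X t ω) ∉ D := by
      rw [← hD.mem_image_iff]
      exact notMem_of_exitTime_eq (Z'.right_continuous ω) hDo' hs.symm
    rw [killedPath_of_le (hs.le.trans h1), indicator_of_notMem hmem, mul_zero,
      indicator_of_notMem (s := {ω | (t : ℝ≥0∞) < exitTime Z'.X (I '' D) ω}) hs.not_lt]
  · rw [indicator_of_notMem (s := {ω | (t : ℝ≥0∞) < exitTime Z'.X (I '' D) ω}) hs.not_gt]
    have hr := (ENNReal.coe_toNNReal (hs.trans ENNReal.coe_lt_top).ne).symm
    set r := (exitTime Z'.X (I '' D) ω).toNNReal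
    have hrt : r < t := by rw [hr] at hs; exact_mod_cast hs
    have h4 := h2 r hr (StandardProcess.mem_of_le_of_mem hrt.le hX)
    rw [killedPath_of_lt (h4.trans_lt (by exact_mod_cast hrt)), mul_zero]

/-- The clock is strictly increasing during the lifetime, so the time-changed path leaves `D` before
`t` exactly when the original path leaves it before `γ_t`. -/
lemma ae_killedPath_changed (hE₀ : IsOpen E₀) (hDo : IsOpen D) (hDE : D ⊆ E₀)
    (hK : IsExhaustion K D) (hx : x ∈ D) (t : ℝ≥0) :
    ∀ᵐ ω ∂(Z.P x), invClock Z v t ω < ⊤ →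
      killedPath (fun n => I ⁻¹' K n) (fun z => D.indicator f (I z)) t
        (fun s => I (Z.changed v s ω)) =
      killedPath K (D.indicator f) (invClock Z v t ω).toNNReal fun s => Z.X s ω := by
  filter_upwards [Z.ae_clock_lt_top hE₀ hD.v_pos hD.v_continuous (hDE hx),
    Z.pathExit_eq_exitTime hDE hK hx] with ω hfin hexit hγ
  have hr := (ENNReal.coe_toNNReal hγ.ne).symm
  have hm := hD.measurable_rate_path hE₀ ω
  obtain ⟨hXr, hcr⟩ := StandardProcess.of_invClock_eq hE₀ hfin hr
  have hval : Z.changed v t ω = Z.X (invClock Z v t ω).toNNReal ω := rfl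
  set r := (invClock Z v t ω).toNNReal
  have key : (pathExit K fun s => Z.changed v s ω) < t ↔ (pathExit K fun s => Z.X s ω) < r := by
    rw [hexit]
    constructor
    · intro hS
      have hS' := hS.trans ENNReal.coe_lt_top
      have hSt : (pathExit K fun s => Z.changed v s ω).toNNReal ≤ t := by
        simpa using ENNReal.toNNReal_mono ENNReal.coe_ne_top hS.le
      have hγ' : invClock Z v (pathExit K fun s => Z.changed v s ω).toNNReal ω < ⊤ :=
        (StandardProcess.invClock_mono Z v ω hSt).trans_lt hγ
      have hr' := (ENNReal.coe_toNNReal hγ'.ne).symm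
      refine (exitTime_le_of_invClock_pathExit hE₀ hD.v_pos hm hfin hK hexit hS' hr').trans_lt ?_
      have hc' := (StandardProcess.of_invClock_eq hE₀ hfin hr').2
      rw [ENNReal.coe_toNNReal hS'.ne] at hc'
      rw [ENNReal.coe_lt_coe]
      by_contra! hle
      have := Z.clock_mono v ω hle
      simp only [hcr, hc'] at this
      exact this.not_gt hS
    · intro hτ
      have hs := (ENNReal.coe_toNNReal (hτ.trans ENNReal.coe_lt_top).ne).symm
      set s := (exitTime Z.X D ω).toNNReal
      have hsr : s < r := by rw [hs] at hτ; exact_mod_cast hτ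
      have hXs := StandardProcess.mem_of_le_of_mem hsr.le hXr
      rw [(pathExit_changed_eq hE₀ hD.v_pos hm hfin hDo hK hexit hs hXs).1, ← hcr]
      exact StandardProcess.clock_lt_clock hE₀ hD.v_pos hm hXs (hfin s hXs) hsr
  rcases lt_or_ge (pathExit K fun s => Z.X s ω) r with h1 | h1
  · rw [killedPath_of_lt h1, killedPath_of_lt]
    rw [hD.pathExit_preimage]
    exact key.2 h1
  · rw [killedPath_of_le h1, killedPath_of_le, hD.involutive, hval]
    rw [hD.pathExit_preimage]
    exact not_lt.1 fun h2 => h1.not_gt (key.1 h2)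

/-- The killed semigroup of the dual process, expressed by the time-changed process. -/
lemma killedExpect_dual (hE₀ : IsOpen E₀) (hDo : IsOpen D) (hDE : D ⊆ E₀)
    (hDo' : IsOpen (I '' D)) (hK : IsExhaustion K D) (hf : Measurable (D.indicator f)) (hx : x ∈ D)
    (t : ℝ≥0) :
    killedExpect Z' (I '' D) (fun z => ENNReal.ofReal (h z) * f (I z)) t (I x) =
      ENNReal.ofReal (h (I x)) * ∫⁻ ω in {ω | invClock Z v t ω < ⊤},
        killedPath K (D.indicator f) (invClock Z v t ω).toNNReal (fun s => Z.X s ω) ∂(Z.P x) := by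
  have hKm : ∀ n, MeasurableSet (I ⁻¹' K n) := fun n => hD.measurable_I (hK.closed n).measurableSet
  have hcm := hD.change_of_measure hE₀ x t
    (measurable_killedPath hKm (hf.comp hD.measurable_I) t)
  have h1 : ∀ ω, killedPath (fun n => I ⁻¹' K n) (D.indicator f ∘ I) t
      (fun s => Z'.X (min s t) ω) = killedPath (fun n => I ⁻¹' K n) (D.indicator f ∘ I) t
        fun s => Z'.X s ω := fun ω => killedPath_stopped hKm _ t fun s => Z'.X s ω
  have h2 : ∀ ω, killedPath (fun n => I ⁻¹' K n) (D.indicator f ∘ I) t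
      (fun s => I (Z.changed v (min s t) ω)) = killedPath (fun n => I ⁻¹' K n) (D.indicator f ∘ I) t
        fun s => I (Z.changed v s ω) :=
    fun ω => killedPath_stopped hKm _ t fun s => I (Z.changed v s ω)
  simp only [h1, h2] at hcm
  rw [killedExpect, lintegral_congr_ae
    (hD.ae_weight_mul_killedPath hE₀ hDo hDE hDo' hK hx t)]
  refine hcm.trans ?_
  congr 1
  exact setLIntegral_congr_fun_ae (hD.measurableSet_alive hE₀ t)
    (hD.ae_killedPath_changed hE₀ hDo hDE hK hx t)

/-- The Kelvin transform preserves continuous excessive functions. -/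
theorem excessiveOn (hE₀ : IsOpen E₀) (hDo : IsOpen D) (hDE : D ⊆ E₀) (hI : ContinuousOn I E₀)
    (hfc : ContinuousOn f D) (hf : ExcessiveOn Z D f) :
    ExcessiveOn Z' (I '' D) fun z => ENNReal.ofReal (h z) * f (I z) := by
  have hDo' := hD.isOpen_image hE₀ hI hDo hDE
  obtain ⟨K, hK⟩ := exists_isExhaustion hDo
  refine ⟨?_, ?_⟩
  · convert hD.measurable_weight.mul (hf.1.comp hD.measurable_I) using 1
    ext z
    by_cases hz : I z ∈ D
    · simp [indicator_of_mem (hD.mem_image_iff.2 hz), hz]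
    · simp [indicator_of_notMem fun hz' => hz (hD.mem_image_iff.1 hz'), hz]
  rintro _ ⟨x, hx, rfl⟩
  set c := ENNReal.ofReal (h (I x)) with hc
  have hγm := fun t => Z.isStoppingTime_invClock hE₀ hD.v_pos hD.v_continuous t
  have hval : ∀ t, killedExpect Z' (I '' D) (fun z => ENNReal.ofReal (h z) * f (I z)) t (I x) =
      c * ∫⁻ ω in {ω | invClock Z v t ω < ⊤},
        killedPath K (D.indicator f) (invClock Z v t ω).toNNReal (fun s => Z.X s ω) ∂(Z.P x) :=
    hD.killedExpect_dual hE₀ hDo hDE hDo' hK hf.1 hx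
  -- Optional stopping at `γ_t`.
  have hle : ∀ t, ∫⁻ ω in {ω | invClock Z v t ω < ⊤},
      killedPath K (D.indicator f) (invClock Z v t ω).toNNReal (fun s => Z.X s ω) ∂(Z.P x) ≤ f x :=
    fun t => StandardProcess.lintegral_killedPath_stopped_le hDo hDE hK hf hfc hx (hγm t)
  simp only [hval, hD.involutive x]
  refine ⟨fun t => mul_le_mul_right (hle t) _, ?_⟩
  refine ENNReal.Tendsto.const_mul ?_ (Or.inr ENNReal.ofReal_ne_top)
  -- The upper bound holds for every `t`. The lower one is Fatou's lemma: `γ_t` decreases to `0`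
  -- through positive values, and the killed functional is lower semicontinuous from the right at
  -- `0`, with value `f x` there.
  refine tendsto_order.2 ⟨fun a ha => ?_, fun a ha => Eventually.of_forall fun t =>
    (hle t).trans_lt ha⟩
  have hm : ∀ t, Measurable ({ω | invClock Z v t ω < ⊤}.indicator fun ω =>
      killedPath K (D.indicator f) (invClock Z v t ω).toNNReal fun s => Z.X s ω) := fun t =>
    (Z.measurable_killedPath_comp (fun n => (hK.closed n).measurableSet) hf.1
      (hD.measurable_invClock hE₀ t).ennreal_toNNReal).indicator (hD.measurableSet_alive hE₀ t)
  simp only [← lintegral_indicator (hD.measurableSet_alive hE₀ _)]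
  refine eventually_lt_lintegral (μ := Z.P x) (G := fun _ => f x) hm ?_ (by simpa using ha)
  filter_upwards [StandardProcess.ae_eventually_lt_killedPath hDo hDE hK hfc hx,
    hD.ae_changed_zero hE₀ (hDE hx), Z.start x,
    Z.ae_clock_lt_top hE₀ hD.v_pos hD.v_continuous (hDE hx)] with ω hω h0 hstart hfin b hb
  have h1 := StandardProcess.tendsto_invClock hE₀ hD.v_pos (hD.measurable_rate_path hE₀ ω) hfin
    (u := 0) (by simp [h0.1])
  rw [h0.1, ENNReal.toNNReal_zero] at h1
  have h2 := hω 0 b (by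
    rwa [killedPath_of_le (by simp), hstart, indicator_of_mem hx])
  filter_upwards [h1.1, h1.2.eventually h2] with t ht1 ht2
  rwa [indicator_of_mem (s := {ω | invClock Z v t ω < ⊤}) ht1]

end DualInversionProperty

end KelvinDuality

theorem theorem2p3 {n : ℕ} (S : Set (EuclideanSpace ℝ (Fin n)))
    (hS_lc : LocallyCompactSpace S) (hS_unb : ¬ Bornology.IsBounded S) (hS_zero : 0 ∈ S)
    {Ω Ω' : Type*} [MeasurableSpace Ω] [MeasurableSpace Ω']
    (Z : KelvinDuality.StandardProcess (OnePoint S) (KelvinDuality.stateInterior S) Ω)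
    (Z' : KelvinDuality.StandardProcess (OnePoint S) (KelvinDuality.stateInterior S) Ω')
    (I : OnePoint S → OnePoint S) (h v : OnePoint S → ℝ) (m : Measure (OnePoint S))
    (hDIP : KelvinDuality.DualInversionProperty Z Z' I h v m)
    (D : Set (OnePoint S)) (hD : IsOpen D) (hD_int : D ⊆ KelvinDuality.stateInterior S) :
    -- regular harmonic functions
    (IsOpen (I '' D) →
      ∀ f : OnePoint S → ℝ, (∀ x ∉ KelvinDuality.stateInterior S, f x = 0) →
        KelvinDuality.RegularHarmonicOn Z D f →
        KelvinDuality.RegularHarmonicOn Z' (I '' D) (fun x => h x * f (I x))) ∧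
    -- superharmonic functions
    (ContinuousOn I (KelvinDuality.stateInterior S) →
      ∀ f : OnePoint S → EReal, (∀ x ∉ KelvinDuality.stateInterior S, f x = 0) →
        KelvinDuality.SuperharmonicOn Z D f →
        KelvinDuality.SuperharmonicOn Z' (I '' D) (fun x => (h x : EReal) * f (I x))) ∧
    -- continuous excessive functions
    (ContinuousOn I (KelvinDuality.stateInterior S) →
      ContinuousOn h (KelvinDuality.stateInterior S) →
      ∀ f : OnePoint S → ENNReal, ContinuousOn f D →
        KelvinDuality.ExcessiveOn Z D f →
        KelvinDuality.ExcessiveOn Z' (I '' D) (fun x => ENNReal.ofReal (h x) * f (I x))) := by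
  have hE₀ := KelvinDuality.isOpen_stateInterior S
  -- The compactification is compact, Hausdorff and second countable, hence metrizable, as the
  -- exhaustions and the measurability of limits require.
  have := KelvinDuality.secondCountableTopology_onePoint (X := S)
  have : TopologicalSpace.MetrizableSpace (OnePoint S) :=
    TopologicalSpace.metrizableSpace_of_t3_secondCountable _
  exact ⟨fun hID f hf0 hf => hDIP.regularHarmonicOn hE₀ hD hD_int hID hf0 hf,
    fun hI f hf0 hf => hDIP.superharmonicOn hE₀ hD_int hI hf0 hf,
    fun hI _ f hfc hf => hDIP.excessiveOn hE₀ hD hD_int hI hfc hf⟩
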